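/- Let $k$ be a field and let $H$ be a pointed Hopf algebra over $k$, i.e. every simple subcoalgebra of $H$ is one-dimensional. Let $\operatorname{corad}(H)=H_0$ be its coradical (the sum of all simple subcoalgebras), let $H_0\subseteq H_1\subseteq\cdots$ with $H_{n+1}=\Delta^{-1}(H_0\otimes H+H\otimes H_n)$ be its coradical filtration, and let $\operatorname{gr}_cH=\bigoplus_{n\ge 0}H_n/H_{n-1}$ (with $H_{-1}=0$) be the associated graded Hopf algebra. Let $\pi:\operatorname{gr}_cH\to\operatorname{corad}(H)$ be the projection onto degree zero and let $B=(\operatorname{gr}_cH)^{\operatorname{co}\pi}=\{a\in\operatorname{gr}_cH : (\mathrm{id}\otimes\pi)\Delta(a)=a\otimes 1\}$, with $B_n=B\cap(\operatorname{gr}_cH)_n$. If $\operatorname{gr}_cH$ is left or right Noetherian, then $\operatorname{corad}(H)$, $\operatorname{gr}_cH$, $H$ and $B$ are all affine, i.e. finitely generated as $k$-algebras. Here the algebra $B=\bigoplus_{n\ge0}B_n$, with $B_0=k1$, carries the structure of an $\mathbb N$-graded braided Hopf algebra in the category of left Yetter–Drinfel'd modules over $\operatorname{corad}(H)$ for which $\operatorname{gr}_cH$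 is isomorphic, as a graded Hopf algebra, to the Radford biproduct $B\,\sharp\operatorname{corad}(H)$ with grading $(B\,\sharp\operatorname{corad}(H))_n=B_n\otimes\operatorname{corad}(H)$. -/

import Mathlib

open scoped TensorProduct

noncomputable section

namespace PointedHopf

section Coalgebra

variable (k : Type*) {C : Type*} [Field k] [AddCommGroup C] [Module k C]

/-- For subspaces `X ⊆ C` and `Y ⊆ D`, the subspace `X ⊗ Y` of `C ⊗ D`. -/
def tensorSub {D : Type*} [AddCommGroup D] [Module k D] (X : Submodule k C) (Y : Submodule k D) :
    Submodule k (C ⊗[k] D) :=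
  Submodule.map₂ (TensorProduct.mk k C D) X Y

variable {k}

lemma tmul_mem_tensorSub {D : Type*} [AddCommGroup D] [Module k D] {X : Submodule k C}
    {Y : Submodule k D} {x : C} {y : D} (hx : x ∈ X) (hy : y ∈ Y) :
    x ⊗ₜ[k] y ∈ tensorSub k X Y :=
  Submodule.apply_mem_map₂ _ hx hy

lemma tensorSub_le {D : Type*} [AddCommGroup D] [Module k D] {X : Submodule k C}
    {Y : Submodule k D} {Z : Submodule k (C ⊗[k] D)} :
    tensorSub k X Y ≤ Z ↔ ∀ x ∈ X, ∀ y ∈ Y, x ⊗ₜ[k] y ∈ Z :=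
  Submodule.map₂_le

lemma tensorSub_mono {D : Type*} [AddCommGroup D] [Module k D] {X X' : Submodule k C}
    {Y Y' : Submodule k D} (hX : X ≤ X') (hY : Y ≤ Y') : tensorSub k X Y ≤ tensorSub k X' Y' :=
  Submodule.map₂_le_map₂ hX hY

lemma map_mem_tensorSub {D C' D' : Type*} [AddCommGroup D] [Module k D] [AddCommGroup C']
    [Module k C'] [AddCommGroup D'] [Module k D'] {X : Submodule k C} {Y : Submodule k D}
    {X' : Submodule k C'} {Y' : Submodule k D'} {f : C →ₗ[k] C'} {g : D →ₗ[k] D'}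
    (hf : ∀ x ∈ X, f x ∈ X') (hg : ∀ y ∈ Y, g y ∈ Y') {u : C ⊗[k] D}
    (hu : u ∈ tensorSub k X Y) : TensorProduct.map f g u ∈ tensorSub k X' Y' := by
  have : tensorSub k X Y ≤ (tensorSub k X' Y').comap (TensorProduct.map f g) := by
    rw [tensorSub_le]
    intro x hx y hy
    simpa using tmul_mem_tensorSub (hf x hx) (hg y hy)
  exact this hu

lemma mem_tensorSub_top {D : Type*} [AddCommGroup D] [Module k D] (u : C ⊗[k] D) :
    u ∈ tensorSub k (⊤ : Submodule k C) (⊤ : Submodule k D) := by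
  induction u with
  | zero => exact zero_mem _
  | tmul x y => exact tmul_mem_tensorSub trivial trivial
  | add x y hx hy => exact add_mem hx hy

lemma exists_proj (X : Submodule k C) :
    ∃ P : C →ₗ[k] C, (∀ x, P x ∈ X) ∧ ∀ x ∈ X, P x = x := by
  obtain ⟨g, hg⟩ := X.subtype.exists_leftInverse_of_injective X.ker_subtype
  refine ⟨X.subtype ∘ₗ g, fun x => (g x).2, fun x hx => ?_⟩
  simpa using congrArg Subtype.val (LinearMap.congr_fun hg ⟨x, hx⟩)

lemma exists_factor {V Z : Type*} [AddCommGroup V] [Module k V] [AddCommGroup Z] [Module k Z]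
    (T : C →ₗ[k] Z) (f : C →ₗ[k] V) (h : ∀ x, T x = 0 → f x = 0) :
    ∃ φ : Z →ₗ[k] V, f = φ ∘ₗ T := by
  obtain ⟨g, hg⟩ := ((LinearMap.ker T).liftQ T le_rfl).exists_leftInverse_of_injective
    (Submodule.ker_liftQ_eq_bot _ _ _ le_rfl)
  refine ⟨(LinearMap.ker T).liftQ f (fun x hx => h x hx) ∘ₗ g, ?_⟩
  ext x
  have := LinearMap.congr_fun hg ((LinearMap.ker T).mkQ x)
  simp only [LinearMap.comp_apply, Submodule.mkQ_apply, Submodule.liftQ_apply,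
    LinearMap.id_apply] at this
  simp only [LinearMap.comp_apply, this]
  rfl

lemma map_sub_left {D V W : Type*} [AddCommGroup D] [Module k D] [AddCommGroup V] [Module k V]
    [AddCommGroup W] [Module k W] (f f' : C →ₗ[k] V) (g : D →ₗ[k] W) (u : C ⊗[k] D) :
    TensorProduct.map (f - f') g u = TensorProduct.map f g u - TensorProduct.map f' g u := by
  induction u with
  | zero => simp
  | tmul x y => simp [TensorProduct.sub_tmul]
  | add x y hx hy => simp only [map_add, hx, hy]; abel

lemma map_sub_right {D V W : Type*} [AddCommGroup D] [Module k D] [AddCommGroup V] [Module k V]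
    [AddCommGroup W] [Module k W] (f : C →ₗ[k] V) (g g' : D →ₗ[k] W) (u : C ⊗[k] D) :
    TensorProduct.map f (g - g') u = TensorProduct.map f g u - TensorProduct.map f g' u := by
  induction u with
  | zero => simp
  | tmul x y => simp [TensorProduct.tmul_sub]
  | add x y hx hy => simp only [map_add, hx, hy]; abel

lemma map_eq_zero {D V W : Type*} [AddCommGroup D] [Module k D] [AddCommGroup V] [Module k V]
    [AddCommGroup W] [Module k W] {X : Submodule k C} {Y : Submodule k D} {f : C →ₗ[k] V}
    {g : D →ₗ[k] W} (h : (∀ x ∈ X, f x = 0) ∨ ∀ y ∈ Y, g y = 0) {u : C ⊗[k] D}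
    (hu : u ∈ tensorSub k X Y) : TensorProduct.map f g u = 0 := by
  have : tensorSub k X Y ≤ LinearMap.ker (TensorProduct.map f g) := by
    rw [tensorSub_le]
    intro x hx y hy
    rcases h with h | h
    · simp [h x hx]
    · simp [h y hy]
  exact this hu

lemma mem_of_map_mkQ_eq_zero {X Y : Submodule k C} {u : C ⊗[k] C}
    (hu : TensorProduct.map X.mkQ Y.mkQ u = 0) : u ∈ tensorSub k X ⊤ ⊔ tensorSub k ⊤ Y := by
  obtain ⟨P, hP, hP'⟩ := exists_proj X
  obtain ⟨R, hR, hR'⟩ := exists_proj Y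
  obtain ⟨φ, hφ⟩ := exists_factor X.mkQ (LinearMap.id - P)
    (fun x hx => by simp [hP' x (by simpa using hx)])
  obtain ⟨ψ, hψ⟩ := exists_factor Y.mkQ (LinearMap.id - R)
    (fun x hx => by simp [hR' x (by simpa using hx)])
  have h0 : TensorProduct.map (LinearMap.id - P) (LinearMap.id - R) u = 0 := by
    rw [hφ, hψ, TensorProduct.map_comp, LinearMap.comp_apply, hu, map_zero]
  have key : ∀ u : C ⊗[k] C, u - TensorProduct.map (LinearMap.id - P) (LinearMap.id - R) u ∈
      tensorSub k X ⊤ ⊔ tensorSub k ⊤ Y := by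
    intro u
    induction u with
    | zero => simp
    | add x y hx hy =>
      rw [map_add, add_sub_add_comm]
      exact add_mem hx hy
    | tmul a b =>
      have : a ⊗ₜ[k] b - TensorProduct.map (LinearMap.id - P) (LinearMap.id - R) (a ⊗ₜ[k] b) =
          P a ⊗ₜ[k] b + (a - P a) ⊗ₜ[k] R b := by
        simp only [TensorProduct.map_tmul, LinearMap.sub_apply, LinearMap.id_apply,
          TensorProduct.sub_tmul, TensorProduct.tmul_sub]
        abel
      rw [this]
      exact add_mem (Submodule.mem_sup_left (tmul_mem_tensorSub (hP a) trivial))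
        (Submodule.mem_sup_right (tmul_mem_tensorSub trivial (hR b)))
  simpa [h0] using key u

variable (k) [Coalgebra k C]

/-- A subspace `D` with `Δ(D) ⊆ D ⊗ D`. -/
def IsSubcoalgebra (D : Submodule k C) : Prop :=
  ∀ x ∈ D, Coalgebra.comul (R := k) x ∈ tensorSub k D D

/-- A nonzero subcoalgebra with no subcoalgebras but `0` and itself. -/
def IsSimpleSubcoalgebra (D : Submodule k C) : Prop :=
  IsSubcoalgebra k D ∧ D ≠ ⊥ ∧ ∀ E : Submodule k C, IsSubcoalgebra k E → E ≤ D → E = ⊥ ∨ E = D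

variable (C) in
/-- The coradical: the sum of all simple subcoalgebras. -/
def coradical : Submodule k C := sSup {D | IsSimpleSubcoalgebra k D}

variable (C) in
/-- A coalgebra is pointed if all its simple subcoalgebras are one-dimensional. -/
class IsPointed : Prop where
  finrank_eq_one : ∀ D : Submodule k C, IsSimpleSubcoalgebra k D → Module.finrank k D = 1

variable (C) in
/-- The coradical filtration: `C₀` is the coradical and
`Cₙ₊₁ = Δ⁻¹(C₀ ⊗ C + C ⊗ Cₙ)`. -/
def coradFilt : ℕ → Submodule k C
  | 0 => coradical k C
  | n + 1 => (tensorSub k (coradical k C) ⊤ ⊔ tensorSub k ⊤ (coradFilt n)).comap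
      (Coalgebra.comul (R := k) (A := C))

variable (C) in
/-- The preceding step of the coradical filtration: `Cₙ₋₁`, with `C₋₁ = 0`. -/
def coradPred : ℕ → Submodule k C
  | 0 => ⊥
  | n + 1 => coradFilt k C n


variable {k}

lemma isSubcoalgebra_coradical : IsSubcoalgebra k (coradical k C) := by
  have : coradical k C ≤ (tensorSub k (coradical k C) (coradical k C)).comap
      (Coalgebra.comul (R := k) (A := C)) := by
    refine sSup_le fun D hD x hx => ?_
    exact tensorSub_mono (le_sSup hD) (le_sSup hD) (hD.1 x hx)
  exact this

lemma mem_coradFilt_succ {n : ℕ} {x : C} : x ∈ coradFilt k C (n + 1) ↔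
    Coalgebra.comul (R := k) x ∈
      tensorSub k (coradical k C) ⊤ ⊔ tensorSub k ⊤ (coradFilt k C n) := Iff.rfl

lemma coradFilt_le_succ (n : ℕ) : coradFilt k C n ≤ coradFilt k C (n + 1) := by
  induction n with
  | zero =>
    intro x hx
    exact Submodule.mem_sup_left (tensorSub_mono le_rfl le_top (isSubcoalgebra_coradical x hx))
  | succ n ih =>
    exact Submodule.comap_mono (sup_le_sup le_rfl (tensorSub_mono le_rfl ih))

lemma coradFilt_mono : Monotone (coradFilt k C) := monotone_nat_of_le_succ coradFilt_le_succ

lemma coradPred_le (n : ℕ) : coradPred k C n ≤ coradFilt k C n := by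
  cases n with
  | zero => exact bot_le
  | succ n => exact coradFilt_le_succ n

lemma coradPred_mono : Monotone (coradPred k C) := by
  refine monotone_nat_of_le_succ fun n => ?_
  exact coradPred_le n

lemma coradFilt_le_coradPred {m n : ℕ} (h : m < n) : coradFilt k C m ≤ coradPred k C n := by
  cases n with
  | zero => omega
  | succ n => exact coradFilt_mono (by omega)

lemma map_comul_eq_zero_of_succ {V W : Type*} [AddCommGroup V] [Module k V] [AddCommGroup W]
    [Module k W] {n : ℕ} {f : C →ₗ[k] V} {g : C →ₗ[k] W} (hf : ∀ x ∈ coradical k C, f x = 0)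
    (hg : ∀ x ∈ coradFilt k C n, g x = 0) {x : C} (hx : x ∈ coradFilt k C (n + 1)) :
    TensorProduct.map f g (Coalgebra.comul (R := k) x) = 0 := by
  have : tensorSub k (coradical k C) ⊤ ⊔ tensorSub k ⊤ (coradFilt k C n) ≤
      LinearMap.ker (TensorProduct.map f g) :=
    sup_le (fun u hu => map_eq_zero (.inl hf) hu) (fun u hu => map_eq_zero (.inr hg) hu)
  exact this hx

/-- Coassociativity in the form `(f ⊗ (q ⊗ g)Δ)Δ = ((f ⊗ q)Δ ⊗ g)Δ`. -/
lemma map_comul_right {V W₁ W₂ : Type*} [AddCommGroup V] [Module k V] [AddCommGroup W₁]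
    [Module k W₁] [AddCommGroup W₂] [Module k W₂]
    (f : C →ₗ[k] V) (q : C →ₗ[k] W₁) (g : C →ₗ[k] W₂) (x : C) :
    TensorProduct.map f (TensorProduct.map q g ∘ₗ Coalgebra.comul) (Coalgebra.comul (R := k) x) =
      TensorProduct.assoc k V W₁ W₂
        (TensorProduct.map (TensorProduct.map f q ∘ₗ Coalgebra.comul) g
          (Coalgebra.comul (R := k) x)) := by
  have h1 : TensorProduct.map f (TensorProduct.map q g ∘ₗ Coalgebra.comul (R := k)) =
      TensorProduct.map f (TensorProduct.map q g) ∘ₗ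
        (Coalgebra.comul (R := k) (A := C)).lTensor C := by
    ext; simp
  have h2 : TensorProduct.map (TensorProduct.map f q ∘ₗ Coalgebra.comul (R := k)) g =
      TensorProduct.map (TensorProduct.map f q) g ∘ₗ
        (Coalgebra.comul (R := k) (A := C)).rTensor C := by
    ext; simp
  rw [h1, h2, LinearMap.comp_apply, LinearMap.comp_apply, ← Coalgebra.coassoc_apply,
    TensorProduct.map_map_assoc]

lemma map_comul_eq_zero_right {V W : Type*} [AddCommGroup V] [Module k V] [AddCommGroup W]
    [Module k W] {n : ℕ} (f : C →ₗ[k] V) {g : C →ₗ[k] W}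
    (hg : ∀ x ∈ coradFilt k C n, g x = 0) {x : C} (hx : x ∈ coradFilt k C n) :
    TensorProduct.map f g (Coalgebra.comul (R := k) x) = 0 := by
  cases n with
  | zero => exact map_eq_zero (.inr hg) (isSubcoalgebra_coradical x hx)
  | succ n =>
    obtain ⟨φ, rfl⟩ := exists_factor (TensorProduct.map (coradical k C).mkQ
      (coradFilt k C n).mkQ ∘ₗ Coalgebra.comul) g
      (fun x hx => hg x (mem_of_map_mkQ_eq_zero hx))
    rw [← LinearMap.id_comp f, TensorProduct.map_comp, LinearMap.comp_apply, map_comul_right]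
    have h0 : TensorProduct.map (TensorProduct.map f (coradical k C).mkQ ∘ₗ Coalgebra.comul)
        (coradFilt k C n).mkQ (Coalgebra.comul (R := k) x) = 0 := by
      refine map_comul_eq_zero_of_succ (n := n) (fun y hy => ?_) (by simp) hx
      exact map_eq_zero (Y := coradical k C) (.inr (by simp))
        (isSubcoalgebra_coradical y hy)
    rw [h0, map_zero, map_zero]

/-- If `f` kills `Cᵢ₋₁` and `g` kills `Cⱼ₋₁` then `(f ⊗ g) ∘ Δ` kills `Cᵢ₊ⱼ₋₁`. -/
lemma map_comul_eq_zero {i j : ℕ} {V W : Type*} [AddCommGroup V] [Module k V] [AddCommGroup W]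
    [Module k W] {f : C →ₗ[k] V} {g : C →ₗ[k] W} (hf : ∀ x ∈ coradPred k C i, f x = 0)
    (hg : ∀ x ∈ coradPred k C j, g x = 0) {x : C} (hx : x ∈ coradPred k C (i + j)) :
    TensorProduct.map f g (Coalgebra.comul (R := k) x) = 0 := by
  have main : ∀ (i : ℕ) {V : Type _} [AddCommGroup V] [Module k V] {f : C →ₗ[k] V}
      (_ : ∀ x ∈ coradPred k C i, f x = 0) {x : C} (_ : x ∈ coradPred k C (i + j)),
      TensorProduct.map f g (Coalgebra.comul (R := k) x) = 0 := by
    intro i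
    induction i with
    | zero =>
      intro V _ _ f hf x hx
      rw [zero_add] at hx
      cases j with
      | zero => rw [show x = 0 from hx]; simp
      | succ j => exact map_comul_eq_zero_right f hg hx
    | succ i ih =>
      intro V _ _ f hf x hx
      cases i with
      | zero =>
        cases j with
        | zero => exact map_eq_zero (.inl hf) (isSubcoalgebra_coradical x hx)
        | succ j =>
          rw [show 0 + 1 + (j + 1) = (j + 1) + 1 by omega] at hx
          exact map_comul_eq_zero_of_succ hf hg hx
      | succ i =>
        obtain ⟨φ, rfl⟩ := exists_factor (TensorProduct.map (coradical k C).mkQ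
          (coradFilt k C i).mkQ ∘ₗ Coalgebra.comul) f
          (fun x hx => hf x (mem_of_map_mkQ_eq_zero hx))
        have h0 : TensorProduct.map (coradical k C).mkQ (TensorProduct.map (coradFilt k C i).mkQ g
            ∘ₗ Coalgebra.comul) (Coalgebra.comul (R := k) x) = 0 := by
          rw [show i + 1 + 1 + j = (i + j + 1) + 1 by omega] at hx
          refine map_comul_eq_zero_of_succ (n := i + j) (by simp) (fun y hy => ?_) hx
          refine ih (fun z hz => (Submodule.Quotient.mk_eq_zero _).2 hz) ?_
          rwa [show i + 1 + j = (i + j) + 1 by omega]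
        rw [map_comul_right, LinearEquiv.map_eq_zero_iff] at h0
        rw [← LinearMap.id_comp g, TensorProduct.map_comp, LinearMap.comp_apply, h0, map_zero]
  have hf' : ∀ x ∈ coradPred k C i, (coradPred k C i).mkQ x = 0 := by simp
  obtain ⟨φ, rfl⟩ := exists_factor (coradPred k C i).mkQ f (fun x hx => hf x (by simpa using hx))
  rw [← LinearMap.id_comp g, TensorProduct.map_comp, LinearMap.comp_apply, main i hf' hx, map_zero]

variable (k C) in
/-- The tensor product filtration `∑_{i+j=n} Cᵢ ⊗ Cⱼ` of `C ⊗ C`. -/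
def tensorFilt (n : ℕ) : Submodule k (C ⊗[k] C) :=
  ⨆ p ∈ Finset.HasAntidiagonal.antidiagonal n, tensorSub k (coradFilt k C p.1) (coradFilt k C p.2)

lemma tensorSub_le_tensorFilt {i j n : ℕ} (h : i + j = n) :
    tensorSub k (coradFilt k C i) (coradFilt k C j) ≤ tensorFilt k C n :=
  le_iSup₂_of_le (i, j) (by simpa using h) le_rfl

lemma tensorFilt_le {n : ℕ} {Z : Submodule k (C ⊗[k] C)} (h : ∀ i j, i + j = n →
    ∀ x ∈ coradFilt k C i, ∀ y ∈ coradFilt k C j, x ⊗ₜ[k] y ∈ Z) : tensorFilt k C n ≤ Z :=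
  iSup₂_le fun p hp => tensorSub_le.2 (h p.1 p.2 (by simpa using hp))

lemma mem_tensorFilt_aux (n m : ℕ) (hm : m ≤ n + 1) (u : C ⊗[k] C)
    (hu : u ∈ tensorSub k (coradPred k C m) ⊤)
    (h : ∀ i j, i + j = n + 1 → i < m → ∀ f g : C →ₗ[k] C, (∀ x ∈ coradPred k C i, f x = 0) →
      (∀ x ∈ coradPred k C j, g x = 0) → TensorProduct.map f g u = 0) :
    u ∈ tensorFilt k C n := by
  induction m generalizing u with
  | zero =>
    have : tensorSub k (coradPred k C 0) (⊤ : Submodule k C) ≤ tensorFilt k C n := by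
      rw [tensorSub_le]
      intro x hx y _
      rw [show x = 0 from hx, TensorProduct.zero_tmul]
      exact zero_mem _
    exact this hu
  | succ m ih =>
    obtain ⟨P, hP, hP'⟩ := exists_proj (coradPred k C m)
    obtain ⟨R, hR, hR'⟩ := exists_proj (coradFilt k C (n - m))
    set v := TensorProduct.map (LinearMap.id - P) LinearMap.id u with hv
    have hv1 : v = TensorProduct.map LinearMap.id R v := by
      have h0 := h m (n - m + 1) (by omega) (by omega) (LinearMap.id - P) (LinearMap.id - R)
        (fun x hx => by simp [hP' x hx]) (fun x hx => by simp [hR' x hx])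
      have : TensorProduct.map (LinearMap.id - P) (LinearMap.id - R) u =
          v - TensorProduct.map LinearMap.id R v := by
        rw [hv, ← LinearMap.comp_apply (TensorProduct.map LinearMap.id R),
          ← TensorProduct.map_comp, LinearMap.id_comp, LinearMap.comp_id,
          map_sub_right]
      rw [this] at h0
      exact sub_eq_zero.1 h0
    have hv2 : v ∈ tensorSub k (coradFilt k C m) ⊤ :=
      map_mem_tensorSub (fun x hx => sub_mem hx (coradPred_le m (hP x))) (fun _ _ => Submodule.mem_top) hu
    have hv3 : v ∈ tensorSub k (coradFilt k C m) (coradFilt k C (n - m)) := by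
      rw [hv1]
      exact map_mem_tensorSub (fun x hx => hx) (fun y _ => hR y) hv2
    have huv : u = v + TensorProduct.map P LinearMap.id u := by
      rw [hv, map_sub_left]
      simp
    have h4 : TensorProduct.map P LinearMap.id u ∈ tensorFilt k C n := by
      refine ih (by omega) _ (map_mem_tensorSub (fun x _ => hP x) (fun _ _ => Submodule.mem_top) hu) ?_
      intro i j hij him f g hf hg
      have e : TensorProduct.map P LinearMap.id u = u - v := by rw [eq_sub_iff_add_eq']; exact huv.symm
      rw [e, map_sub, h i j hij (by omega) f g hf hg,
        map_eq_zero (.inr fun y hy => hg y (coradFilt_le_coradPred (by omega) hy)) hv3, sub_zero]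
    rw [huv]
    exact add_mem (tensorSub_le_tensorFilt (by omega) hv3) h4

/-- `Δ(Cₙ) ⊆ ∑_{i+j=n} Cᵢ ⊗ Cⱼ`. -/
lemma comul_mem_tensorFilt {n : ℕ} {x : C} (hx : x ∈ coradFilt k C n) :
    Coalgebra.comul (R := k) x ∈ tensorFilt k C n := by
  have key : ∀ i j, i + j = n + 1 → ∀ f g : C →ₗ[k] C, (∀ x ∈ coradPred k C i, f x = 0) →
      (∀ x ∈ coradPred k C j, g x = 0) →
      TensorProduct.map f g (Coalgebra.comul (R := k) x) = 0 := by
    intro i j hij f g hf hg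
    exact map_comul_eq_zero hf hg (by rw [hij]; exact hx)
  refine mem_tensorFilt_aux n (n + 1) le_rfl _ ?_ (fun i j hij _ => key i j hij)
  obtain ⟨P, hP, hP'⟩ := exists_proj (coradFilt k C n)
  have h0 := key (n + 1) 0 rfl (LinearMap.id - P) LinearMap.id (fun x hx => by simp [hP' x hx])
    (fun x hx => by rw [show x = 0 from hx, map_zero])
  rw [map_sub_left, TensorProduct.map_id, LinearMap.id_apply,
    sub_eq_zero] at h0
  rw [h0]
  exact map_mem_tensorSub (fun x _ => hP x) (fun _ _ => Submodule.mem_top) (mem_tensorSub_top _)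

end Coalgebra

section Hopf

open Coalgebra LinearMap WithConv HopfAlgebra

variable {k H : Type*} [Field k] [Ring H] [HopfAlgebra k H]

lemma antipode_conv_comul :
    (toConv (TensorProduct.map (antipode k) (antipode k) ∘ₗ
      (TensorProduct.comm k H H).toLinearMap ∘ₗ comul) : WithConv (H →ₗ[k] H ⊗[k] H)) *
        toConv comul = 1 := by
  apply WithConv.ext
  simp only [LinearMap.convMul_def, LinearMap.convOne_def, ofConv_toConv]
  let L : H ⊗[k] ((H ⊗[k] H) ⊗[k] H) →ₗ[k] H ⊗[k] H :=
    TensorProduct.map (mul' k H ∘ₗ (antipode k).rTensor H) (mul' k H ∘ₗ (antipode k).rTensor H) ∘ₗ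
      (TensorProduct.leftComm k H (H ⊗[k] H) H).toLinearMap
  have hL : mul' k (H ⊗[k] H) ∘ₗ TensorProduct.map (TensorProduct.map (antipode k) (antipode k) ∘ₗ
      (TensorProduct.comm k H H).toLinearMap) LinearMap.id = L ∘ₗ
      (TensorProduct.assoc k H H H).symm.toLinearMap.lTensor H ∘ₗ
        (TensorProduct.assoc k H H (H ⊗[k] H)).toLinearMap := by
    ext; simp [L]
  have h2 : (TensorProduct.assoc k H H H).symm.toLinearMap.lTensor H ∘ₗ
      (TensorProduct.assoc k H H (H ⊗[k] H)).toLinearMap ∘ₗ TensorProduct.map comul comul ∘ₗ comul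
      = (comul.rTensor H ∘ₗ comul).lTensor H ∘ₗ comul (R := k) (A := H) := by
    simp only [coassoc_simps]
  have h3 : L ∘ₗ (comul.rTensor H).lTensor H =
      TensorProduct.mk k H H 1 ∘ₗ mul' k H ∘ₗ (antipode k).rTensor H ∘ₗ
      ((TensorProduct.lid k H).toLinearMap ∘ₗ (counit (R := k) (A := H)).rTensor H).lTensor H := by
    ext a b c
    have := mul_antipode_rTensor_comul_apply (R := k) b
    simp [L, this, Algebra.algebraMap_eq_smul_one, TensorProduct.smul_tmul]
  clear_value L
  have h4 : (TensorProduct.lid k H).toLinearMap ∘ₗ (counit (R := k) (A := H)).rTensor H ∘ₗ comul =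
      LinearMap.id := by
    rw [Coalgebra.rTensor_counit_comp_comul]; ext; simp
  have h5 : TensorProduct.map (TensorProduct.map (antipode k) (antipode k) ∘ₗ
      (TensorProduct.comm k H H).toLinearMap ∘ₗ comul) (comul (R := k) (A := H)) =
      TensorProduct.map (TensorProduct.map (antipode k) (antipode k) ∘ₗ
      (TensorProduct.comm k H H).toLinearMap) LinearMap.id ∘ₗ TensorProduct.map comul comul := by
    rw [← TensorProduct.map_comp, LinearMap.id_comp, LinearMap.comp_assoc]
  rw [h5, LinearMap.comp_assoc, ← LinearMap.comp_assoc, hL, LinearMap.comp_assoc,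
    LinearMap.comp_assoc, h2, LinearMap.lTensor_comp, LinearMap.comp_assoc, ← LinearMap.comp_assoc,
    h3]
  have h6 : (TensorProduct.mk k H H 1 ∘ₗ mul' k H ∘ₗ (antipode k).rTensor H ∘ₗ
      ((TensorProduct.lid k H).toLinearMap ∘ₗ (counit (R := k) (A := H)).rTensor H).lTensor H) ∘ₗ
      (comul (R := k) (A := H)).lTensor H ∘ₗ comul = TensorProduct.mk k H H 1 ∘ₗ mul' k H ∘ₗ
      (antipode k).rTensor H ∘ₗ ((TensorProduct.lid k H).toLinearMap ∘ₗ
      (counit (R := k) (A := H)).rTensor H ∘ₗ comul).lTensor H ∘ₗ comul := by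
    simp only [LinearMap.comp_assoc, LinearMap.lTensor_comp]
  rw [h6, h4, LinearMap.lTensor_id, LinearMap.id_comp, HopfAlgebra.mul_antipode_rTensor_comul]
  ext x
  simp [Algebra.algebraMap_eq_smul_one, Algebra.TensorProduct.one_def]

/-- The antipode reverses the comultiplication. -/
lemma comul_antipode (x : H) : comul (R := k) (antipode k x) =
    TensorProduct.map (antipode k) (antipode k)
      (TensorProduct.comm k H H (comul (R := k) x)) := by
  have := left_inv_eq_right_inv (antipode_conv_comul (k := k) (H := H)) LinearMap.comul_right_inv
  exact (LinearMap.congr_fun (congrArg WithConv.ofConv this) x).symm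

lemma isSimple_span_groupLike {g : H} (hg : IsGroupLikeElem k g) :
    IsSimpleSubcoalgebra k (k ∙ g) := by
  refine ⟨?_, ?_, ?_⟩
  · intro x hx
    obtain ⟨c, rfl⟩ := Submodule.mem_span_singleton.1 hx
    rw [map_smul, hg.comul_eq_tmul_self]
    exact Submodule.smul_mem _ _ (tmul_mem_tensorSub (Submodule.mem_span_singleton_self g)
      (Submodule.mem_span_singleton_self g))
  · simpa using hg.ne_zero
  · intro E _ hE
    exact (nonzero_span_atom g hg.ne_zero).le_iff.1 hE

lemma groupLike_mem_coradical {g : H} (hg : IsGroupLikeElem k g) : g ∈ coradical k H :=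
  (le_sSup (show (k ∙ g) ∈ {D | IsSimpleSubcoalgebra k D} from isSimple_span_groupLike hg))
    (Submodule.mem_span_singleton_self g)

lemma exists_groupLike {D : Submodule k H} (hD : IsSubcoalgebra k D)
    (h1 : Module.finrank k D = 1) : ∃ g, IsGroupLikeElem k g ∧ D = k ∙ g := by
  obtain ⟨⟨v, hv⟩, hv0, hspan⟩ := finrank_eq_one_iff'.1 h1
  have hv0' : v ≠ 0 := fun h => hv0 (by simp [h])
  have hDv : D = k ∙ v := by
    apply le_antisymm
    · intro x hx
      obtain ⟨c, hc⟩ := hspan ⟨x, hx⟩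
      exact Submodule.mem_span_singleton.2 ⟨c, congrArg Subtype.val hc⟩
    · simpa using hv
  have h2 : tensorSub k D D ≤ k ∙ (v ⊗ₜ[k] v) := by
    rw [tensorSub_le]
    intro x hx y hy
    rw [hDv] at hx hy
    obtain ⟨a, rfl⟩ := Submodule.mem_span_singleton.1 hx
    obtain ⟨b, rfl⟩ := Submodule.mem_span_singleton.1 hy
    exact Submodule.mem_span_singleton.2 ⟨a * b, by rw [TensorProduct.smul_tmul_smul]⟩
  obtain ⟨c, hc⟩ := Submodule.mem_span_singleton.1 (h2 (hD v hv))
  have h3 : (c * counit (R := k) v) • v = v := by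
    have := Coalgebra.rTensor_counit_comul (R := k) v
    rw [← hc] at this
    have := congrArg (TensorProduct.lid k H) this
    simpa [smul_smul] using this
  have h4 : c * counit (R := k) v = 1 := by
    have : (c * counit (R := k) v - 1) • v = 0 := by rw [sub_smul, h3, one_smul, sub_self]
    exact sub_eq_zero.1 ((smul_eq_zero.1 this).resolve_right hv0')
  have hc0 : c ≠ 0 := fun h => by simp [h] at h4
  refine ⟨c • v, ⟨by simpa using h4, ?_⟩, ?_⟩
  · rw [map_smul, ← hc, TensorProduct.smul_tmul_smul, smul_smul]
  · rw [hDv, Submodule.span_singleton_smul_eq (IsUnit.mk0 c hc0)]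

lemma one_mem_coradical : (1 : H) ∈ coradical k H := groupLike_mem_coradical .one

lemma tensorFilt_le_wedge (n : ℕ) : tensorFilt k H n ≤
    tensorSub k (coradFilt k H 0) (coradFilt k H n) ⊔
      tensorSub k (coradFilt k H n) (coradPred k H n) := by
  refine tensorFilt_le fun i j hij x hx y hy => ?_
  rcases Nat.eq_zero_or_pos i with rfl | hi
  · rw [zero_add] at hij
    subst hij
    exact Submodule.mem_sup_left (tmul_mem_tensorSub hx hy)
  · exact Submodule.mem_sup_right (tmul_mem_tensorSub (coradFilt_mono (by omega) hx)
      (coradFilt_le_coradPred (by omega) hy))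

lemma mul_mem_of_forall {X X' Y Y' Z Z' : Submodule k H} (h1 : ∀ x ∈ X, ∀ y ∈ Y, x * y ∈ Z)
    (h2 : ∀ x ∈ X', ∀ y ∈ Y', x * y ∈ Z') {u v : H ⊗[k] H} (hu : u ∈ tensorSub k X X')
    (hv : v ∈ tensorSub k Y Y') : u * v ∈ tensorSub k Z Z' := by
  have : tensorSub k X X' ≤ (tensorSub k Z Z').comap ((LinearMap.mul k (H ⊗[k] H)).flip v) := by
    rw [tensorSub_le]
    intro x hx x' hx'
    have : tensorSub k Y Y' ≤
        (tensorSub k Z Z').comap (LinearMap.mul k (H ⊗[k] H) (x ⊗ₜ[k] x')) := by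
      rw [tensorSub_le]
      intro y hy y' hy'
      simpa using tmul_mem_tensorSub (h1 x hx y hy) (h2 x' hx' y' hy')
    exact this hv
  exact this hu

section Pointed

variable [IsPointed k H]

variable (k H) in
lemma coradical_eq_span : coradical k H = Submodule.span k {g | IsGroupLikeElem k g} := by
  apply le_antisymm
  · refine sSup_le fun D hD => ?_
    obtain ⟨g, hg, rfl⟩ := exists_groupLike hD.1 (IsPointed.finrank_eq_one D hD)
    exact Submodule.span_mono (by simpa using hg)
  · exact Submodule.span_le.2 fun g hg => groupLike_mem_coradical hg

lemma mul_mem_coradical {x y : H} (hx : x ∈ coradical k H) (hy : y ∈ coradical k H) :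
    x * y ∈ coradical k H := by
  rw [coradical_eq_span] at hx hy
  have := Submodule.mul_mem_mul hx hy
  rw [Submodule.span_mul_span] at this
  refine Submodule.span_le.2 ?_ this
  rintro _ ⟨g, hg, h, hh, rfl⟩
  exact groupLike_mem_coradical (hg.mul hh)

lemma antipode_mem_coradical {x : H} (hx : x ∈ coradical k H) :
    antipode k x ∈ coradical k H := by
  rw [coradical_eq_span] at hx
  have : Submodule.span k {g : H | IsGroupLikeElem k g} ≤
      (coradical k H).comap (antipode k) :=
    Submodule.span_le.2 fun g hg => groupLike_mem_coradical (IsGroupLikeElem.antipode hg)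
  exact this hx

/-- The coradical filtration of a pointed Hopf algebra is multiplicative. -/
lemma mul_mem_coradFilt {m n : ℕ} {x y : H} (hx : x ∈ coradFilt k H m)
    (hy : y ∈ coradFilt k H n) : x * y ∈ coradFilt k H (m + n) := by
  induction hN : m + n using Nat.strong_induction_on generalizing m n x y with
  | _ N ih =>
  cases N with
  | zero =>
    obtain ⟨rfl, rfl⟩ : m = 0 ∧ n = 0 := by omega
    exact mul_mem_coradical hx hy
  | succ N =>
    rw [mem_coradFilt_succ, Bialgebra.comul_mul]
    obtain ⟨u, hu, u', hu', e⟩ := Submodule.mem_sup.1 (tensorFilt_le_wedge m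
      (comul_mem_tensorFilt hx))
    obtain ⟨v, hv, v', hv', e'⟩ := Submodule.mem_sup.1 (tensorFilt_le_wedge n
      (comul_mem_tensorFilt hy))
    have hpred : ∀ {a b : ℕ}, a + b = N + 1 → ∀ x ∈ coradPred k H a, ∀ y ∈ coradFilt k H b,
        x * y ∈ coradFilt k H N := by
      intro a b hab x hx y hy
      cases a with
      | zero => rw [show x = 0 from hx, zero_mul]; exact zero_mem _
      | succ a => exact ih N (by omega) hx hy (by omega)
    have hpred' : ∀ {a b : ℕ}, a + b = N + 1 → ∀ x ∈ coradFilt k H a, ∀ y ∈ coradPred k H b,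
        x * y ∈ coradFilt k H N := by
      intro a b hab x hx y hy
      cases b with
      | zero => rw [show y = 0 from hy, mul_zero]; exact zero_mem _
      | succ b => exact ih N (by omega) hx hy (by omega)
    rw [← e, ← e', add_mul, mul_add, mul_add]
    refine add_mem (add_mem (Submodule.mem_sup_left ?_) (Submodule.mem_sup_right ?_))
      (add_mem (Submodule.mem_sup_right ?_) (Submodule.mem_sup_right ?_))
    · exact mul_mem_of_forall (fun _ ha _ hb => mul_mem_coradical ha hb)
        (fun _ _ _ _ => Submodule.mem_top) hu hv
    · exact mul_mem_of_forall (fun _ _ _ _ => Submodule.mem_top) (hpred' hN) hu hv'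
    · exact mul_mem_of_forall (fun _ _ _ _ => Submodule.mem_top) (hpred hN) hu' hv
    · exact mul_mem_of_forall (fun _ _ _ _ => Submodule.mem_top)
        (fun a ha b hb => hpred hN a ha b (coradPred_le n hb)) hu' hv'

lemma antipode_mem_coradFilt {n : ℕ} {x : H} (hx : x ∈ coradFilt k H n) :
    antipode k x ∈ coradFilt k H n := by
  induction n generalizing x with
  | zero => exact antipode_mem_coradical hx
  | succ n ih =>
    rw [mem_coradFilt_succ, comul_antipode]
    have : tensorFilt k H (n + 1) ≤ (tensorSub k (coradical k H) ⊤ ⊔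
        tensorSub k ⊤ (coradFilt k H n)).comap
        (TensorProduct.map (antipode k) (antipode k) ∘ₗ
          (TensorProduct.comm k H H).toLinearMap) := by
      refine tensorFilt_le fun i j hij x hx y hy => ?_
      simp only [Submodule.mem_comap, LinearMap.comp_apply, LinearEquiv.coe_coe,
        TensorProduct.comm_tmul, TensorProduct.map_tmul]
      rcases Nat.eq_zero_or_pos j with rfl | hj
      · exact Submodule.mem_sup_left
          (tmul_mem_tensorSub (antipode_mem_coradical hy) Submodule.mem_top)
      · exact Submodule.mem_sup_right
          (tmul_mem_tensorSub Submodule.mem_top (ih (coradFilt_mono (by omega) hx)))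
    exact this (comul_mem_tensorFilt hx)

end Pointed

end Hopf


section Graded

open Coalgebra HopfAlgebra

variable (k H : Type*) [Field k] [Ring H] [HopfAlgebra k H]

/-- The `n`-th homogeneous component `Hₙ / Hₙ₋₁` of the associated graded space. -/
abbrev grComp (n : ℕ) : Type _ :=
  coradFilt k H n ⧸ (coradPred k H n).submoduleOf (coradFilt k H n)

/-- The associated graded space `gr_c H = ⨁ₙ Hₙ / Hₙ₋₁` of the coradical filtration. -/
def GrC : Type _ := DirectSum ℕ (grComp k H)

instance : AddCommGroup (GrC k H) := inferInstanceAs (AddCommGroup (DirectSum ℕ (grComp k H)))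
instance : Module k (GrC k H) := inferInstanceAs (Module k (DirectSum ℕ (grComp k H)))

namespace GrC

/-- The inclusion of the `n`-th homogeneous component. -/
def incl (n : ℕ) : grComp k H n →ₗ[k] GrC k H := DirectSum.lof k ℕ (grComp k H) n

/-- The `n`-th homogeneous component of `gr_c H`, as a subspace. -/
def component (n : ℕ) : Submodule k (GrC k H) := LinearMap.range (incl k H n)

variable {k H}

/-- The class in `Hₙ / Hₙ₋₁ ⊆ gr_c H` of an element of `Hₙ`. -/
def cls (n : ℕ) : coradFilt k H n →ₗ[k] GrC k H :=
  incl k H n ∘ₗ ((coradPred k H n).submoduleOf (coradFilt k H n)).mkQ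

/-- The linear map out of `gr_c H` induced by maps `Hₙ → M` vanishing on `Hₙ₋₁`. -/
def lift {M : Type*} [AddCommGroup M] [Module k M] (f : ∀ n, coradFilt k H n →ₗ[k] M)
    (hf : ∀ n (x : coradFilt k H n), (x : H) ∈ coradPred k H n → f n x = 0) : GrC k H →ₗ[k] M :=
  DirectSum.toModule k ℕ M fun n =>
    ((coradPred k H n).submoduleOf (coradFilt k H n)).liftQ (f n) fun x hx => hf n x hx

@[simp]
lemma lift_cls {M : Type*} [AddCommGroup M] [Module k M] (f : ∀ n, coradFilt k H n →ₗ[k] M)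
    (hf : ∀ n (x : coradFilt k H n), (x : H) ∈ coradPred k H n → f n x = 0) (n : ℕ)
    (x : coradFilt k H n) : lift f hf (cls n x) = f n x := by
  unfold lift cls incl
  exact DirectSum.toModule_lof k n _

@[elab_as_elim]
lemma induction {p : GrC k H → Prop} (h0 : p 0) (hadd : ∀ a b, p a → p b → p (a + b))
    (h : ∀ n (x : coradFilt k H n), p (cls n x)) (a : GrC k H) : p a := by
  refine DirectSum.induction_on (β := grComp k H) (motive := p) a h0 (fun n x => ?_) hadd
  obtain ⟨x, rfl⟩ := Submodule.mkQ_surjective _ x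
  exact h n x

lemma hom_ext {M : Type*} [AddCommGroup M] [Module k M] {f g : GrC k H →ₗ[k] M}
    (h : ∀ n (x : coradFilt k H n), f (cls n x) = g (cls n x)) : f = g := by
  ext a
  induction a using induction with
  | h0 => simp
  | hadd a b ha hb => simp [ha, hb]
  | h n x => exact h n x

lemma cls_eq_zero {n : ℕ} {x : coradFilt k H n} (hx : (x : H) ∈ coradPred k H n) :
    cls n x = 0 := by
  have : ((coradPred k H n).submoduleOf (coradFilt k H n)).mkQ x = 0 := by
    exact (Submodule.Quotient.mk_eq_zero _).2 hx
  rw [cls, LinearMap.comp_apply, this, map_zero]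

lemma exists_symb (n : ℕ) : ∃ s : H →ₗ[k] GrC k H, s ∘ₗ (coradFilt k H n).subtype = cls n :=
  LinearMap.exists_extend _

/-- A linear extension to `H` of the class map `Hₙ → gr_c H`. -/
def symb (n : ℕ) : H →ₗ[k] GrC k H := (exists_symb n).choose

lemma symb_coe (n : ℕ) (x : coradFilt k H n) : symb (k := k) n (x : H) = cls n x :=
  LinearMap.congr_fun (exists_symb (k := k) (H := H) n).choose_spec x

lemma symb_eq_zero {n : ℕ} {x : H} (hx : x ∈ coradPred k H n) : symb (k := k) n x = 0 := by
  rw [symb_coe n ⟨x, coradPred_le n hx⟩]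
  exact cls_eq_zero hx

/-- On `∑_{i+j=n} Hᵢ ⊗ Hⱼ` this map sends `a ⊗ b` with `a ∈ Hᵢ`, `b ∈ Hⱼ`, `i + j = n` to
`[a] ⊗ [b]` with `[a] ∈ Hᵢ / Hᵢ₋₁`, `[b] ∈ Hⱼ / Hⱼ₋₁`. -/
def symb₂ (n : ℕ) : H ⊗[k] H →ₗ[k] GrC k H ⊗[k] GrC k H :=
  ∑ p ∈ Finset.HasAntidiagonal.antidiagonal n, TensorProduct.map (symb p.1) (symb p.2)

lemma symb₂_tmul {i j n : ℕ} (h : i + j = n) {a b : H} (ha : a ∈ coradFilt k H i)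
    (hb : b ∈ coradFilt k H j) :
    symb₂ n (a ⊗ₜ[k] b) = symb (k := k) i a ⊗ₜ[k] symb (k := k) j b := by
  rw [symb₂, LinearMap.sum_apply, Finset.sum_eq_single (i, j)]
  · simp
  · rintro ⟨i', j'⟩ hp hne
    rw [Finset.HasAntidiagonal.mem_antidiagonal] at hp
    simp only [TensorProduct.map_tmul]
    dsimp only at hp
    rcases lt_trichotomy i i' with h' | h' | h'
    · rw [symb_eq_zero (coradFilt_le_coradPred h' ha), TensorProduct.zero_tmul]
    · exact absurd (by ext <;> dsimp <;> omega) hne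
    · rw [symb_eq_zero (coradFilt_le_coradPred (by omega : j < j') hb), TensorProduct.tmul_zero]
  · intro h'
    exact absurd (Finset.HasAntidiagonal.mem_antidiagonal.2 h) h'

lemma symb₂_comul_eq_zero {n : ℕ} {x : H} (hx : x ∈ coradPred k H n) :
    symb₂ n (comul (R := k) x) = 0 := by
  rw [symb₂, LinearMap.sum_apply]
  refine Finset.sum_eq_zero fun p hp => ?_
  rw [Finset.HasAntidiagonal.mem_antidiagonal] at hp
  exact map_comul_eq_zero (i := p.1) (j := p.2) (fun y hy => symb_eq_zero hy)
    (fun y hy => symb_eq_zero hy) (by rwa [hp])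

lemma symb₂_eq_zero {m n : ℕ} (hmn : m < n) {u : H ⊗[k] H} (hu : u ∈ tensorFilt k H m) :
    symb₂ n u = 0 := by
  have : tensorFilt k H m ≤ LinearMap.ker (symb₂ (k := k) (H := H) n) := by
    refine tensorFilt_le fun i j hij x hx y hy => ?_
    rw [LinearMap.mem_ker,
      symb₂_tmul (i := i) (j := n - i) (by omega) hx (coradFilt_mono (by omega) hy),
      symb_eq_zero (coradFilt_le_coradPred (by omega : j < n - i) hy), TensorProduct.tmul_zero]
  exact this hu

/-- The coalgebra structure of `gr_c H`: for `x ∈ Hₙ`, writing `Δ(x)` as a sum of tensors `a ⊗ b`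
with `a ∈ Hᵢ`, `b ∈ Hⱼ` and `i + j = n`, `Δ[x]` is the sum of the `[a] ⊗ [b]`
(see `comul_cls_of_sum`); and `ε[x] = ε(x)` for `n = 0`, `ε[x] = 0` for `n > 0`. -/
instance : CoalgebraStruct k (GrC k H) where
  comul := lift (fun n => symb₂ n ∘ₗ comul ∘ₗ (coradFilt k H n).subtype)
    fun _ _ hx => symb₂_comul_eq_zero hx
  counit := lift (fun n => if n = 0 then counit ∘ₗ (coradFilt k H n).subtype else 0) (by
    rintro (_ | n) x hx
    · simp [show (x : H) = 0 from hx]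
    · simp)

lemma comul_cls (n : ℕ) (x : coradFilt k H n) :
    comul (R := k) (cls n x) = symb₂ n (comul (R := k) (x : H)) :=
  lift_cls _ _ n x

lemma comul_symb {n : ℕ} {x : H} (hx : x ∈ coradFilt k H n) :
    comul (R := k) (symb (k := k) n x) = symb₂ n (comul (R := k) x) := by
  rw [symb_coe n ⟨x, hx⟩, comul_cls]

lemma comul_cls_of_sum {n : ℕ} {x : coradFilt k H n} {ι : Type*} (s : Finset ι) (i j : ι → ℕ)
    (hij : ∀ t ∈ s, i t + j t = n) (a : ∀ t, coradFilt k H (i t)) (b : ∀ t, coradFilt k H (j t))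
    (h : comul (R := k) (x : H) = ∑ t ∈ s, (a t : H) ⊗ₜ[k] (b t : H)) :
    comul (R := k) (cls n x) = ∑ t ∈ s, cls (i t) (a t) ⊗ₜ[k] cls (j t) (b t) := by
  rw [comul_cls, h, map_sum]
  refine Finset.sum_congr rfl fun t ht => ?_
  rw [symb₂_tmul (hij t ht) (a t).2 (b t).2, symb_coe, symb_coe]

lemma counit_cls_zero (x : coradFilt k H 0) :
    counit (R := k) (cls 0 x) = counit (R := k) (x : H) := by
  refine (lift_cls _ _ 0 x).trans ?_
  simp

lemma counit_cls_pos {n : ℕ} (hn : n ≠ 0) (x : coradFilt k H n) :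
    counit (R := k) (cls n x) = 0 := by
  refine (lift_cls _ _ n x).trans ?_
  simp [hn]

lemma rTensor_comul_symb₂ {n : ℕ} {u : H ⊗[k] H} (hu : u ∈ tensorFilt k H n) :
    (comul (R := k) (A := GrC k H)).rTensor (GrC k H) (symb₂ n u) =
      (∑ p ∈ Finset.HasAntidiagonal.antidiagonal n,
        TensorProduct.map (symb₂ (k := k) (H := H) p.1) (symb p.2))
          ((comul (R := k) (A := H)).rTensor H u) := by
  have : tensorFilt k H n ≤ LinearMap.eqLocus
      ((comul (R := k) (A := GrC k H)).rTensor (GrC k H) ∘ₗ symb₂ n)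
      ((∑ p ∈ Finset.HasAntidiagonal.antidiagonal n,
        TensorProduct.map (symb₂ (k := k) (H := H) p.1) (symb p.2)) ∘ₗ
          (comul (R := k) (A := H)).rTensor H) := by
    refine tensorFilt_le fun i j hij x hx y hy => ?_
    rw [LinearMap.mem_eqLocus, LinearMap.comp_apply, LinearMap.comp_apply, symb₂_tmul hij hx hy,
      LinearMap.rTensor_tmul, LinearMap.rTensor_tmul, comul_symb hx, LinearMap.sum_apply,
      Finset.sum_eq_single (i, j)]
    · simp
    · rintro ⟨i', j'⟩ hp hne
      rw [Finset.HasAntidiagonal.mem_antidiagonal] at hp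
      simp only [TensorProduct.map_tmul]
      dsimp only at hp
      rcases lt_trichotomy i i' with h' | h' | h'
      · rw [symb₂_eq_zero h' (comul_mem_tensorFilt hx), TensorProduct.zero_tmul]
      · exact absurd (by ext <;> dsimp <;> omega) hne
      · rw [symb_eq_zero (coradFilt_le_coradPred (by omega : j < j') hy), TensorProduct.tmul_zero]
    · intro h'
      exact absurd (Finset.HasAntidiagonal.mem_antidiagonal.2 hij) h'
  exact this hu

lemma lTensor_comul_symb₂ {n : ℕ} {u : H ⊗[k] H} (hu : u ∈ tensorFilt k H n) :
    (comul (R := k) (A := GrC k H)).lTensor (GrC k H) (symb₂ n u) =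
      (∑ p ∈ Finset.HasAntidiagonal.antidiagonal n,
        TensorProduct.map (symb p.1) (symb₂ (k := k) (H := H) p.2))
          ((comul (R := k) (A := H)).lTensor H u) := by
  have : tensorFilt k H n ≤ LinearMap.eqLocus
      ((comul (R := k) (A := GrC k H)).lTensor (GrC k H) ∘ₗ symb₂ n)
      ((∑ p ∈ Finset.HasAntidiagonal.antidiagonal n,
        TensorProduct.map (symb p.1) (symb₂ (k := k) (H := H) p.2)) ∘ₗ
          (comul (R := k) (A := H)).lTensor H) := by
    refine tensorFilt_le fun i j hij x hx y hy => ?_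
    rw [LinearMap.mem_eqLocus, LinearMap.comp_apply, LinearMap.comp_apply, symb₂_tmul hij hx hy,
      LinearMap.lTensor_tmul, LinearMap.lTensor_tmul, comul_symb hy, LinearMap.sum_apply,
      Finset.sum_eq_single (i, j)]
    · simp
    · rintro ⟨i', j'⟩ hp hne
      rw [Finset.HasAntidiagonal.mem_antidiagonal] at hp
      simp only [TensorProduct.map_tmul]
      dsimp only at hp
      rcases lt_trichotomy i i' with h' | h' | h'
      · rw [symb_eq_zero (coradFilt_le_coradPred h' hx), TensorProduct.zero_tmul]
      · exact absurd (by ext <;> dsimp <;> omega) hne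
      · rw [symb₂_eq_zero (by omega : j < j') (comul_mem_tensorFilt hy), TensorProduct.tmul_zero]
    · intro h'
      exact absurd (Finset.HasAntidiagonal.mem_antidiagonal.2 hij) h'
  exact this hu

lemma assoc_symb₃ (n : ℕ) (w : (H ⊗[k] H) ⊗[k] H) :
    TensorProduct.assoc k (GrC k H) (GrC k H) (GrC k H)
      ((∑ p ∈ Finset.HasAntidiagonal.antidiagonal n,
        TensorProduct.map (symb₂ (k := k) (H := H) p.1) (symb p.2)) w) =
      (∑ p ∈ Finset.HasAntidiagonal.antidiagonal n,
        TensorProduct.map (symb p.1) (symb₂ (k := k) (H := H) p.2))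
          (TensorProduct.assoc k H H H w) := by
  have : (TensorProduct.assoc k (GrC k H) (GrC k H) (GrC k H)).toLinearMap ∘ₗ
      (∑ p ∈ Finset.HasAntidiagonal.antidiagonal n,
        TensorProduct.map (symb₂ (k := k) (H := H) p.1) (symb p.2)) =
      (∑ p ∈ Finset.HasAntidiagonal.antidiagonal n,
        TensorProduct.map (symb p.1) (symb₂ (k := k) (H := H) p.2)) ∘ₗ
          (TensorProduct.assoc k H H H).toLinearMap := by
    refine TensorProduct.ext_threefold fun a b c => ?_
    simp only [LinearMap.comp_apply, LinearMap.sum_apply, TensorProduct.map_tmul, symb₂,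
      LinearEquiv.coe_coe, TensorProduct.assoc_tmul, TensorProduct.sum_tmul, map_sum,
      TensorProduct.tmul_sum]
    rw [Finset.sum_sigma', Finset.sum_sigma']
    refine Finset.sum_bij' (fun t _ => ⟨(t.2.1, t.2.2 + t.1.2), (t.2.2, t.1.2)⟩)
      (fun t _ => ⟨(t.1.1 + t.2.1, t.2.2), (t.1.1, t.2.1)⟩) ?_ ?_ ?_ ?_ ?_
    case refine_5 => exact fun _ _ => rfl
    all_goals
      rintro ⟨⟨p₁, p₂⟩, ⟨q₁, q₂⟩⟩ ht
      rw [Finset.mem_sigma, Finset.HasAntidiagonal.mem_antidiagonal,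
        Finset.HasAntidiagonal.mem_antidiagonal] at ht
      obtain ⟨h₁, h₂⟩ := ht
      dsimp only at h₁ h₂
      subst h₁
      subst h₂
    · simp [add_assoc]
    · simp [add_assoc]
    · rfl
    · rfl
  exact LinearMap.congr_fun this w

instance : Coalgebra k (GrC k H) where
  coassoc := by
    refine hom_ext fun n x => ?_
    have hx := comul_mem_tensorFilt x.2
    simp only [LinearMap.comp_apply, LinearEquiv.coe_coe, comul_cls]
    rw [rTensor_comul_symb₂ hx, lTensor_comul_symb₂ hx, assoc_symb₃, Coalgebra.coassoc_apply]
  rTensor_counit_comp_comul := by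
    refine hom_ext fun n x => ?_
    have : tensorFilt k H n ≤ LinearMap.eqLocus
        ((counit (R := k) (A := GrC k H)).rTensor (GrC k H) ∘ₗ symb₂ n)
        ((symb (k := k) n).lTensor k ∘ₗ (counit (R := k) (A := H)).rTensor H) := by
      refine tensorFilt_le fun i j hij x hx y hy => ?_
      rw [LinearMap.mem_eqLocus, LinearMap.comp_apply, LinearMap.comp_apply, symb₂_tmul hij hx hy,
        LinearMap.rTensor_tmul, LinearMap.rTensor_tmul, LinearMap.lTensor_tmul,
        symb_coe i ⟨x, hx⟩]
      rcases Nat.eq_zero_or_pos i with rfl | hi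
      · rw [counit_cls_zero, show j = n by omega]
      · rw [counit_cls_pos hi.ne', symb_eq_zero (coradFilt_le_coradPred (by omega : j < n) hy),
          TensorProduct.zero_tmul, TensorProduct.tmul_zero]
    have h := this (comul_mem_tensorFilt x.2)
    rw [LinearMap.mem_eqLocus, LinearMap.comp_apply, LinearMap.comp_apply,
      Coalgebra.rTensor_counit_comul, LinearMap.lTensor_tmul, symb_coe] at h
    rw [LinearMap.comp_apply, comul_cls, h]
    rfl
  lTensor_counit_comp_comul := by
    refine hom_ext fun n x => ?_
    have : tensorFilt k H n ≤ LinearMap.eqLocus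
        ((counit (R := k) (A := GrC k H)).lTensor (GrC k H) ∘ₗ symb₂ n)
        ((symb (k := k) n).rTensor k ∘ₗ (counit (R := k) (A := H)).lTensor H) := by
      refine tensorFilt_le fun i j hij x hx y hy => ?_
      rw [LinearMap.mem_eqLocus, LinearMap.comp_apply, LinearMap.comp_apply, symb₂_tmul hij hx hy,
        LinearMap.lTensor_tmul, LinearMap.lTensor_tmul, LinearMap.rTensor_tmul,
        symb_coe j ⟨y, hy⟩]
      rcases Nat.eq_zero_or_pos j with rfl | hj
      · rw [counit_cls_zero, show i = n by omega]
      · rw [counit_cls_pos hj.ne', symb_eq_zero (coradFilt_le_coradPred (by omega : i < n) hx),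
          TensorProduct.zero_tmul, TensorProduct.tmul_zero]
    have h := this (comul_mem_tensorFilt x.2)
    rw [LinearMap.mem_eqLocus, LinearMap.comp_apply, LinearMap.comp_apply,
      Coalgebra.lTensor_counit_comul, LinearMap.rTensor_tmul, symb_coe] at h
    rw [LinearMap.comp_apply, comul_cls, h]
    rfl

end GrC

end Graded


section GradedHopf

open Coalgebra HopfAlgebra

variable {k H : Type*} [Field k] [Ring H] [HopfAlgebra k H]

lemma gradedMk_eq {m n : ℕ} (h : m = n) {x : coradFilt k H m} {y : coradFilt k H n}
    (hxy : (x : H) = y) : GradedMonoid.mk (A := grComp k H) m (Submodule.Quotient.mk x) =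
      GradedMonoid.mk n (Submodule.Quotient.mk y) := by
  subst h
  rw [Subtype.ext hxy]

variable [IsPointed k H]

lemma mul_mem_coradPred_left {m n : ℕ} {x y : H} (hx : x ∈ coradPred k H m)
    (hy : y ∈ coradFilt k H n) : x * y ∈ coradPred k H (m + n) := by
  cases m with
  | zero => rw [show x = 0 from hx, zero_mul]; exact zero_mem _
  | succ m =>
    rw [show m + 1 + n = m + n + 1 by omega]
    exact mul_mem_coradFilt hx hy

lemma mul_mem_coradPred_right {m n : ℕ} {x y : H} (hx : x ∈ coradFilt k H m)
    (hy : y ∈ coradPred k H n) : x * y ∈ coradPred k H (m + n) := by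
  cases n with
  | zero => rw [show y = 0 from hy, mul_zero]; exact zero_mem _
  | succ n => exact mul_mem_coradFilt hx hy

/-- The multiplication `Hₘ × Hₙ → Hₘ₊ₙ`. -/
def filtMul (m n : ℕ) : coradFilt k H m →ₗ[k] coradFilt k H n →ₗ[k] coradFilt k H (m + n) :=
  LinearMap.mk₂ k (fun x y => ⟨(x : H) * y, mul_mem_coradFilt x.2 y.2⟩)
    (fun _ _ _ => Subtype.ext (add_mul _ _ _)) (fun _ _ _ => Subtype.ext (smul_mul_assoc _ _ _))
    (fun _ _ _ => Subtype.ext (mul_add _ _ _)) (fun _ _ _ => Subtype.ext (mul_smul_comm _ _ _))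

/-- The multiplication `Hₘ / Hₘ₋₁ × Hₙ / Hₙ₋₁ → Hₘ₊ₙ / Hₘ₊ₙ₋₁` induced by that of `H`. -/
def grMul (m n : ℕ) : grComp k H m →ₗ[k] grComp k H n →ₗ[k] grComp k H (m + n) :=
  Submodule.liftQ _ (Submodule.liftQ _ ((filtMul m n).compr₂ (Submodule.mkQ _)).flip
    (fun y hy => by
      ext x
      exact (Submodule.Quotient.mk_eq_zero _).2 (mul_mem_coradPred_right x.2 hy))).flip
    (fun x hx => by
      ext y
      exact (Submodule.Quotient.mk_eq_zero _).2 (mul_mem_coradPred_left hx y.2))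

lemma grMul_mk {m n : ℕ} (x : coradFilt k H m) (y : coradFilt k H n) :
    grMul m n (Submodule.Quotient.mk x) (Submodule.Quotient.mk y) =
      Submodule.Quotient.mk ⟨(x : H) * y, mul_mem_coradFilt x.2 y.2⟩ := rfl

instance : GradedMonoid.GMul (grComp k H) where
  mul {m n} a b := grMul m n a b

instance : GradedMonoid.GOne (grComp k H) where
  one := Submodule.Quotient.mk ⟨1, one_mem_coradical⟩

instance : DirectSum.GRing (grComp k H) where
  mul_zero a := map_zero (grMul _ _ a)
  zero_mul b := by
    change grMul _ _ 0 b = 0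
    rw [map_zero, LinearMap.zero_apply]
  mul_add a b c := map_add (grMul _ _ a) b c
  add_mul a b c := by
    change grMul _ _ (a + b) c = grMul _ _ a c + grMul _ _ b c
    rw [map_add, LinearMap.add_apply]
  one_mul := by
    rintro ⟨n, a⟩
    obtain ⟨x, rfl⟩ := Submodule.Quotient.mk_surjective _ a
    exact gradedMk_eq (zero_add n) (one_mul (x : H))
  mul_one := by
    rintro ⟨n, a⟩
    obtain ⟨x, rfl⟩ := Submodule.Quotient.mk_surjective _ a
    exact gradedMk_eq (add_zero n) (mul_one (x : H))
  mul_assoc := by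
    rintro ⟨l, a⟩ ⟨m, b⟩ ⟨n, c⟩
    obtain ⟨x, rfl⟩ := Submodule.Quotient.mk_surjective _ a
    obtain ⟨y, rfl⟩ := Submodule.Quotient.mk_surjective _ b
    obtain ⟨z, rfl⟩ := Submodule.Quotient.mk_surjective _ c
    exact gradedMk_eq (add_assoc l m n) (mul_assoc (x : H) y z)
  natCast n := n • GradedMonoid.GOne.one
  natCast_zero := zero_smul _ _
  natCast_succ n := succ_nsmul _ n
  intCast n := n • GradedMonoid.GOne.one
  intCast_ofNat n := natCast_zsmul _ n
  intCast_negSucc_ofNat n := negSucc_zsmul _ n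

instance : DirectSum.GAlgebra k (grComp k H) where
  toFun := (LinearMap.toSpanSingleton k (grComp k H 0) GradedMonoid.GOne.one).toAddMonoidHom
  map_one := one_smul k (GradedMonoid.GOne.one : grComp k H 0)
  map_mul r s := by
    refine gradedMk_eq (x := (r * s) • ⟨1, one_mem_coradical⟩)
      (y := ⟨(r • (1 : H)) * (s • (1 : H)), _⟩) (zero_add 0).symm ?_
    simp [mul_smul, smul_comm r s]
  commutes r := by
    rintro ⟨n, a⟩
    obtain ⟨x, rfl⟩ := Submodule.Quotient.mk_surjective _ a
    refine gradedMk_eq (x := ⟨(r • (1 : H)) * x, _⟩) (y := ⟨x * (r • (1 : H)), _⟩)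
      (by omega) ?_
    simp
  smul_def r := by
    rintro ⟨n, a⟩
    obtain ⟨x, rfl⟩ := Submodule.Quotient.mk_surjective _ a
    refine gradedMk_eq (x := r • x) (y := ⟨(r • (1 : H)) * x, _⟩) (zero_add n).symm ?_
    simp

namespace GrC

instance : Ring (GrC k H) := inferInstanceAs (Ring (DirectSum ℕ (grComp k H)))
instance : Algebra k (GrC k H) := inferInstanceAs (Algebra k (DirectSum ℕ (grComp k H)))

lemma cls_mul_cls {m n : ℕ} (x : coradFilt k H m) (y : coradFilt k H n) :
    cls m x * cls n y = cls (m + n) ⟨(x : H) * y, mul_mem_coradFilt x.2 y.2⟩ :=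
  DirectSum.of_mul_of (A := grComp k H) _ _

lemma one_eq_cls : (1 : GrC k H) = cls 0 ⟨1, one_mem_coradical⟩ := rfl

lemma symb_mul_symb {m n : ℕ} {x y : H} (hx : x ∈ coradFilt k H m) (hy : y ∈ coradFilt k H n) :
    symb (k := k) m x * symb (k := k) n y = symb (k := k) (m + n) (x * y) := by
  rw [symb_coe m ⟨x, hx⟩, symb_coe n ⟨y, hy⟩, cls_mul_cls,
    symb_coe (m + n) ⟨x * y, mul_mem_coradFilt hx hy⟩]

lemma symb₂_mul {m n : ℕ} {u v : H ⊗[k] H} (hu : u ∈ tensorFilt k H m)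
    (hv : v ∈ tensorFilt k H n) :
    symb₂ (m + n) (u * v) = symb₂ (k := k) m u * symb₂ (k := k) n v := by
  have key : tensorFilt k H m ≤ LinearMap.eqLocus
      (symb₂ (k := k) (m + n) ∘ₗ (LinearMap.mul k (H ⊗[k] H)).flip v)
      ((LinearMap.mul k (GrC k H ⊗[k] GrC k H)).flip (symb₂ (k := k) n v) ∘ₗ symb₂ m) := by
    refine tensorFilt_le fun i j hij a ha b hb => ?_
    have key2 : tensorFilt k H n ≤ LinearMap.eqLocus
        (symb₂ (k := k) (m + n) ∘ₗ LinearMap.mul k (H ⊗[k] H) (a ⊗ₜ[k] b))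
        (LinearMap.mul k (GrC k H ⊗[k] GrC k H) (symb₂ (k := k) m (a ⊗ₜ[k] b)) ∘ₗ symb₂ n) := by
      refine tensorFilt_le fun i' j' hij' a' ha' b' hb' => ?_
      simp only [LinearMap.mem_eqLocus, LinearMap.comp_apply, LinearMap.mul_apply',
        Algebra.TensorProduct.tmul_mul_tmul]
      rw [symb₂_tmul (by omega : (i + i') + (j + j') = m + n) (mul_mem_coradFilt ha ha')
        (mul_mem_coradFilt hb hb'), symb₂_tmul hij ha hb, symb₂_tmul hij' ha' hb',
        Algebra.TensorProduct.tmul_mul_tmul, symb_mul_symb ha ha', symb_mul_symb hb hb']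
    exact key2 hv
  exact key hu

instance : Bialgebra k (GrC k H) :=
  Bialgebra.mk' k (GrC k H)
    (by rw [one_eq_cls, counit_cls_zero]; exact Bialgebra.counit_one)
    (fun {a b} => by
      induction a using induction with
      | h0 => simp
      | hadd a a' ha ha' => rw [add_mul, map_add, map_add, ha, ha', add_mul]
      | h m x =>
      induction b using induction with
      | h0 => simp
      | hadd b b' hb hb' => rw [mul_add, map_add, map_add, hb, hb', mul_add]
      | h n y =>
      rw [cls_mul_cls]
      rcases Nat.eq_zero_or_pos m with rfl | hm
      · rcases Nat.eq_zero_or_pos n with rfl | hn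
        · rw [counit_cls_zero, counit_cls_zero, counit_cls_zero]
          exact Bialgebra.counit_mul (x : H) (y : H)
        · rw [counit_cls_pos hn.ne' y, counit_cls_pos (by omega), mul_zero]
      · rw [counit_cls_pos hm.ne' x, counit_cls_pos (by omega), zero_mul])
    (by
      rw [one_eq_cls, comul_cls]
      dsimp only
      rw [Bialgebra.comul_one, Algebra.TensorProduct.one_def,
        symb₂_tmul (i := 0) (j := 0) rfl one_mem_coradical one_mem_coradical,
        symb_coe 0 ⟨1, one_mem_coradical⟩, ← one_eq_cls, Algebra.TensorProduct.one_def])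
    (fun {a b} => by
      induction a using induction with
      | h0 => simp
      | hadd a a' ha ha' => rw [add_mul, map_add, map_add, ha, ha', add_mul]
      | h m x =>
      induction b using induction with
      | h0 => simp
      | hadd b b' hb hb' => rw [mul_add, map_add, map_add, hb, hb', mul_add]
      | h n y =>
      rw [cls_mul_cls, comul_cls, comul_cls, comul_cls]
      dsimp only
      rw [Bialgebra.comul_mul,
        symb₂_mul (comul_mem_tensorFilt x.2) (comul_mem_tensorFilt y.2)])

lemma antipode_mem_coradPred {n : ℕ} {x : H} (hx : x ∈ coradPred k H n) :
    antipode k x ∈ coradPred k H n := by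
  cases n with
  | zero => rw [show x = 0 from hx, map_zero]; exact zero_mem _
  | succ n => exact antipode_mem_coradFilt hx

/-- The antipode of `gr_c H`: `S[x] = [S(x)]`. -/
instance : HopfAlgebraStruct k (GrC k H) where
  antipode := lift (fun n => cls n ∘ₗ (antipode k).restrict fun _ hx => antipode_mem_coradFilt hx)
    fun _ _ hx => cls_eq_zero (antipode_mem_coradPred hx)

lemma antipode_cls (n : ℕ) (x : coradFilt k H n) :
    antipode k (cls n x) = cls n ⟨antipode k (x : H), antipode_mem_coradFilt x.2⟩ :=
  lift_cls _ _ n x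

lemma antipode_symb {n : ℕ} {x : H} (hx : x ∈ coradFilt k H n) :
    antipode k (symb (k := k) n x) = symb (k := k) n (antipode k x) := by
  rw [symb_coe n ⟨x, hx⟩, antipode_cls, ← symb_coe]

lemma algebraMap_counit_cls (n : ℕ) (x : coradFilt k H n) :
    symb (k := k) n (algebraMap k H (counit (R := k) (x : H))) =
      algebraMap k (GrC k H) (counit (R := k) (cls n x)) := by
  rw [Algebra.algebraMap_eq_smul_one, Algebra.algebraMap_eq_smul_one, map_smul]
  rcases Nat.eq_zero_or_pos n with rfl | hn
  · rw [counit_cls_zero, symb_coe 0 ⟨1, one_mem_coradical⟩, ← one_eq_cls]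
  · rw [counit_cls_pos hn.ne', zero_smul,
      symb_eq_zero (coradFilt_le_coradPred hn one_mem_coradical), smul_zero]

/-- `gr_c H` as a Hopf algebra. -/
instance : HopfAlgebra k (GrC k H) where
  mul_antipode_rTensor_comul := by
    refine hom_ext fun n x => ?_
    have : tensorFilt k H n ≤ LinearMap.eqLocus
        (LinearMap.mul' k (GrC k H) ∘ₗ (antipode k).rTensor (GrC k H) ∘ₗ symb₂ n)
        (symb n ∘ₗ LinearMap.mul' k H ∘ₗ (antipode k).rTensor H) := by
      refine tensorFilt_le fun i j hij a ha b hb => ?_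
      subst hij
      simp only [LinearMap.mem_eqLocus, LinearMap.comp_apply]
      rw [symb₂_tmul rfl ha hb, LinearMap.rTensor_tmul, LinearMap.rTensor_tmul,
        LinearMap.mul'_apply, LinearMap.mul'_apply, antipode_symb ha,
        symb_mul_symb (antipode_mem_coradFilt ha) hb]
    have h := this (comul_mem_tensorFilt x.2)
    simp only [LinearMap.mem_eqLocus, LinearMap.comp_apply,
      HopfAlgebra.mul_antipode_rTensor_comul_apply] at h
    rw [LinearMap.comp_apply, LinearMap.comp_apply, comul_cls, h, algebraMap_counit_cls]
    rfl
  mul_antipode_lTensor_comul := by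
    refine hom_ext fun n x => ?_
    have : tensorFilt k H n ≤ LinearMap.eqLocus
        (LinearMap.mul' k (GrC k H) ∘ₗ (antipode k).lTensor (GrC k H) ∘ₗ symb₂ n)
        (symb n ∘ₗ LinearMap.mul' k H ∘ₗ (antipode k).lTensor H) := by
      refine tensorFilt_le fun i j hij a ha b hb => ?_
      subst hij
      simp only [LinearMap.mem_eqLocus, LinearMap.comp_apply]
      rw [symb₂_tmul rfl ha hb, LinearMap.lTensor_tmul, LinearMap.lTensor_tmul,
        LinearMap.mul'_apply, LinearMap.mul'_apply, antipode_symb hb,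
        symb_mul_symb ha (antipode_mem_coradFilt hb)]
    have h := this (comul_mem_tensorFilt x.2)
    simp only [LinearMap.mem_eqLocus, LinearMap.comp_apply,
      HopfAlgebra.mul_antipode_lTensor_comul_apply] at h
    rw [LinearMap.comp_apply, LinearMap.comp_apply, comul_cls, h, algebraMap_counit_cls]
    rfl

end GrC

end GradedHopf


section Corad

open Coalgebra HopfAlgebra

variable (k H : Type*) [Field k] [Ring H] [HopfAlgebra k H] [IsPointed k H]

/-- The coradical of a pointed Hopf algebra as a subalgebra. -/
def corad : Subalgebra k H where
  carrier := coradical k H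
  mul_mem' := mul_mem_coradical
  add_mem' := add_mem
  algebraMap_mem' r := by
    rw [Algebra.algebraMap_eq_smul_one]
    exact Submodule.smul_mem _ r one_mem_coradical

namespace corad

/-- The inclusion `corad(H) ⊗ corad(H) → H ⊗ H`. -/
def incl₂ : corad k H ⊗[k] corad k H →ₐ[k] H ⊗[k] H :=
  Algebra.TensorProduct.map (corad k H).val (corad k H).val

variable {k H}

lemma incl₂_tmul (x y : corad k H) : incl₂ k H (x ⊗ₜ[k] y) = (x : H) ⊗ₜ[k] (y : H) := rfl

variable (k H) in
lemma incl₂_injective : Function.Injective (incl₂ k H) :=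
  TensorProduct.map_injective_of_flat_flat (corad k H).val.toLinearMap
    (corad k H).val.toLinearMap Subtype.val_injective Subtype.val_injective

lemma comul_mem_range (x : corad k H) :
    comul (R := k) (x : H) ∈ LinearMap.range (incl₂ k H).toLinearMap := by
  have : tensorSub k (coradical k H) (coradical k H) ≤
      LinearMap.range (incl₂ k H).toLinearMap := by
    rw [tensorSub_le]
    intro x hx y hy
    exact ⟨(⟨x, hx⟩ : corad k H) ⊗ₜ[k] (⟨y, hy⟩ : corad k H), rfl⟩
  exact this (isSubcoalgebra_coradical _ x.2)

/-- The comultiplication and counit of `corad(H)` are the restrictions of those of `H`. -/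
instance : CoalgebraStruct k (corad k H) where
  comul := (LinearEquiv.ofInjective (incl₂ k H).toLinearMap (incl₂_injective k H)).symm.toLinearMap
    ∘ₗ LinearMap.codRestrict _ (comul ∘ₗ (corad k H).val.toLinearMap) comul_mem_range
  counit := counit ∘ₗ (corad k H).val.toLinearMap

lemma incl₂_comul (x : corad k H) : incl₂ k H (comul (R := k) x) = comul (R := k) (x : H) :=
  congrArg Subtype.val
    ((LinearEquiv.ofInjective (incl₂ k H).toLinearMap (incl₂_injective k H)).apply_symm_apply
      ⟨comul (R := k) (x : H), comul_mem_range x⟩)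

lemma counit_coe (x : corad k H) : counit (R := k) x = counit (R := k) (x : H) := rfl

instance : Coalgebra k (corad k H) where
  coassoc := by
    ext x
    have hinj : Function.Injective (TensorProduct.map (corad k H).val.toLinearMap
        (incl₂ k H).toLinearMap) :=
      TensorProduct.map_injective_of_flat_flat _ _ Subtype.val_injective (incl₂_injective k H)
    apply hinj
    have h1 : TensorProduct.map (corad k H).val.toLinearMap (incl₂ k H).toLinearMap ∘ₗ
        (TensorProduct.assoc k _ _ _).toLinearMap ∘ₗ (comul (R := k)).rTensor (corad k H) =
        (TensorProduct.assoc k H H H).toLinearMap ∘ₗ (comul (R := k)).rTensor H ∘ₗ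
          (incl₂ k H).toLinearMap := by
      have h0 : TensorProduct.map (corad k H).val.toLinearMap (incl₂ k H).toLinearMap ∘ₗ
          (TensorProduct.assoc k _ _ _).toLinearMap = (TensorProduct.assoc k H H H).toLinearMap ∘ₗ
          TensorProduct.map (incl₂ k H).toLinearMap (corad k H).val.toLinearMap :=
        TensorProduct.ext_threefold fun a b c => rfl
      rw [← LinearMap.comp_assoc, h0, LinearMap.comp_assoc]
      congr 1
      refine TensorProduct.ext' fun a b => ?_
      simp only [LinearMap.comp_apply, LinearMap.rTensor_tmul, TensorProduct.map_tmul,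
        AlgHom.toLinearMap_apply, incl₂_comul, incl₂_tmul]
      rfl
    have h2 : TensorProduct.map (corad k H).val.toLinearMap (incl₂ k H).toLinearMap ∘ₗ
        (comul (R := k)).lTensor (corad k H) = (comul (R := k)).lTensor H ∘ₗ
          (incl₂ k H).toLinearMap := by
      refine TensorProduct.ext' fun a b => ?_
      simp only [LinearMap.comp_apply, LinearMap.lTensor_tmul, TensorProduct.map_tmul,
        AlgHom.toLinearMap_apply, incl₂_comul, incl₂_tmul]
      rfl
    have e1 := LinearMap.congr_fun h1 (comul (R := k) x)
    have e2 := LinearMap.congr_fun h2 (comul (R := k) x)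
    simp only [LinearMap.comp_apply, AlgHom.toLinearMap_apply, incl₂_comul,
      LinearEquiv.coe_coe] at e1 e2 ⊢
    rw [e1, e2, Coalgebra.coassoc_apply]
  rTensor_counit_comp_comul := by
    ext x
    have hinj : Function.Injective ((corad k H).val.toLinearMap.lTensor k) :=
      Module.Flat.lTensor_preserves_injective_linearMap _ Subtype.val_injective
    apply hinj
    have h1 : (corad k H).val.toLinearMap.lTensor k ∘ₗ (counit (R := k)).rTensor (corad k H) =
        (counit (R := k)).rTensor H ∘ₗ (incl₂ k H).toLinearMap :=
      TensorProduct.ext' fun a b => rfl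
    have e1 := LinearMap.congr_fun h1 (comul (R := k) x)
    simp only [LinearMap.comp_apply, AlgHom.toLinearMap_apply, incl₂_comul] at e1 ⊢
    rw [e1, Coalgebra.rTensor_counit_comul]
    rfl
  lTensor_counit_comp_comul := by
    ext x
    have hinj : Function.Injective ((corad k H).val.toLinearMap.rTensor k) :=
      Module.Flat.rTensor_preserves_injective_linearMap _ Subtype.val_injective
    apply hinj
    have h1 : (corad k H).val.toLinearMap.rTensor k ∘ₗ (counit (R := k)).lTensor (corad k H) =
        (counit (R := k)).lTensor H ∘ₗ (incl₂ k H).toLinearMap :=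
      TensorProduct.ext' fun a b => rfl
    have e1 := LinearMap.congr_fun h1 (comul (R := k) x)
    simp only [LinearMap.comp_apply, AlgHom.toLinearMap_apply, incl₂_comul] at e1 ⊢
    rw [e1, Coalgebra.lTensor_counit_comul]
    rfl

instance : Bialgebra k (corad k H) :=
  Bialgebra.mk' k (corad k H)
    (Bialgebra.counit_one (R := k) (A := H))
    (fun {a b} => Bialgebra.counit_mul (R := k) (a : H) (b : H))
    (incl₂_injective k H (by
      rw [incl₂_comul, map_one]
      exact Bialgebra.comul_one (R := k) (A := H)))
    (fun {a b} => incl₂_injective k H (by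
      rw [map_mul (incl₂ k H), incl₂_comul, incl₂_comul, incl₂_comul]
      exact Bialgebra.comul_mul (R := k) (a : H) (b : H)))

/-- The antipode of `corad(H)` is the restriction of that of `H`. -/
instance : HopfAlgebraStruct k (corad k H) where
  antipode := LinearMap.restrict (p := Subalgebra.toSubmodule (corad k H))
    (q := Subalgebra.toSubmodule (corad k H)) (antipode k) fun _ hx => antipode_mem_coradical hx

lemma antipode_coe (x : corad k H) : (antipode k x : corad k H) = antipode k (x : H) := rfl

/-- `corad(H)` as a Hopf algebra. -/
instance : HopfAlgebra k (corad k H) where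
  mul_antipode_rTensor_comul := by
    ext x
    have h1 : (corad k H).val.toLinearMap ∘ₗ LinearMap.mul' k (corad k H) ∘ₗ
        (antipode k).rTensor (corad k H) = LinearMap.mul' k H ∘ₗ (antipode k).rTensor H ∘ₗ
          (incl₂ k H).toLinearMap := TensorProduct.ext' fun a b => rfl
    have e1 := LinearMap.congr_fun h1 (comul (R := k) x)
    simp only [LinearMap.comp_apply, AlgHom.toLinearMap_apply, incl₂_comul,
      HopfAlgebra.mul_antipode_rTensor_comul_apply] at e1
    exact e1
  mul_antipode_lTensor_comul := by
    ext x
    have h1 : (corad k H).val.toLinearMap ∘ₗ LinearMap.mul' k (corad k H) ∘ₗ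
        (antipode k).lTensor (corad k H) = LinearMap.mul' k H ∘ₗ (antipode k).lTensor H ∘ₗ
          (incl₂ k H).toLinearMap := TensorProduct.ext' fun a b => rfl
    have e1 := LinearMap.congr_fun h1 (comul (R := k) x)
    simp only [LinearMap.comp_apply, AlgHom.toLinearMap_apply, incl₂_comul,
      HopfAlgebra.mul_antipode_lTensor_comul_apply] at e1
    exact e1

end corad

namespace GrC

/-- The projection onto degree zero, as a linear map `gr_c H → H₀ = corad(H)`. -/
def projZeroLin : GrC k H →ₗ[k] corad k H :=
  lift (fun n => match n with
    | 0 => (LinearMap.id : coradFilt k H 0 →ₗ[k] coradFilt k H 0)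
    | _ + 1 => 0) (by
    rintro (_ | n) x hx
    · exact Subtype.ext hx
    · rfl)

variable {k H} in
lemma projZeroLin_cls_zero (x : coradFilt k H 0) : projZeroLin k H (cls 0 x) = ⟨x, x.2⟩ :=
  lift_cls _ _ 0 x

variable {k H} in
lemma projZeroLin_cls_pos {n : ℕ} (hn : n ≠ 0) (x : coradFilt k H n) :
    projZeroLin k H (cls n x) = 0 := by
  cases n with
  | zero => exact absurd rfl hn
  | succ n => exact lift_cls _ _ (n + 1) x

/-- The projection `π : gr_c H → corad(H)` onto degree zero. -/
def projZero : GrC k H →ₐ[k] corad k H :=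
  AlgHom.ofLinearMap (projZeroLin k H)
    (by rw [one_eq_cls, projZeroLin_cls_zero]; rfl)
    (fun a b => by
      induction a using induction with
      | h0 => simp
      | hadd a a' ha ha' => rw [add_mul, map_add, map_add, ha, ha', add_mul]
      | h m x =>
      induction b using induction with
      | h0 => simp
      | hadd b b' hb hb' => rw [mul_add, map_add, map_add, hb, hb', mul_add]
      | h n y =>
      rw [cls_mul_cls]
      rcases Nat.eq_zero_or_pos m with rfl | hm
      · rcases Nat.eq_zero_or_pos n with rfl | hn
        · rw [projZeroLin_cls_zero, projZeroLin_cls_zero, projZeroLin_cls_zero]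
          rfl
        · rw [projZeroLin_cls_pos hn.ne' y, projZeroLin_cls_pos (by omega), mul_zero]
      · rw [projZeroLin_cls_pos hm.ne' x, projZeroLin_cls_pos (by omega), zero_mul])

/-- The algebra `B = (gr_c H)^{co π} = {a | (id ⊗ π)Δ(a) = a ⊗ 1}` of right coinvariants of the
projection `π : gr_c H → corad(H)`. -/
def braidedPart : Subalgebra k (GrC k H) :=
  AlgHom.equalizer
    ((Algebra.TensorProduct.map (AlgHom.id k (GrC k H)) (projZero k H)).comp
      (Bialgebra.comulAlgHom k (GrC k H)))
    Algebra.TensorProduct.includeLeft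

/-- The subspace `Bₙ = B ∩ (gr_c H)ₙ` of `B`. -/
def braidedComponent (n : ℕ) : Submodule k (braidedPart k H) :=
  (component k H n).comap (braidedPart k H).val.toLinearMap

end GrC

end Corad


section YetterDrinfeld

open Coalgebra HopfAlgebra TensorProduct

variable (k K : Type*) [Field k] [Ring K] [HopfAlgebra k K]

/-- A linear action `h ⊗ v ↦ h · v` and a linear coaction `v ↦ v₍₋₁₎ ⊗ v₍₀₎` of `K` on `V`; the
axioms are in `YDData.IsYetterDrinfeld`. -/
structure YDData (V : Type*) [AddCommGroup V] [Module k V] where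
  act : K ⊗[k] V →ₗ[k] V
  coact : V →ₗ[k] K ⊗[k] V

namespace YDData

variable {k K} {V W : Type*} [AddCommGroup V] [Module k V] [AddCommGroup W] [Module k W]

/-- Left Yetter-Drinfel'd modules over `K`: left modules and left comodules with
`h₁ v₍₋₁₎ ⊗ h₂ · v₍₀₎ = (h₁ · v)₍₋₁₎ h₂ ⊗ (h₁ · v)₍₀₎`. -/
structure IsYetterDrinfeld (M : YDData k K V) : Prop where
  one_act : ∀ v, M.act (1 ⊗ₜ v) = v
  mul_act : ∀ g h v, M.act ((g * h) ⊗ₜ v) = M.act (g ⊗ₜ M.act (h ⊗ₜ v))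
  counit_coact : TensorProduct.lid k V ∘ₗ counit.rTensor V ∘ₗ M.coact = LinearMap.id
  coassoc_coact : TensorProduct.assoc k K K V ∘ₗ comul.rTensor V ∘ₗ M.coact =
    M.coact.lTensor K ∘ₗ M.coact
  compat :
    TensorProduct.map (LinearMap.mul' k K) M.act ∘ₗ
        TensorProduct.tensorTensorTensorComm k K K K V ∘ₗ TensorProduct.map comul M.coact =
      (LinearMap.mul' k K).rTensor V ∘ₗ TensorProduct.rightComm k K V K ∘ₗ
        M.coact.rTensor K ∘ₗ M.act.rTensor K ∘ₗ TensorProduct.rightComm k K K V ∘ₗ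
          (comul (R := k) (A := K)).rTensor V

/-- The tensor product: `h · (v ⊗ w) = h₁ · v ⊗ h₂ · w`,
`v ⊗ w ↦ v₍₋₁₎ w₍₋₁₎ ⊗ (v₍₀₎ ⊗ w₍₀₎)`. -/
def tensor (M : YDData k K V) (N : YDData k K W) : YDData k K (V ⊗[k] W) where
  act := TensorProduct.map M.act N.act ∘ₗ TensorProduct.tensorTensorTensorComm k K K V W ∘ₗ
    comul.rTensor (V ⊗[k] W)
  coact := (LinearMap.mul' k K).rTensor (V ⊗[k] W) ∘ₗ
    TensorProduct.tensorTensorTensorComm k K V K W ∘ₗ TensorProduct.map M.coact N.coact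

variable (k K) in
/-- The unit object `k`: `h · c = ε(h) c`, `c ↦ 1 ⊗ c`. -/
def unit : YDData k K k where
  act := TensorProduct.lid k k ∘ₗ counit.rTensor k
  coact := TensorProduct.mk k K k 1

/-- Linear maps compatible with the actions and the coactions. -/
structure IsHom (M : YDData k K V) (N : YDData k K W) (f : V →ₗ[k] W) : Prop where
  act : f ∘ₗ M.act = N.act ∘ₗ f.lTensor K
  coact : N.coact ∘ₗ f = f.lTensor K ∘ₗ M.coact

/-- The braiding `v ⊗ w ↦ v₍₋₁₎ · w ⊗ v₍₀₎`. -/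
def braiding (M : YDData k K V) (N : YDData k K W) : V ⊗[k] W →ₗ[k] W ⊗[k] V :=
  N.act.rTensor V ∘ₗ TensorProduct.rightComm k K V W ∘ₗ M.coact.rTensor W

end YDData

/-- `id ⊗ f ⊗ id`, with the four tensor factors bracketed in pairs. -/
def middle {k X Y M N P Q : Type*} [Field k] [AddCommGroup X] [Module k X] [AddCommGroup Y]
    [Module k Y] [AddCommGroup M] [Module k M] [AddCommGroup N] [Module k N] [AddCommGroup P]
    [Module k P] [AddCommGroup Q] [Module k Q] (f : M ⊗[k] N →ₗ[k] P ⊗[k] Q) :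
    (X ⊗[k] M) ⊗[k] (N ⊗[k] Y) →ₗ[k] (X ⊗[k] P) ⊗[k] (Q ⊗[k] Y) :=
  (TensorProduct.assoc k X P (Q ⊗[k] Y)).symm ∘ₗ
    ((TensorProduct.assoc k P Q Y).toLinearMap ∘ₗ f.rTensor Y ∘ₗ
      (TensorProduct.assoc k M N Y).symm.toLinearMap).lTensor X ∘ₗ
    TensorProduct.assoc k X M (N ⊗[k] Y)

/-- The data, besides the algebra structure of `B`, of a braided Hopf algebra over `K`: an action
and a coaction of `K`, a comultiplication, a counit and an antipode; the axioms are in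
`BraidedHopfData.IsBraidedHopfAlgebra`. -/
structure BraidedHopfData (B : Type*) [Ring B] [Algebra k B] extends YDData k K B where
  comul : B →ₗ[k] B ⊗[k] B
  counit : B →ₗ[k] k
  antipode : B →ₗ[k] B

namespace BraidedHopfData

variable {k K} {B : Type*} [Ring B] [Algebra k B]

/-- Hopf algebras in the braided category of left Yetter-Drinfel'd modules over `K`. -/
structure IsBraidedHopfAlgebra (D : BraidedHopfData k K B) : Prop where
  yetterDrinfeld : D.toYDData.IsYetterDrinfeld
  mul_hom : (D.toYDData.tensor D.toYDData).IsHom D.toYDData (LinearMap.mul' k B)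
  one_hom : (YDData.unit k K).IsHom D.toYDData (Algebra.linearMap k B)
  comul_hom : D.toYDData.IsHom (D.toYDData.tensor D.toYDData) D.comul
  counit_hom : D.toYDData.IsHom (YDData.unit k K) D.counit
  antipode_hom : D.toYDData.IsHom D.toYDData D.antipode
  coassoc : TensorProduct.assoc k B B B ∘ₗ D.comul.rTensor B ∘ₗ D.comul =
    D.comul.lTensor B ∘ₗ D.comul
  rTensor_counit_comul : TensorProduct.lid k B ∘ₗ D.counit.rTensor B ∘ₗ D.comul = LinearMap.id
  lTensor_counit_comul : TensorProduct.rid k B ∘ₗ D.counit.lTensor B ∘ₗ D.comul = LinearMap.id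
  counit_one : D.counit 1 = 1
  counit_mul : ∀ a b, D.counit (a * b) = D.counit a * D.counit b
  comul_one : D.comul 1 = 1 ⊗ₜ 1
  /-- The comultiplication is multiplicative for the braided product on `B ⊗ B`. -/
  comul_mul : D.comul ∘ₗ LinearMap.mul' k B =
    TensorProduct.map (LinearMap.mul' k B) (LinearMap.mul' k B) ∘ₗ
      middle (D.toYDData.braiding D.toYDData) ∘ₗ TensorProduct.map D.comul D.comul
  mul_antipode_rTensor : LinearMap.mul' k B ∘ₗ D.antipode.rTensor B ∘ₗ D.comul =
    Algebra.linearMap k B ∘ₗ D.counit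
  mul_antipode_lTensor : LinearMap.mul' k B ∘ₗ D.antipode.lTensor B ∘ₗ D.comul =
    Algebra.linearMap k B ∘ₗ D.counit

/-- The subspaces `Bₙ` form an `ℕ`-grading of `B` respected by all the structure maps. -/
structure IsGraded (D : BraidedHopfData k K B) (𝓑 : ℕ → Submodule k B) : Prop where
  isInternal : DirectSum.IsInternal 𝓑
  one_mem : 1 ∈ 𝓑 0
  mul_mem : ∀ m n, ∀ a ∈ 𝓑 m, ∀ b ∈ 𝓑 n, a * b ∈ 𝓑 (m + n)
  act_mem : ∀ n h, ∀ b ∈ 𝓑 n, D.act (h ⊗ₜ b) ∈ 𝓑 n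
  coact_mem : ∀ n, ∀ b ∈ 𝓑 n, D.coact b ∈ tensorSub k ⊤ (𝓑 n)
  comul_mem : ∀ n, ∀ b ∈ 𝓑 n,
    D.comul b ∈ ⨆ p ∈ Finset.HasAntidiagonal.antidiagonal n, tensorSub k (𝓑 p.1) (𝓑 p.2)
  counit_eq_zero : ∀ n, n ≠ 0 → ∀ b ∈ 𝓑 n, D.counit b = 0
  antipode_mem : ∀ n, ∀ b ∈ 𝓑 n, D.antipode b ∈ 𝓑 n

/-- The multiplication `(b ♯ h)(b' ♯ h') = b (h₁ · b') ♯ h₂ h'` of the Radford biproduct `B ♯ K`,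
whose underlying space is `B ⊗ K`. -/
def biproductMul (D : BraidedHopfData k K B) :
    (B ⊗[k] K) ⊗[k] (B ⊗[k] K) →ₗ[k] B ⊗[k] K :=
  TensorProduct.map (LinearMap.mul' k B) (LinearMap.mul' k K) ∘ₗ
    middle (D.act.rTensor K ∘ₗ TensorProduct.rightComm k K K B ∘ₗ
      (Coalgebra.comul (R := k) (A := K)).rTensor B)

/-- The comultiplication
`b ♯ h ↦ (b⁽¹⁾ ♯ (b⁽²⁾)₍₋₁₎ h₁) ⊗ ((b⁽²⁾)₍₀₎ ♯ h₂)` of the Radford biproduct `B ♯ K`. -/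
def biproductComul (D : BraidedHopfData k K B) :
    B ⊗[k] K →ₗ[k] (B ⊗[k] K) ⊗[k] (B ⊗[k] K) :=
  middle ((LinearMap.mul' k K).rTensor B ∘ₗ TensorProduct.rightComm k K B K ∘ₗ
      D.coact.rTensor K) ∘ₗ
    TensorProduct.map D.comul (Coalgebra.comul (R := k) (A := K))

/-- The counit `b ♯ h ↦ ε(b) ε(h)` of the Radford biproduct `B ♯ K`. -/
def biproductCounit (D : BraidedHopfData k K B) : B ⊗[k] K →ₗ[k] k :=
  TensorProduct.lid k k ∘ₗ TensorProduct.map D.counit (Coalgebra.counit (R := k) (A := K))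

/-- A bijection `B ♯ K ≃ A` which is an isomorphism of graded Hopf algebras, where `B ♯ K` has
the unit `1 ♯ 1` and the grading `(B ♯ K)ₙ = Bₙ ⊗ K`. As `A` is a Hopf algebra, such a map also
carries the antipode of `B ♯ K` to that of `A`. -/
structure IsBiproductIso {A : Type*} [Ring A] [HopfAlgebra k A] (D : BraidedHopfData k K B)
    (𝓑 : ℕ → Submodule k B) (𝓐 : ℕ → Submodule k A) (Φ : B ⊗[k] K ≃ₗ[k] A) : Prop where
  map_one : Φ (1 ⊗ₜ 1) = 1
  map_mul : Φ.toLinearMap ∘ₗ D.biproductMul =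
    LinearMap.mul' k A ∘ₗ TensorProduct.map Φ.toLinearMap Φ.toLinearMap
  map_comul : Coalgebra.comul ∘ₗ Φ.toLinearMap =
    TensorProduct.map Φ.toLinearMap Φ.toLinearMap ∘ₗ D.biproductComul
  map_counit : Coalgebra.counit ∘ₗ Φ.toLinearMap = D.biproductCounit
  map_grading : ∀ n, (tensorSub k (𝓑 n) ⊤).map Φ.toLinearMap = 𝓐 n

end BraidedHopfData

end YetterDrinfeld

end PointedHopf

end

noncomputable section

namespace PointedHopf

/-! ### Comodules over a coalgebra spanned by group-like elements -/

section GroupLikeSpan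

open Coalgebra HopfAlgebra

variable {k K V W : Type*} [Field k] [AddCommGroup V] [Module k V] [AddCommGroup W] [Module k W]

section Coalgebra

variable [AddCommGroup K] [Module k K] [Coalgebra k K]

/-! Write A for the associated graded Hopf algebra, K for the coradical, π : A → K for the
projection and ι : K → A for the inclusion of degree zero. As H is pointed, K is spanned by
group-like elements, which form a basis. A comodule over K is therefore a space graded by the group
of group-likes, and A is the sum of the subspaces B ι(g) (`mem_span_mul_incl`). Radford's theorem is
proved in this setting: p(a) = a₁ ιSπ(a₂) projects A onto B, sends b ι(g) to b, and identifies B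
with A / AK⁺. Identities on A are checked on elements b ι(g), and identities on K at group-likes,
where Δ is diagonal and the action on B is conjugation (`isBraidedHopfAlgebra`, `isBiproductIso`).
Since π kills positive degrees, p is graded and all structure maps of B respect the grading
(`isGraded`).

For finiteness, K is a quotient of A, hence Noetherian on the same side. Finitely many g - 1 then
generate its augmentation ideal, and this forces the corresponding g to generate the group
(`finiteType_of_span_groupLike`). A Noetherian graded algebra is generated by degree zero together
with finitely many homogeneous generators of its irrelevant ideal (`finiteType_of_graded`), so A is
affine. B inherits the Noetherian property as a B-bimodule summand of A
(`exists_bimodule_retraction`) and has B₀ = k, so B is affine too.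

Finally, representatives in H of generators of A generate H (`finiteType_of_grC`), by induction
along the coradical filtration. This needs the filtration to be exhaustive (`exists_mem_coradFilt`),
which is proved through finite-dimensional left coideals and the fact that simple left coideals lie
in the coradical. -/

/-- The basis of group-like elements of a coalgebra which they span. -/
def groupLikeBasis (hK : Submodule.span k {g : K | IsGroupLikeElem k g} = ⊤) :
    Module.Basis (GroupLike k K) k K :=
  Module.Basis.mk (linearIndep_groupLikeVal (R := k) (A := K)) (by
    rw [← hK]
    refine Submodule.span_mono fun g hg => ⟨⟨g, hg⟩, rfl⟩)

lemma groupLikeBasis_apply (hK : Submodule.span k {g : K | IsGroupLikeElem k g} = ⊤)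
    (g : GroupLike k K) : groupLikeBasis hK g = g.val :=
  Module.Basis.mk_apply _ _ g

/-- With this and the two-variable versions, identities involving Δ on K need only be checked where
Δ(g) = g ⊗ g. -/
lemma hom_ext_groupLike (hK : Submodule.span k {g : K | IsGroupLikeElem k g} = ⊤)
    {f f' : K →ₗ[k] V} (h : ∀ g, IsGroupLikeElem k g → f g = f' g) : f = f' :=
  LinearMap.ext_on hK fun g hg => h g hg

lemma tensor_ext_groupLike (hK : Submodule.span k {g : K | IsGroupLikeElem k g} = ⊤)
    {f f' : K ⊗[k] V →ₗ[k] W} (h : ∀ g, IsGroupLikeElem k g → ∀ v, f (g ⊗ₜ v) = f' (g ⊗ₜ v)) :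
    f = f' := by
  refine TensorProduct.ext (hom_ext_groupLike hK fun g hg => ?_)
  ext v
  exact h g hg v

/-- A right comodule over a coalgebra spanned by group-like elements is spanned by homogeneous
elements. -/
lemma mem_span_homogeneous (hK : Submodule.span k {g : K | IsGroupLikeElem k g} = ⊤)
    (ρ : V →ₗ[k] V ⊗[k] K) (hε : ∀ v, TensorProduct.rid k V (counit.lTensor V (ρ v)) = v)
    (hρ : ∀ v, TensorProduct.assoc k V K K (ρ.rTensor K (ρ v)) = comul.lTensor V (ρ v)) (v : V) :
    v ∈ Submodule.span k {x | ∃ g, IsGroupLikeElem k g ∧ ρ x = x ⊗ₜ g} := by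
  classical
  set b := groupLikeBasis hK
  obtain ⟨x, hx⟩ := (TensorProduct.equivFinsuppOfBasisRight (M := V) b).symm.surjective (ρ v)
  rw [TensorProduct.equivFinsuppOfBasisRight_symm_apply] at hx
  -- Expand ρ(v) = ∑ x_g ⊗ g in the basis of group-likes; the counit axiom gives v = ∑ x_g.
  have hv : v = ∑ g ∈ x.support, x g := by
    conv_lhs => rw [← hε v, ← hx]
    simp only [Finsupp.sum, map_sum, LinearMap.lTensor_tmul, TensorProduct.rid_tmul]
    exact Finset.sum_congr rfl fun g _ => by
      rw [groupLikeBasis_apply, g.2.counit_eq_one, one_smul]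
  rw [hv]
  refine sum_mem fun g _ => Submodule.subset_span ⟨g.val, g.2, ?_⟩
  -- Coassociativity reads ∑ ρ(x_c) ⊗ c = ∑ x_c ⊗ c ⊗ c; the coefficient of g in the last factor is
  -- ρ(x_g) = x_g ⊗ g.
  have h := congrArg (TensorProduct.rid k _ ∘ (b.coord g).lTensor (V ⊗[k] K) ∘
    (TensorProduct.assoc k V K K).symm) (hρ v)
  rw [← hx] at h
  simp only [Function.comp_apply, LinearEquiv.symm_apply_apply, Finsupp.sum, map_sum,
    LinearMap.rTensor_tmul, LinearMap.lTensor_tmul, TensorProduct.rid_tmul,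
    Module.Basis.coord_apply, Module.Basis.repr_self] at h
  have h' : ∀ c : GroupLike k K, comul (R := k) (b c) = b c ⊗ₜ[k] b c := fun c => by
    rw [groupLikeBasis_apply, c.2.comul_eq_tmul_self]
  simp only [h', TensorProduct.assoc_symm_tmul, LinearMap.lTensor_tmul, TensorProduct.rid_tmul,
    Module.Basis.coord_apply, Module.Basis.repr_self, Finsupp.single_apply] at h
  by_cases hg : g ∈ x.support
  · simpa [hg, Finsupp.notMem_support_iff, b, groupLikeBasis_apply] using h
  · simp [Finsupp.notMem_support_iff.1 hg]

/-- Each g ⊗ g is symmetric. Cocommutativity allows left comodules to be treated as right ones. -/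
lemma comm_comul_of_span (hK : Submodule.span k {g : K | IsGroupLikeElem k g} = ⊤) (x : K) :
    TensorProduct.comm k K K (comul (R := k) x) = comul (R := k) x := by
  have : (TensorProduct.comm k K K).toLinearMap ∘ₗ comul = comul (R := k) (A := K) :=
    hom_ext_groupLike hK fun g hg => by simp [hg.comul_eq_tmul_self]
  exact LinearMap.congr_fun this x

/-- A left comodule over a coalgebra spanned by group-like elements is spanned by homogeneous
elements. -/
lemma mem_span_homogeneous_left (hK : Submodule.span k {g : K | IsGroupLikeElem k g} = ⊤)
    (δ : V →ₗ[k] K ⊗[k] V) (hε : ∀ v, TensorProduct.lid k V (counit.rTensor V (δ v)) = v)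
    (hδ : ∀ v, TensorProduct.assoc k K K V (comul.rTensor V (δ v)) = δ.lTensor K (δ v)) (v : V) :
    v ∈ Submodule.span k {x | ∃ g, IsGroupLikeElem k g ∧ δ x = g ⊗ₜ x} := by
  -- Flipping the tensor factors turns δ into a right coaction; the two remaining goals are its
  -- counit and coassociativity axioms.
  have h := mem_span_homogeneous hK ((TensorProduct.comm k K V).toLinearMap ∘ₗ δ)
    (fun v => ?_) (fun v => ?_) v
  · refine Submodule.span_mono ?_ h
    rintro x ⟨g, hg, hx⟩
    refine ⟨g, hg, (TensorProduct.comm k K V).injective ?_⟩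
    simpa using hx
  · conv_rhs => rw [← hε v]
    simp only [LinearMap.comp_apply]
    induction δ v with
    | zero => simp
    | tmul x y => simp
    | add x y hx hy => simp only [map_add, hx, hy]
  · have e : (comul (R := k) (A := K)).lTensor V ∘ₗ (TensorProduct.comm k K V).toLinearMap =
        (TensorProduct.comm k K K).toLinearMap.lTensor V ∘ₗ
        (TensorProduct.comm k (K ⊗[k] K) V).toLinearMap ∘ₗ comul.rTensor V := by
      refine TensorProduct.ext' fun x y => ?_
      simp [comm_comul_of_span hK]
    have e' := LinearMap.congr_fun e (δ v)
    simp only [LinearMap.comp_apply, LinearEquiv.coe_coe] at e' ⊢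
    rw [e', show comul.rTensor V (δ v) = (TensorProduct.assoc k K K V).symm (δ.lTensor K (δ v)) by
      rw [← hδ, LinearEquiv.symm_apply_apply]]
    induction δ v with
    | zero => simp
    | add x y hx hy => simp only [map_add, hx, hy]
    | tmul x y =>
      simp only [TensorProduct.comm_tmul, LinearMap.rTensor_tmul, LinearMap.lTensor_tmul,
        LinearMap.comp_apply, LinearEquiv.coe_coe]
      induction δ y with
      | zero => simp
      | add x y hx hy => simp only [map_add, hx, hy, TensorProduct.tmul_add, TensorProduct.add_tmul]
      | tmul z y => simp

end Coalgebra

end GroupLikeSpan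

/-! ### Split projections: the retraction onto the coinvariants -/

section Biproduct

open Coalgebra HopfAlgebra

variable {k A K : Type*} [Field k] [Ring A] [HopfAlgebra k A] [Ring K] [HopfAlgebra k K]

/-- The right coaction `(id ⊗ π)Δ` of `K` on `A`. -/
def coactRight (π : A →ₐ[k] K) : A →ₐ[k] A ⊗[k] K :=
  (Algebra.TensorProduct.map (AlgHom.id k A) π).comp (Bialgebra.comulAlgHom k A)

/-- The algebra of right coinvariants `{a | (id ⊗ π)Δ(a) = a ⊗ 1}`. -/
def coinv (π : A →ₐ[k] K) : Subalgebra k A :=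
  AlgHom.equalizer (coactRight π) Algebra.TensorProduct.includeLeft

lemma coactRight_apply (π : A →ₐ[k] K) (a : A) :
    coactRight π a = TensorProduct.map LinearMap.id π.toLinearMap (comul (R := k) a) := rfl

lemma mem_coinv {π : A →ₐ[k] K} {a : A} : a ∈ coinv π ↔ coactRight π a = a ⊗ₜ 1 := Iff.rfl

/-- Maps of bialgebras `π : A → K` and `ι : K → A` with `πι = id`, where `K` is spanned by
group-like elements. -/
structure IsSplitProjection (π : A →ₐ[k] K) (ι : K →ₐ[k] A) : Prop where
  comul_proj : ∀ a, comul (R := k) (π a) =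
    TensorProduct.map π.toLinearMap π.toLinearMap (comul (R := k) a)
  counit_proj : ∀ a, counit (R := k) (π a) = counit (R := k) a
  comul_incl : ∀ x, comul (R := k) (ι x) =
    TensorProduct.map ι.toLinearMap ι.toLinearMap (comul (R := k) x)
  counit_incl : ∀ x, counit (R := k) (ι x) = counit (R := k) x
  proj_incl : ∀ x, π (ι x) = x
  span_groupLike : Submodule.span k {g : K | IsGroupLikeElem k g} = ⊤

namespace IsSplitProjection

variable {π : A →ₐ[k] K} {ι : K →ₐ[k] A} (h : IsSplitProjection π ι)

include h

lemma incl_groupLike {g : K} (hg : IsGroupLikeElem k g) : IsGroupLikeElem k (ι g) where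
  counit_eq_one := by rw [h.counit_incl, hg.counit_eq_one]
  comul_eq_tmul_self := by
    rw [h.comul_incl, hg.comul_eq_tmul_self]
    rfl

omit h in
lemma incl_mul_antipode {g : K} (hg : IsGroupLikeElem k g) : ι g * ι (antipode k g) = 1 := by
  rw [← map_mul, hg.mul_antipode_cancel, map_one]

omit h in
lemma incl_antipode_mul {g : K} (hg : IsGroupLikeElem k g) : ι (antipode k g) * ι g = 1 := by
  rw [← map_mul, hg.antipode_mul_cancel, map_one]

lemma coactRight_incl {g : K} (hg : IsGroupLikeElem k g) : coactRight π (ι g) = ι g ⊗ₜ g := by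
  rw [coactRight_apply, (h.incl_groupLike hg).comul_eq_tmul_self]
  simp [h.proj_incl]

/-- A right K-comodule is spanned by homogeneous x, say of degree g. Then x = (x ι(S g)) ι(g), and
the first factor has degree g S(g) = 1, so it is coinvariant. -/
lemma mem_span_mul_incl (a : A) : a ∈ Submodule.span k
    {x | ∃ b ∈ coinv π, ∃ g, IsGroupLikeElem k g ∧ x = b * ι g} := by
  have := mem_span_homogeneous h.span_groupLike (coactRight π).toLinearMap (fun a => ?_)
    (fun a => ?_) a
  · refine Submodule.span_mono ?_ this
    rintro x ⟨g, hg, hx⟩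
    refine ⟨x * ι (antipode k g), ?_, g, hg, ?_⟩
    · rw [AlgHom.toLinearMap_apply] at hx
      rw [mem_coinv, map_mul, hx, h.coactRight_incl (IsGroupLikeElem.antipode hg),
        Algebra.TensorProduct.tmul_mul_tmul, hg.mul_antipode_cancel]
    · rw [mul_assoc, incl_antipode_mul hg, mul_one]
  · rw [AlgHom.toLinearMap_apply, coactRight_apply, LinearMap.lTensor_map]
    have : counit (R := k) ∘ₗ π.toLinearMap = counit (R := k) (A := A) :=
      LinearMap.ext h.counit_proj
    rw [this, ← LinearMap.lTensor, Coalgebra.lTensor_counit_comul,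
      TensorProduct.rid_tmul, one_smul]
  · have e := map_comul_right (k := k) LinearMap.id π.toLinearMap π.toLinearMap a
    have e1 : TensorProduct.map π.toLinearMap π.toLinearMap ∘ₗ comul =
      comul (R := k) ∘ₗ π.toLinearMap := LinearMap.ext fun a => (h.comul_proj a).symm
    have e2 : TensorProduct.map LinearMap.id π.toLinearMap ∘ₗ comul (R := k) =
      (coactRight π).toLinearMap := rfl
    rw [e1, e2] at e
    rw [AlgHom.toLinearMap_apply, coactRight_apply, LinearMap.lTensor_map, LinearMap.rTensor_map,
      LinearMap.comp_id, e]

/-- This reduces the identities below to elements b ι(g), on which `retract` and the right coaction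
have closed forms. -/
lemma hom_ext {V : Type*} [AddCommGroup V] [Module k V] {f f' : A →ₗ[k] V}
    (H : ∀ (b : coinv π) (g : K), IsGroupLikeElem k g → f (b * ι g) = f' (b * ι g)) : f = f' := by
  refine LinearMap.ext_on (s := {x | ∃ b ∈ coinv π, ∃ g, IsGroupLikeElem k g ∧ x = b * ι g})
    (eq_top_iff.2 fun a _ => h.mem_span_mul_incl a) ?_
  rintro _ ⟨b, hb, g, hg, rfl⟩
  exact H ⟨b, hb⟩ g hg

omit h in
lemma coactRight_coe (b : coinv π) : coactRight π (b : A) = (b : A) ⊗ₜ 1 := b.2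

lemma coactRight_mul_incl (b : coinv π) {g : K} (hg : IsGroupLikeElem k g) :
    coactRight π (b * ι g) = (b * ι g : A) ⊗ₜ g := by
  rw [map_mul, coactRight_coe, h.coactRight_incl hg, Algebra.TensorProduct.tmul_mul_tmul, one_mul]

/-- The map `a ↦ a₁ ιSπ(a₂)`. -/
def retractAux (π : A →ₐ[k] K) (ι : K →ₐ[k] A) : A →ₗ[k] A :=
  LinearMap.mul' k A ∘ₗ (ι.toLinearMap ∘ₗ antipode k).lTensor A ∘ₗ (coactRight π).toLinearMap

lemma retractAux_mul_incl (b : coinv π) {g : K} (hg : IsGroupLikeElem k g) :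
    retractAux π ι (b * ι g) = b := by
  simp only [retractAux, LinearMap.comp_apply, AlgHom.toLinearMap_apply]
  rw [h.coactRight_mul_incl b hg]
  simp [mul_assoc, incl_mul_antipode hg]

lemma retractAux_mem (a : A) : retractAux π ι a ∈ Subalgebra.toSubmodule (coinv π) := by
  have : Submodule.span k {x | ∃ b ∈ coinv π, ∃ g, IsGroupLikeElem k g ∧ x = b * ι g} ≤
      (Subalgebra.toSubmodule (coinv π)).comap (retractAux π ι) := by
    rw [Submodule.span_le]
    rintro _ ⟨b, hb, g, hg, rfl⟩
    simpa [h.retractAux_mul_incl ⟨b, hb⟩ hg] using hb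
  exact this (h.mem_span_mul_incl a)

/-- The projection `A → B`, `a ↦ a₁ ιSπ(a₂)`. -/
def retract : A →ₗ[k] coinv π :=
  LinearMap.codRestrict (Subalgebra.toSubmodule (coinv π)) (retractAux π ι) h.retractAux_mem

lemma retract_mul_incl (b : coinv π) {g : K} (hg : IsGroupLikeElem k g) :
    h.retract (b * ι g) = b :=
  Subtype.ext (h.retractAux_mul_incl b hg)

lemma retract_coe (b : coinv π) : h.retract b = b := by
  simpa using h.retract_mul_incl b .one

lemma retract_mul_groupLike (a : A) {g : K} (hg : IsGroupLikeElem k g) :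
    h.retract (a * ι g) = h.retract a := by
  have : h.retract ∘ₗ LinearMap.mulRight k (ι g) = h.retract := h.hom_ext fun b x hx => by
    rw [LinearMap.comp_apply, LinearMap.mulRight_apply, mul_assoc, ← map_mul,
      h.retract_mul_incl b hx, h.retract_mul_incl b (hx.mul hg)]
  exact LinearMap.congr_fun this a

/-- Right multiplication by ι(g) does not change `retract`. For a' = b ι(x) both sides are therefore
p(a b). -/
lemma retract_mul_retract (a a' : A) : h.retract (a * h.retract a') = h.retract (a * a') := by
  have : h.retract ∘ₗ LinearMap.mulLeft k a ∘ₗ (coinv π).val.toLinearMap ∘ₗ h.retract =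
      h.retract ∘ₗ LinearMap.mulLeft k a := h.hom_ext fun b x hx => by
    simp only [LinearMap.comp_apply, h.retract_mul_incl b hx, LinearMap.mulLeft_apply]
    rw [← mul_assoc, h.retract_mul_groupLike _ hx]
    rfl
  exact LinearMap.congr_fun this a'

lemma retract_coe_mul (b : coinv π) (a : A) : h.retract (b * a) = b * h.retract a := by
  rw [← h.retract_mul_retract, ← MulMemClass.coe_mul, h.retract_coe]

lemma comul_mul_incl (a : A) {g : K} (hg : IsGroupLikeElem k g) :
    comul (R := k) (a * ι g) = comul (R := k) a * (ι g ⊗ₜ ι g) := by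
  rw [Bialgebra.comul_mul, (h.incl_groupLike hg).comul_eq_tmul_self]

lemma comul_incl_mul (a : A) {g : K} (hg : IsGroupLikeElem k g) :
    comul (R := k) (ι g * a) = (ι g ⊗ₜ ι g) * comul (R := k) a := by
  rw [Bialgebra.comul_mul, (h.incl_groupLike hg).comul_eq_tmul_self]

lemma map_retract_mul {V : Type*} [AddCommGroup V] [Module k V] (f : A →ₗ[k] V) (u : A ⊗[k] A)
    {g : K} (hg : IsGroupLikeElem k g) :
    TensorProduct.map f h.retract (u * (ι g ⊗ₜ ι g)) =
      TensorProduct.map (f ∘ₗ LinearMap.mulRight k (ι g)) h.retract u := by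
  induction u with
  | zero => simp
  | add x y hx hy => simp only [add_mul, map_add, hx, hy]
  | tmul x y => simp [h.retract_mul_groupLike _ hg]

lemma retract_comp_mulRight {g : K} (hg : IsGroupLikeElem k g) :
    h.retract ∘ₗ LinearMap.mulRight k (ι g) = h.retract :=
  LinearMap.ext fun a => h.retract_mul_groupLike a hg

/-- `B` is the quotient coalgebra `A / A K⁺`. -/
lemma map_retract_comul (a : A) :
    TensorProduct.map h.retract h.retract (comul (R := k) (h.retract a : A)) =
      TensorProduct.map h.retract h.retract (comul (R := k) a) := by
  have : TensorProduct.map h.retract h.retract ∘ₗ comul ∘ₗ (coinv π).val.toLinearMap ∘ₗ h.retract =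
      TensorProduct.map h.retract h.retract ∘ₗ comul (R := k) := h.hom_ext fun b x hx => by
    simp only [LinearMap.comp_apply, h.retract_mul_incl b hx]
    rw [h.comul_mul_incl _ hx, h.map_retract_mul _ _ hx, h.retract_comp_mulRight hx]
    rfl
  exact LinearMap.congr_fun this a

/-- `Δ(B) ⊆ A ⊗ B`. -/
lemma map_id_retract_comul (b : coinv π) :
    TensorProduct.map LinearMap.id ((coinv π).val.toLinearMap ∘ₗ h.retract) (comul (R := k) (b : A))
      = comul (R := k) (b : A) := by
  -- Applying p to the second leg of Δ(b) gives b₁ ⊗ b₂ ιSπ(b₃), and coinvariance of b gives b₁ ⊗ b₂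
  -- ⊗ π(b₃) = b₁ ⊗ b₂ ⊗ 1.
  have e0 : (coinv π).val.toLinearMap ∘ₗ h.retract =
      (LinearMap.mul' k A ∘ₗ (ι.toLinearMap ∘ₗ antipode k).lTensor A) ∘ₗ
        (TensorProduct.map LinearMap.id π.toLinearMap ∘ₗ comul) := rfl
  have e1 := map_comul_right (k := k) LinearMap.id LinearMap.id π.toLinearMap (b : A)
  have e2 : TensorProduct.map comul π.toLinearMap (comul (R := k) (b : A)) =
      comul (R := k) (b : A) ⊗ₜ 1 := by
    have := congrArg ((comul (R := k)).rTensor K) (coactRight_coe b)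
    rwa [LinearMap.rTensor_tmul, coactRight_apply, LinearMap.rTensor_map,
      LinearMap.comp_id] at this
  rw [e0, ← LinearMap.lTensor_map, e1, TensorProduct.map_id, LinearMap.id_comp, e2]
  induction comul (R := k) (b : A) with
  | zero => simp
  | add x y hx hy => simp only [TensorProduct.add_tmul, map_add, hx, hy]
  | tmul x y => simp

/-- Because Δ(B) ⊆ A ⊗ B, the retraction can be inserted or dropped on the second leg of Δ(b) before
any linear map. -/
lemma map_comp_retract_comul {V W : Type*} [AddCommGroup V] [Module k V] [AddCommGroup W]
    [Module k W] (f : A →ₗ[k] V) (q : A →ₗ[k] W) (b : coinv π) :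
    TensorProduct.map f (q ∘ₗ (coinv π).val.toLinearMap ∘ₗ h.retract) (comul (R := k) (b : A)) =
      TensorProduct.map f q (comul (R := k) (b : A)) := by
  conv_rhs => rw [← h.map_id_retract_comul b, ← LinearMap.comp_apply, ← TensorProduct.map_comp,
    LinearMap.comp_id]

/-- `a = p(a₁) ιπ(a₂)`. -/
lemma retract_mul_proj (a : A) :
    LinearMap.mul' k A (TensorProduct.map ((coinv π).val.toLinearMap ∘ₗ h.retract)
      (ι.toLinearMap ∘ₗ π.toLinearMap) (comul (R := k) a)) = a := by
  have : LinearMap.mul' k A ∘ₗ TensorProduct.map ((coinv π).val.toLinearMap ∘ₗ h.retract)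
      ι.toLinearMap ∘ₗ (coactRight π).toLinearMap = LinearMap.id := h.hom_ext fun b x hx => by
    simp only [LinearMap.comp_apply, AlgHom.toLinearMap_apply]
    rw [h.coactRight_mul_incl b hx]
    simp [h.retract_mul_incl b hx]
  have := LinearMap.congr_fun this a
  rwa [LinearMap.comp_apply, LinearMap.comp_apply, AlgHom.toLinearMap_apply, coactRight_apply,
    ← LinearMap.comp_apply (TensorProduct.map _ _), ← TensorProduct.map_comp] at this

/-- The left coaction `(π ⊗ id)Δ` of `K` on `B`. -/
def coactLeft : coinv π →ₗ[k] K ⊗[k] coinv π :=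
  TensorProduct.map π.toLinearMap h.retract ∘ₗ comul ∘ₗ (coinv π).val.toLinearMap

lemma coactLeft_apply (b : coinv π) :
    h.coactLeft b = TensorProduct.map π.toLinearMap h.retract (comul (R := k) (b : A)) := rfl

/-- The retraction in `coactLeft` only adjusts the codomain. Inside K ⊗ A the coaction is (π ⊗ id)Δ,
a restriction of an algebra map, and K ⊗ B embeds there by flatness. -/
lemma lTensor_val_coactLeft (b : coinv π) :
    (coinv π).val.toLinearMap.lTensor K (h.coactLeft b) =
      TensorProduct.map π.toLinearMap LinearMap.id (comul (R := k) (b : A)) := by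
  rw [coactLeft_apply, LinearMap.lTensor_map, ← LinearMap.id_comp (_ ∘ₗ h.retract),
    h.map_comp_retract_comul]

omit h in
lemma lTensor_val_injective (V : Type*) [AddCommGroup V] [Module k V] :
    Function.Injective ((coinv π).val.toLinearMap.lTensor V) :=
  Module.Flat.lTensor_preserves_injective_linearMap _ Subtype.val_injective

/-- `π(a₁) ⊗ p(a₂) = p(a₁)₍₋₁₎ π(a₂) ⊗ p(a₁)₍₀₎`. -/
lemma map_proj_retract_comul (a : A) :
    (LinearMap.mul' k K).rTensor (coinv π) (TensorProduct.rightComm k K (coinv π) K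
      (TensorProduct.map (h.coactLeft ∘ₗ h.retract) π.toLinearMap (comul (R := k) a))) =
      TensorProduct.map π.toLinearMap h.retract (comul (R := k) a) := by
  have : (LinearMap.mul' k K).rTensor (coinv π) ∘ₗ
      (TensorProduct.rightComm k K (coinv π) K).toLinearMap ∘ₗ
      (h.coactLeft ∘ₗ h.retract).rTensor K ∘ₗ (coactRight π).toLinearMap =
      TensorProduct.map π.toLinearMap h.retract ∘ₗ comul := h.hom_ext fun b x hx => by
    simp only [LinearMap.comp_apply, AlgHom.toLinearMap_apply]
    rw [h.coactRight_mul_incl b hx, h.comul_mul_incl _ hx, h.map_retract_mul _ _ hx]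
    simp only [LinearMap.rTensor_tmul, LinearMap.comp_apply, h.retract_mul_incl b hx,
      coactLeft_apply]
    induction comul (R := k) (b : A) with
    | zero => simp
    | add x y hx hy => simp only [TensorProduct.add_tmul, map_add, hx, hy]
    | tmul y z => simp [h.proj_incl]
  have := LinearMap.congr_fun this a
  simp only [LinearMap.comp_apply, AlgHom.toLinearMap_apply] at this
  rwa [coactRight_apply, LinearMap.rTensor_map, LinearMap.comp_id] at this

/-- The action `h · b = p(ι(h) b)` of `K` on `B`. -/
def adj : K ⊗[k] coinv π →ₗ[k] coinv π :=
  h.retract ∘ₗ LinearMap.mul' k A ∘ₗ TensorProduct.map ι.toLinearMap (coinv π).val.toLinearMap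

lemma adj_tmul (x : K) (b : coinv π) : h.adj (x ⊗ₜ b) = h.retract (ι x * b) := rfl

lemma conj_mem (b : coinv π) {g : K} (hg : IsGroupLikeElem k g) :
    ι g * b * ι (antipode k g) ∈ coinv π := by
  rw [mem_coinv, map_mul, map_mul, coactRight_coe, h.coactRight_incl hg,
    h.coactRight_incl (IsGroupLikeElem.antipode hg), Algebra.TensorProduct.tmul_mul_tmul,
    Algebra.TensorProduct.tmul_mul_tmul, mul_one, hg.mul_antipode_cancel]

/-- ι(g) b = (ι(g) b ι(S g)) ι(g) with coinvariant first factor, so p returns that factor: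
group-likes act by conjugation. -/
lemma coe_adj {g : K} (hg : IsGroupLikeElem k g) (b : coinv π) :
    (h.adj (g ⊗ₜ b) : A) = ι g * b * ι (antipode k g) := by
  have := h.retract_mul_incl ⟨_, h.conj_mem b hg⟩ hg
  rw [adj_tmul]
  rw [Subtype.coe_mk, mul_assoc (ι g * (b : A)), incl_antipode_mul hg, mul_one] at this
  rw [this]

/-- `p(a₁) (π(a₂) · c) = p(a c)`. -/
lemma retract_mul_adj (a : A) (c : coinv π) :
    LinearMap.mul' k (coinv π) (TensorProduct.map h.retract
      (h.adj ∘ₗ (TensorProduct.mk k K (coinv π)).flip c ∘ₗ π.toLinearMap) (comul (R := k) a)) =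
      h.retract (a * c) := by
  have : LinearMap.mul' k (coinv π) ∘ₗ TensorProduct.map h.retract
      (h.adj ∘ₗ (TensorProduct.mk k K (coinv π)).flip c) ∘ₗ (coactRight π).toLinearMap =
      h.retract ∘ₗ LinearMap.mulRight k (c : A) := h.hom_ext fun b x hx => by
    simp only [LinearMap.comp_apply, AlgHom.toLinearMap_apply]
    rw [h.coactRight_mul_incl b hx]
    simp only [TensorProduct.map_tmul, LinearMap.comp_apply, h.retract_mul_incl b hx,
      LinearMap.mul'_apply, LinearMap.flip_apply, TensorProduct.mk_apply, adj_tmul,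
      LinearMap.mulRight_apply, mul_assoc, h.retract_coe_mul]
  have := LinearMap.congr_fun this a
  rwa [LinearMap.comp_apply, LinearMap.comp_apply, AlgHom.toLinearMap_apply, coactRight_apply,
    ← LinearMap.comp_apply (TensorProduct.map _ _), ← TensorProduct.map_comp] at this

end IsSplitProjection

end Biproduct

/-! ### The braided antipode and the structure maps on the coinvariants -/

section Biproduct

open Coalgebra HopfAlgebra

variable {k A K : Type*} [Field k] [Ring A] [HopfAlgebra k A] [Ring K] [HopfAlgebra k K]

lemma map_counit_comul {V : Type*} [AddCommGroup V] [Module k V] (f : A →ₗ[k] V) (a : A) :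
    TensorProduct.map counit f (comul (R := k) a) = 1 ⊗ₜ f a := by
  have := congrArg (f.lTensor k) (Coalgebra.rTensor_counit_comul (R := k) a)
  rwa [LinearMap.rTensor, LinearMap.lTensor_map, LinearMap.comp_id, LinearMap.lTensor_tmul] at this

lemma map_comul_counit {V : Type*} [AddCommGroup V] [Module k V] (f : A →ₗ[k] V) (a : A) :
    TensorProduct.map f counit (comul (R := k) a) = f a ⊗ₜ 1 := by
  have := congrArg (f.rTensor k) (Coalgebra.lTensor_counit_comul (R := k) a)
  rwa [LinearMap.lTensor, LinearMap.rTensor_map, LinearMap.comp_id, LinearMap.rTensor_tmul] at this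

lemma map_comm_apply {V W V' W' : Type*} [AddCommGroup V] [Module k V] [AddCommGroup W]
    [Module k W] [AddCommGroup V'] [Module k V'] [AddCommGroup W'] [Module k W'] (f : V →ₗ[k] V')
    (f' : W →ₗ[k] W') (u : W ⊗[k] V) :
    TensorProduct.map f f' (TensorProduct.comm k W V u) =
      TensorProduct.comm k W' V' (TensorProduct.map f' f u) := by
  induction u with
  | zero => simp
  | add x y hx hy => simp only [map_add, hx, hy]
  | tmul x y => rfl

namespace IsSplitProjection

variable {π : A →ₐ[k] K} {ι : K →ₐ[k] A} (h : IsSplitProjection π ι)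

include h

/-- In the convolution algebra Hom(A, K), πS is a left inverse and Sπ a right inverse of π, so they
agree. -/
lemma proj_antipode (a : A) : π (antipode k a) = antipode k (π a) := by
  have h1 : (WithConv.toConv (π.toLinearMap ∘ₗ antipode k) : WithConv (A →ₗ[k] K)) *
      WithConv.toConv π.toLinearMap = 1 := by
    apply WithConv.ext
    ext a
    have key : ∀ u : A ⊗[k] A, LinearMap.mul' k K (TensorProduct.map (π.toLinearMap ∘ₗ antipode k)
        π.toLinearMap u) = π (LinearMap.mul' k A ((antipode k).rTensor A u)) := by
      intro u
      induction u with
      | zero => simp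
      | add x y hx hy => simp only [map_add, hx, hy]
      | tmul x y => simp
    simp only [LinearMap.convMul_def, LinearMap.convOne_def, LinearMap.comp_apply]
    rw [key, mul_antipode_rTensor_comul_apply, AlgHom.commutes]
    rfl
  have h2 : (WithConv.toConv π.toLinearMap : WithConv (A →ₗ[k] K)) *
      WithConv.toConv (antipode k ∘ₗ π.toLinearMap) = 1 := by
    apply WithConv.ext
    ext a
    simp only [LinearMap.convMul_def, LinearMap.convOne_def, LinearMap.comp_apply]
    rw [← LinearMap.lTensor_map, ← h.comul_proj, mul_antipode_lTensor_comul_apply, h.counit_proj]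
    rfl
  exact LinearMap.congr_fun (congrArg WithConv.ofConv (left_inv_eq_right_inv h1 h2)) a

omit h in
-- Apply ε ⊗ id to (id ⊗ π)Δ(b) = b ⊗ 1.
lemma proj_coe (b : coinv π) : π (b : A) = algebraMap k K (counit (R := k) (b : A)) := by
  have := congrArg (fun u => TensorProduct.lid k K ((counit (R := k)).rTensor K u))
    (coactRight_coe b)
  simp only [coactRight_apply, LinearMap.rTensor_map, LinearMap.comp_id, LinearMap.rTensor_tmul,
    TensorProduct.lid_tmul, map_counit_comul] at this
  simpa [Algebra.algebraMap_eq_smul_one] using this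

lemma counit_retract (a : A) : counit (R := k) (h.retract a : A) = counit (R := k) a := by
  have : counit ∘ₗ (coinv π).val.toLinearMap ∘ₗ h.retract = counit (R := k) (A := A) :=
    h.hom_ext fun b x hx => by
      simp only [LinearMap.comp_apply, h.retract_mul_incl b hx, Bialgebra.counit_mul,
        (h.incl_groupLike hx).counit_eq_one, mul_one]
      rfl
  exact LinearMap.congr_fun this a

omit h in
/-- The map `a ↦ ιπ(a₁) S(a₂)`. -/
def skewAntipode (π : A →ₐ[k] K) (ι : K →ₐ[k] A) : A →ₗ[k] A :=
  LinearMap.mul' k A ∘ₗ TensorProduct.map (ι.toLinearMap ∘ₗ π.toLinearMap) (antipode k) ∘ₗ comul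

lemma antipode_incl {g : K} (hg : IsGroupLikeElem k g) : antipode k (ι g) = ι (antipode k g) := by
  have h1 := (h.incl_groupLike hg).antipode_mul_cancel
  exact left_inv_eq_right_inv h1 (incl_mul_antipode hg)

/-- On x ⊗ y the extra factors meet as ι(g) ι(S g) = 1, between ιπ(x) and S(y). Hence `skewAntipode`
factors through `retract`. -/
lemma skewAntipode_mul_incl (a : A) {g : K} (hg : IsGroupLikeElem k g) :
    skewAntipode π ι (a * ι g) = skewAntipode π ι a := by
  simp only [skewAntipode, LinearMap.comp_apply]
  rw [h.comul_mul_incl _ hg]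
  induction comul (R := k) a with
  | zero => simp
  | add x y hx hy => simp only [add_mul, map_add, hx, hy]
  | tmul x y =>
    simp only [Algebra.TensorProduct.tmul_mul_tmul, TensorProduct.map_tmul, LinearMap.comp_apply,
      AlgHom.toLinearMap_apply, LinearMap.mul'_apply, antipode_mul_antidistrib, map_mul,
      h.proj_incl, h.antipode_incl hg]
    rw [mul_assoc, ← mul_assoc (ι g), incl_mul_antipode hg, one_mul]

lemma skewAntipode_incl_mul (a : A) {g : K} (hg : IsGroupLikeElem k g) :
    skewAntipode π ι (ι g * a) = ι g * skewAntipode π ι a * ι (antipode k g) := by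
  simp only [skewAntipode, LinearMap.comp_apply]
  rw [h.comul_incl_mul _ hg]
  induction comul (R := k) a with
  | zero => simp
  | add x y hx hy => simp only [mul_add, add_mul, map_add, hx, hy]
  | tmul x y =>
    simp only [Algebra.TensorProduct.tmul_mul_tmul, TensorProduct.map_tmul, LinearMap.comp_apply,
      AlgHom.toLinearMap_apply, LinearMap.mul'_apply, antipode_mul_antidistrib, map_mul,
      h.proj_incl, h.antipode_incl hg, mul_assoc]

lemma skewAntipode_retract (a : A) :
    skewAntipode π ι (h.retract a) = skewAntipode π ι a := by
  have : skewAntipode π ι ∘ₗ (coinv π).val.toLinearMap ∘ₗ h.retract = skewAntipode π ι :=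
    h.hom_ext fun b x hx => by
      simp only [LinearMap.comp_apply, h.retract_mul_incl b hx, h.skewAntipode_mul_incl _ hx]
      rfl
  exact LinearMap.congr_fun this a

lemma coassoc_coactLeft (b : coinv π) :
    TensorProduct.assoc k K K (coinv π) (comul.rTensor (coinv π) (h.coactLeft b)) =
      h.coactLeft.lTensor K (h.coactLeft b) := by
  have e := h.map_comp_retract_comul π.toLinearMap
    (TensorProduct.map π.toLinearMap h.retract ∘ₗ comul) b
  have e1 : TensorProduct.map π.toLinearMap π.toLinearMap ∘ₗ comul =
    comul (R := k) ∘ₗ π.toLinearMap := LinearMap.ext fun a => (h.comul_proj a).symm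
  rw [map_comul_right, e1] at e
  rw [coactLeft_apply, LinearMap.lTensor_map, LinearMap.rTensor_map, ← e]
  rfl

lemma counit_coactLeft (b : coinv π) :
    TensorProduct.lid k (coinv π) (counit.rTensor (coinv π) (h.coactLeft b)) = b := by
  have e1 : counit (R := k) ∘ₗ π.toLinearMap = counit (R := k) (A := A) :=
    LinearMap.ext h.counit_proj
  rw [coactLeft_apply, LinearMap.rTensor_map, e1, map_counit_comul, TensorProduct.lid_tmul,
    one_smul,
    retract_coe]

/-- The left coaction grades B by group-likes. On a homogeneous element `skewAntipode` is a multiple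
of S, which makes it computable. -/
lemma mem_span_homogeneous_coinv (b : coinv π) :
    b ∈ Submodule.span k {x | ∃ g, IsGroupLikeElem k g ∧ h.coactLeft x = g ⊗ₜ x} :=
  mem_span_homogeneous_left h.span_groupLike h.coactLeft h.counit_coactLeft
    h.coassoc_coactLeft b

lemma map_proj_id_comul {b : coinv π} {g : K} (hb : h.coactLeft b = g ⊗ₜ b) :
    TensorProduct.map π.toLinearMap LinearMap.id (comul (R := k) (b : A)) = g ⊗ₜ (b : A) := by
  rw [← h.lTensor_val_coactLeft, hb]
  rfl

lemma skewAntipode_homogeneous {b : coinv π} {g : K} (hb : h.coactLeft b = g ⊗ₜ b) :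
    skewAntipode π ι b = ι g * antipode k (b : A) := by
  have := congrArg (LinearMap.mul' k A ∘ₗ TensorProduct.map ι.toLinearMap (antipode k))
    (h.map_proj_id_comul hb)
  rw [LinearMap.comp_apply, ← LinearMap.comp_apply (TensorProduct.map _ _),
    ← TensorProduct.map_comp] at this
  exact this

/-- S reverses Δ and commutes with π, so an element of left degree g is sent to one of right degree
S(g). The product ι(g) S(b) then has right degree 1, which is why `skewAntipode` maps B to itself.
-/
lemma coactRight_antipode {b : coinv π} {g : K} (hb : h.coactLeft b = g ⊗ₜ b) :
    coactRight π (antipode k (b : A)) = antipode k (b : A) ⊗ₜ antipode k g := by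
  have e : π.toLinearMap ∘ₗ antipode k = antipode k ∘ₗ π.toLinearMap :=
    LinearMap.ext h.proj_antipode
  have := congrArg
    ((TensorProduct.comm k K A).toLinearMap ∘ₗ TensorProduct.map (antipode k) (antipode k))
    (h.map_proj_id_comul hb)
  rw [LinearMap.comp_apply, ← LinearMap.comp_apply (TensorProduct.map _ _),
    ← TensorProduct.map_comp, LinearMap.comp_id, ← e] at this
  rw [coactRight_apply, comul_antipode, ← LinearMap.comp_apply, ← TensorProduct.map_comp,
    LinearMap.id_comp, map_comm_apply]
  exact this

lemma skewAntipode_mem_homogeneous {b : coinv π} {g : K} (hg : IsGroupLikeElem k g)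
    (hb : h.coactLeft b = g ⊗ₜ b) : skewAntipode π ι b ∈ coinv π := by
  rw [h.skewAntipode_homogeneous hb, mem_coinv, map_mul, h.coactRight_incl hg,
    h.coactRight_antipode hb, Algebra.TensorProduct.tmul_mul_tmul, hg.mul_antipode_cancel]

lemma skewAntipode_mem (b : coinv π) : skewAntipode π ι b ∈ coinv π := by
  have : Submodule.span k {x | ∃ g, IsGroupLikeElem k g ∧ h.coactLeft x = g ⊗ₜ x} ≤
      (Subalgebra.toSubmodule (coinv π)).comap
        (skewAntipode π ι ∘ₗ (coinv π).val.toLinearMap) := by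
    rw [Submodule.span_le]
    rintro b ⟨g, hg, hb⟩
    exact h.skewAntipode_mem_homogeneous hg hb
  exact this (h.mem_span_homogeneous_coinv b)

/-- The braided Hopf algebra structure of `B`. -/
def braided : BraidedHopfData k K (coinv π) where
  act := h.adj
  coact := h.coactLeft
  comul := TensorProduct.map h.retract h.retract ∘ₗ comul ∘ₗ (coinv π).val.toLinearMap
  counit := counit ∘ₗ (coinv π).val.toLinearMap
  -- The values already lie in B (`skewAntipode_mem`); `retract` only supplies the codomain.
  antipode := h.retract ∘ₗ skewAntipode π ι ∘ₗ (coinv π).val.toLinearMap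

lemma braided_comul_apply (b : coinv π) :
    h.braided.comul b = TensorProduct.map h.retract h.retract (comul (R := k) (b : A)) := rfl

lemma braided_comul_retract (a : A) :
    h.braided.comul (h.retract a) = TensorProduct.map h.retract h.retract (comul (R := k) a) :=
  h.map_retract_comul a

lemma braided_comul_comp_retract :
    h.braided.comul ∘ₗ h.retract = TensorProduct.map h.retract h.retract ∘ₗ comul :=
  LinearMap.ext h.braided_comul_retract

lemma coe_braided_antipode (b : coinv π) :
    (h.braided.antipode b : A) = skewAntipode π ι b :=
  congrArg Subtype.val (h.retract_coe ⟨_, h.skewAntipode_mem b⟩)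

lemma coe_braided_antipode_retract (a : A) :
    (h.braided.antipode (h.retract a) : A) = skewAntipode π ι a := by
  rw [coe_braided_antipode, skewAntipode_retract]

lemma tensor_act_groupLike {g : K} (hg : IsGroupLikeElem k g) (b c : coinv π) :
    (h.braided.toYDData.tensor h.braided.toYDData).act (g ⊗ₜ (b ⊗ₜ c)) =
      h.adj (g ⊗ₜ b) ⊗ₜ h.adj (g ⊗ₜ c) := by
  simp [YDData.tensor, hg.comul_eq_tmul_self, braided]

end IsSplitProjection

end Biproduct

/-! ### The braided Hopf algebra axioms and the biproduct isomorphism -/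

section Biproduct

open Coalgebra HopfAlgebra

variable {k A K : Type*} [Field k] [Ring A] [HopfAlgebra k A] [Ring K] [HopfAlgebra k K]

/-- Associativity of the convolution product. -/
lemma mul_map_comul_assoc (f q g : A →ₗ[k] A) (a : A) :
    LinearMap.mul' k A (TensorProduct.map f
      (LinearMap.mul' k A ∘ₗ TensorProduct.map q g ∘ₗ comul) (comul (R := k) a)) =
    LinearMap.mul' k A (TensorProduct.map
      (LinearMap.mul' k A ∘ₗ TensorProduct.map f q ∘ₗ comul) g (comul (R := k) a)) := by
  have := mul_assoc (WithConv.toConv f) (WithConv.toConv q) (WithConv.toConv g)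
  exact (LinearMap.congr_fun (congrArg WithConv.ofConv this) a).symm

lemma tensor_ext_groupLike_right {V W : Type*} [AddCommGroup V] [Module k V] [AddCommGroup W]
    [Module k W] (hK : Submodule.span k {g : K | IsGroupLikeElem k g} = ⊤)
    {f f' : V ⊗[k] K →ₗ[k] W} (h : ∀ v g, IsGroupLikeElem k g → f (v ⊗ₜ g) = f' (v ⊗ₜ g)) :
    f = f' := by
  refine TensorProduct.ext (LinearMap.ext fun v => hom_ext_groupLike hK fun g hg => ?_)
  exact h v g hg

section YetterDrinfeld

variable {V W B : Type*} [AddCommGroup V] [Module k V] [AddCommGroup W] [Module k W]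
  [Ring B] [Algebra k B]

/-- The product in K leaves the factor W untouched. Bracketing the other three factors together
produces the expression on the left of `map_proj_retract_comul`. -/
lemma tensor_coact_apply (M : YDData k K V) (N : YDData k K W) (u : V ⊗[k] W) :
    (M.tensor N).coact u = TensorProduct.assoc k K V W (((LinearMap.mul' k K).rTensor V ∘ₗ
      (TensorProduct.rightComm k K V K).toLinearMap).rTensor W
        ((TensorProduct.assoc k (K ⊗[k] V) K W).symm
          (TensorProduct.map M.coact N.coact u))) := by
  have : (LinearMap.mul' k K).rTensor (V ⊗[k] W) ∘ₗ
      (TensorProduct.tensorTensorTensorComm k K V K W).toLinearMap =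
      (TensorProduct.assoc k K V W).toLinearMap ∘ₗ ((LinearMap.mul' k K).rTensor V ∘ₗ
      (TensorProduct.rightComm k K V K).toLinearMap).rTensor W ∘ₗ
        (TensorProduct.assoc k (K ⊗[k] V) K W).symm.toLinearMap := by
    ext x v y w
    rfl
  exact LinearMap.congr_fun this _

/-- Lets the coaction on a product be computed with the ordinary algebra structure of K ⊗ A. -/
lemma mul_tensorComm_eq (φ : B →ₐ[k] A) (u v : K ⊗[k] B) :
    φ.toLinearMap.lTensor K ((LinearMap.mul' k B).lTensor K
      ((LinearMap.mul' k K).rTensor (B ⊗[k] B)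
        (TensorProduct.tensorTensorTensorComm k K B K B (u ⊗ₜ v)))) =
      φ.toLinearMap.lTensor K u * φ.toLinearMap.lTensor K v := by
  have : φ.toLinearMap.lTensor K ∘ₗ (LinearMap.mul' k B).lTensor K ∘ₗ
      (LinearMap.mul' k K).rTensor (B ⊗[k] B) ∘ₗ
        (TensorProduct.tensorTensorTensorComm k K B K B).toLinearMap =
      LinearMap.mul' k (K ⊗[k] A) ∘ₗ
        TensorProduct.map (φ.toLinearMap.lTensor K) (φ.toLinearMap.lTensor K) := by
    ext x b y c
    simp
  exact LinearMap.congr_fun this (u ⊗ₜ v)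

/-- The braided product of u with c ⊗ d is u₁ (u₂₍₋₁₎ · c) ⊗ u₂₍₀₎ d. Written as a map applied to
(id ⊗ coaction)(u), it is ready for coassociativity when u = Δ(b). -/
lemma mul_middle_braiding (M : YDData k K B) (c d : B) (u : B ⊗[k] B) :
    TensorProduct.map (LinearMap.mul' k B) (LinearMap.mul' k B)
      (middle (M.braiding M) (u ⊗ₜ (c ⊗ₜ d))) =
      TensorProduct.map (LinearMap.mul' k B ∘ₗ
        (M.act ∘ₗ (TensorProduct.mk k K B).flip c).lTensor B) (LinearMap.mulRight k d)
        ((TensorProduct.assoc k B K B).symm (M.coact.lTensor B u)) := by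
  have e : ∀ u : B ⊗[k] B, middle (M.braiding M) (u ⊗ₜ[k] (c ⊗ₜ[k] d)) =
      middle (M.act.rTensor B ∘ₗ (TensorProduct.rightComm k K B B).toLinearMap)
        (M.coact.lTensor B u ⊗ₜ[k] (c ⊗ₜ[k] d)) := by
    intro u
    induction u with
    | zero => simp
    | add x y hx hy => simp only [map_add, TensorProduct.add_tmul, hx, hy]
    | tmul x y => simp [middle, YDData.braiding]
  have e' : TensorProduct.map (LinearMap.mul' k B) (LinearMap.mul' k B) ∘ₗ
      middle (M.act.rTensor B ∘ₗ (TensorProduct.rightComm k K B B).toLinearMap) ∘ₗ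
      (TensorProduct.mk k (B ⊗[k] (K ⊗[k] B)) (B ⊗[k] B)).flip (c ⊗ₜ d) =
      TensorProduct.map (LinearMap.mul' k B ∘ₗ
        (M.act ∘ₗ (TensorProduct.mk k K B).flip c).lTensor B) (LinearMap.mulRight k d) ∘ₗ
        (TensorProduct.assoc k B K B).symm.toLinearMap := by
    ext b x y
    simp [middle]
  rw [e]
  exact LinearMap.congr_fun e' (M.coact.lTensor B u)

/-- The same bookkeeping for the coproduct of the biproduct: in A ⊗ A it becomes (u₁ u₂₍₋₁₎ ⊗
u₂₍₀₎)(g ⊗ g). -/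
lemma map_middle_coact (D : BraidedHopfData k K B) (φ : B →ₐ[k] A) (ι : K →ₐ[k] A) (g : K)
    (u : B ⊗[k] B) :
    TensorProduct.map (LinearMap.mul' k A ∘ₗ TensorProduct.map φ.toLinearMap ι.toLinearMap)
      (LinearMap.mul' k A ∘ₗ TensorProduct.map φ.toLinearMap ι.toLinearMap)
      (middle ((LinearMap.mul' k K).rTensor B ∘ₗ
        TensorProduct.rightComm k K B K ∘ₗ D.coact.rTensor K) (u ⊗ₜ (g ⊗ₜ g))) =
      TensorProduct.map (LinearMap.mul' k A ∘ₗ TensorProduct.map φ.toLinearMap ι.toLinearMap)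
        φ.toLinearMap ((TensorProduct.assoc k B K B).symm (D.coact.lTensor B u)) *
          (ι g ⊗ₜ ι g) := by
  have e1 : ∀ w : B ⊗[k] (K ⊗[k] B),
      TensorProduct.map (LinearMap.mul' k A ∘ₗ TensorProduct.map φ.toLinearMap ι.toLinearMap)
      (LinearMap.mul' k A ∘ₗ TensorProduct.map φ.toLinearMap ι.toLinearMap)
      (middle ((LinearMap.mul' k K).rTensor B ∘ₗ
        (TensorProduct.rightComm k K B K).toLinearMap) (w ⊗ₜ (g ⊗ₜ g))) =
      TensorProduct.map (LinearMap.mul' k A ∘ₗ TensorProduct.map φ.toLinearMap ι.toLinearMap)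
        φ.toLinearMap ((TensorProduct.assoc k B K B).symm w) * (ι g ⊗ₜ ι g) := by
    intro w
    induction w with
    | zero => simp
    | add x y hx hy => simp only [map_add, TensorProduct.add_tmul, add_mul, hx, hy]
    | tmul b v =>
      induction v with
      | zero => simp
      | add x y hx hy =>
        simp only [TensorProduct.tmul_add, map_add, TensorProduct.add_tmul, add_mul, hx, hy]
      | tmul x c => simp [middle, mul_assoc]
  rw [← e1]
  congr 1
  induction u with
  | zero => simp
  | add x y hx hy => simp only [map_add, TensorProduct.add_tmul, hx, hy]
  | tmul x y => simp [middle]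

end YetterDrinfeld

namespace IsSplitProjection

variable {π : A →ₐ[k] K} {ι : K →ₐ[k] A} (h : IsSplitProjection π ι)

include h

/-- This is `map_proj_retract_comul` when the right coaction of a is the single tensor a ⊗ g. -/
lemma rightComm_coactLeft_retract {a : A} {g : K} (ha : coactRight π a = a ⊗ₜ g) :
    (LinearMap.mul' k K).rTensor (coinv π) (TensorProduct.rightComm k K (coinv π) K
      (h.coactLeft (h.retract a) ⊗ₜ g)) =
      TensorProduct.map π.toLinearMap h.retract (comul (R := k) a) := by
  rw [← h.map_proj_retract_comul, ← LinearMap.comp_id (h.coactLeft ∘ₗ h.retract),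
    ← LinearMap.rTensor_map, ← coactRight_apply, ha]
  rfl

omit h in
lemma map_id_comul_mul (π : A →ₐ[k] K) (u v : A ⊗[k] A) :
    TensorProduct.map π.toLinearMap LinearMap.id (u * v) =
      TensorProduct.map π.toLinearMap LinearMap.id u *
        TensorProduct.map π.toLinearMap LinearMap.id v :=
  map_mul (Algebra.TensorProduct.map π (AlgHom.id k A)) u v

lemma map_proj_retract_incl_mul (g : K) (u : A ⊗[k] A) :
    TensorProduct.map π.toLinearMap h.retract ((ι g ⊗ₜ ι g) * u) =
      TensorProduct.map (LinearMap.mul' k K) h.adj (TensorProduct.tensorTensorTensorComm k K K K _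
        ((g ⊗ₜ g) ⊗ₜ TensorProduct.map π.toLinearMap h.retract u)) := by
  induction u with
  | zero => simp
  | add x y hx hy => simp only [mul_add, map_add, TensorProduct.tmul_add, hx, hy]
  | tmul x y => simp [adj_tmul, h.retract_mul_retract, h.proj_incl]

lemma isYetterDrinfeld : h.braided.toYDData.IsYetterDrinfeld where
  one_act v := by
    change h.retract (ι 1 * v) = v
    rw [map_one, one_mul, h.retract_coe]
  mul_act g x v := by
    change h.retract (ι (g * x) * v) = h.retract (ι g * h.retract (ι x * v))
    rw [h.retract_mul_retract, map_mul ι, mul_assoc]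
  counit_coact := LinearMap.ext h.counit_coactLeft
  coassoc_coact := LinearMap.ext h.coassoc_coactLeft
  compat := tensor_ext_groupLike h.span_groupLike fun g hg v => by
    -- The compatibility at g computes the coaction of p(ι(g)v), and ι(g)v is homogeneous of right
    -- degree g.
    have e : coactRight π (ι g * v) = (ι g * v : A) ⊗ₜ g := by
      rw [map_mul, h.coactRight_incl hg, coactRight_coe, Algebra.TensorProduct.tmul_mul_tmul,
        mul_one]
    have e' := h.rightComm_coactLeft_retract e
    rw [h.comul_incl_mul _ hg, h.map_proj_retract_incl_mul] at e'
    simp only [LinearMap.comp_apply, LinearMap.rTensor_tmul, TensorProduct.map_tmul,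
      hg.comul_eq_tmul_self, LinearEquiv.coe_coe, TensorProduct.rightComm_tmul]
    exact e'.symm

lemma isHom_mul : (h.braided.toYDData.tensor h.braided.toYDData).IsHom h.braided.toYDData
    (LinearMap.mul' k (coinv π)) where
  act := tensor_ext_groupLike h.span_groupLike fun g hg v => by
    simp only [LinearMap.comp_apply, LinearMap.lTensor_tmul]
    induction v with
    | zero => simp
    | add x y hx hy => simp only [TensorProduct.tmul_add, map_add, hx, hy]
    | tmul b c =>
      rw [h.tensor_act_groupLike hg]
      apply Subtype.ext
      change ((h.adj (g ⊗ₜ b) : A)) * h.adj (g ⊗ₜ c) = h.adj (g ⊗ₜ (b * c))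
      rw [h.coe_adj hg, h.coe_adj hg, h.coe_adj hg]
      simp only [mul_assoc, MulMemClass.coe_mul]
      rw [← mul_assoc (ι (antipode k g)) (ι g), incl_antipode_mul hg, one_mul]
  coact := TensorProduct.ext' fun b c => by
    -- In K ⊗ A the claim is the multiplicativity of (π ⊗ id)Δ.
    apply lTensor_val_injective
    change (coinv π).val.toLinearMap.lTensor K (h.coactLeft (b * c)) =
      (coinv π).val.toLinearMap.lTensor K ((LinearMap.mul' k (coinv π)).lTensor K
      ((LinearMap.mul' k K).rTensor (coinv π ⊗[k] coinv π)
        (TensorProduct.tensorTensorTensorComm k K (coinv π) K (coinv π)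
          (h.coactLeft b ⊗ₜ h.coactLeft c))))
    rw [mul_tensorComm_eq, lTensor_val_coactLeft, lTensor_val_coactLeft, lTensor_val_coactLeft,
      MulMemClass.coe_mul, Bialgebra.comul_mul, map_id_comul_mul]

lemma coactLeft_one : h.coactLeft 1 = 1 ⊗ₜ 1 := by
  rw [coactLeft_apply, OneMemClass.coe_one, Bialgebra.comul_one, Algebra.TensorProduct.one_def,
    TensorProduct.map_tmul, AlgHom.toLinearMap_apply, map_one]
  congr 1
  exact h.retract_coe 1

lemma isHom_one : (YDData.unit k K).IsHom h.braided.toYDData (Algebra.linearMap k (coinv π)) where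
  act := tensor_ext_groupLike h.span_groupLike fun g hg c => by
    have : h.retract (ι g) = 1 := by
      simpa using h.retract_mul_incl 1 hg
    simp [YDData.unit, braided, hg.counit_eq_one, adj_tmul, Algebra.algebraMap_eq_smul_one, this]
  coact := by
    ext
    simp [YDData.unit, braided, h.coactLeft_one]

lemma map_retract_incl_mul {g : K} (hg : IsGroupLikeElem k g) (u : A ⊗[k] A) :
    TensorProduct.map h.retract h.retract ((ι g ⊗ₜ ι g) * u) =
      (h.braided.toYDData.tensor h.braided.toYDData).act
        (g ⊗ₜ TensorProduct.map h.retract h.retract u) := by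
  induction u with
  | zero => simp
  | add x y hx hy => simp only [mul_add, map_add, TensorProduct.tmul_add, hx, hy]
  | tmul x y =>
    rw [TensorProduct.map_tmul, h.tensor_act_groupLike hg]
    simp [adj_tmul, h.retract_mul_retract]

/-- On `Δ(b)` the coaction of the second factor is given by the comultiplication. -/
lemma map_coactLeft_comul {V : Type*} [AddCommGroup V] [Module k V] (f : A →ₗ[k] V)
    (b : coinv π) :
    TensorProduct.map f (h.coactLeft ∘ₗ h.retract) (comul (R := k) (b : A)) =
      TensorProduct.assoc k V K (coinv π) (TensorProduct.map
        (TensorProduct.map f π.toLinearMap ∘ₗ comul) h.retract (comul (R := k) (b : A))) := by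
  rw [← map_comul_right]
  exact h.map_comp_retract_comul f (TensorProduct.map π.toLinearMap h.retract ∘ₗ comul) b

lemma isHom_comul : h.braided.toYDData.IsHom (h.braided.toYDData.tensor h.braided.toYDData)
    h.braided.comul where
  act := tensor_ext_groupLike h.span_groupLike fun g hg b => by
    rw [LinearMap.comp_apply, LinearMap.comp_apply, LinearMap.lTensor_tmul,
      h.braided_comul_apply b, ← h.map_retract_incl_mul hg, ← h.comul_incl_mul _ hg,
      ← h.braided_comul_retract]
    rfl
  coact := by
    ext b : 1
    -- By coassociativity the coaction of Δ(b) is p(b₁)₍₋₁₎ π(b₂) ⊗ p(b₁)₍₀₎ ⊗ p(b₃), and this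
    -- identity turns it into π(b₁) ⊗ p(b₂) ⊗ p(b₃).
    have e2 : ((LinearMap.mul' k K).rTensor (coinv π) ∘ₗ
        (TensorProduct.rightComm k K (coinv π) K).toLinearMap) ∘ₗ
        TensorProduct.map (h.coactLeft ∘ₗ h.retract) π.toLinearMap ∘ₗ comul =
        TensorProduct.map π.toLinearMap h.retract ∘ₗ comul (R := k) :=
      LinearMap.ext h.map_proj_retract_comul
    rw [LinearMap.comp_apply, LinearMap.comp_apply, braided_comul_apply, tensor_coact_apply,
      ← LinearMap.comp_apply (TensorProduct.map _ _) (TensorProduct.map _ _),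
      ← TensorProduct.map_comp]
    change TensorProduct.assoc k K (coinv π) (coinv π) (LinearMap.rTensor _ _
      ((TensorProduct.assoc k (K ⊗[k] coinv π) K (coinv π)).symm (TensorProduct.map
        (h.coactLeft ∘ₗ h.retract) (h.coactLeft ∘ₗ h.retract) (comul (R := k) (b : A))))) = _
    rw [h.map_coactLeft_comul, LinearEquiv.symm_apply_apply, LinearMap.rTensor_map, e2,
      ← map_comul_right]
    change _ = h.braided.comul.lTensor K (h.coactLeft b)
    rw [coactLeft_apply, LinearMap.lTensor_map, braided_comul_comp_retract]

lemma counit_comp_retract :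
    h.braided.counit ∘ₗ h.retract = counit (R := k) (A := A) :=
  LinearMap.ext h.counit_retract

lemma isHom_counit : h.braided.toYDData.IsHom (YDData.unit k K) h.braided.counit where
  act := tensor_ext_groupLike h.span_groupLike fun g hg b => by
    change counit (R := k) (h.retract (ι g * b) : A) = _
    rw [h.counit_retract, Bialgebra.counit_mul, (h.incl_groupLike hg).counit_eq_one]
    simp [YDData.unit, hg.counit_eq_one, braided]
  coact := by
    ext b : 1
    change (1 : K) ⊗ₜ[k] counit (R := k) (b : A) = h.braided.counit.lTensor K (h.coactLeft b)
    rw [coactLeft_apply, LinearMap.lTensor_map, counit_comp_retract, map_comul_counit,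
      AlgHom.toLinearMap_apply, proj_coe, Algebra.algebraMap_eq_smul_one, TensorProduct.smul_tmul,
      smul_eq_mul, mul_one]

/-- (π ⊗ id)Δ(S b) = Sπ(b₂) ⊗ S(b₁), where coinvariance replaces π(b₂) by 1. So S(b) has left degree
1 and ι(g) S(b) has left degree g. -/
lemma coactLeft_antipode {b : coinv π} {g : K} (hg : IsGroupLikeElem k g)
    (hb : h.coactLeft b = g ⊗ₜ b) :
    h.coactLeft (h.braided.antipode b) = g ⊗ₜ h.braided.antipode b := by
  apply lTensor_val_injective
  have e : π.toLinearMap ∘ₗ antipode k = antipode k ∘ₗ π.toLinearMap :=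
    LinearMap.ext h.proj_antipode
  have e' := congrArg ((TensorProduct.comm k A K).toLinearMap ∘ₗ
    TensorProduct.map (antipode k) (antipode k)) (coactRight_coe b)
  rw [LinearMap.comp_apply, coactRight_apply, ← LinearMap.comp_apply (TensorProduct.map _ _),
    ← TensorProduct.map_comp, LinearMap.comp_id, ← e] at e'
  rw [lTensor_val_coactLeft, coe_braided_antipode, h.skewAntipode_homogeneous hb,
    h.comul_incl_mul _ hg, map_id_comul_mul, comul_antipode, ← LinearMap.comp_apply
    (TensorProduct.map _ _) (TensorProduct.map _ _), ← TensorProduct.map_comp, map_comm_apply,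
    LinearMap.id_comp]
  simp only [LinearEquiv.coe_coe, LinearMap.comp_apply] at e'
  rw [e']
  simp [h.proj_incl, coe_braided_antipode, h.skewAntipode_homogeneous hb]

lemma isHom_antipode : h.braided.toYDData.IsHom h.braided.toYDData h.braided.antipode where
  act := tensor_ext_groupLike h.span_groupLike fun g hg b => by
    apply Subtype.ext
    change (h.braided.antipode (h.retract (ι g * b)) : A) = h.adj (g ⊗ₜ h.braided.antipode b)
    rw [h.coe_braided_antipode_retract, h.skewAntipode_incl_mul _ hg, h.coe_adj hg,
      coe_braided_antipode]
  coact := by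
    refine LinearMap.ext_on
      (s := {x | ∃ g, IsGroupLikeElem k g ∧ h.coactLeft x = g ⊗ₜ x})
      (eq_top_iff.2 fun b _ => h.mem_span_homogeneous_coinv b) ?_
    rintro b ⟨g, hg, hb⟩
    change h.coactLeft (h.braided.antipode b) = h.braided.antipode.lTensor K (h.coactLeft b)
    rw [h.coactLeft_antipode hg hb, hb, LinearMap.lTensor_tmul]

/-- For v = z ⊗ w the left side is p(b₁ z) ⊗ p(b₂ w). The second leg of Δ(b) lies in B, so p(b₂ w) =
b₂ p(w), and `retract_mul_adj` expands p(b₁ z) as p(b₁)(π(b₂) · p(z)) with a further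
comultiplication. With v = Δ(c) this is the braided multiplicativity of Δ. -/
lemma map_retract_mul_eq (b : coinv π) (v : A ⊗[k] A) :
    TensorProduct.map h.retract h.retract (comul (R := k) (b : A) * v) =
      TensorProduct.map (LinearMap.mul' k (coinv π)) (LinearMap.mul' k (coinv π))
        (middle (h.braided.toYDData.braiding h.braided.toYDData)
          (h.braided.comul b ⊗ₜ TensorProduct.map h.retract h.retract v)) := by
  suffices e : TensorProduct.map h.retract h.retract ∘ₗ
      LinearMap.mul k (A ⊗[k] A) (comul (R := k) (b : A)) =
      TensorProduct.map (LinearMap.mul' k (coinv π)) (LinearMap.mul' k (coinv π)) ∘ₗ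
        middle (h.braided.toYDData.braiding h.braided.toYDData) ∘ₗ
          TensorProduct.mk k _ _ (h.braided.comul b) ∘ₗ
            TensorProduct.map h.retract h.retract from LinearMap.congr_fun e v
  refine TensorProduct.ext' fun z w => ?_
  have e1 : ∀ u : A ⊗[k] A, TensorProduct.map h.retract h.retract (u * z ⊗ₜ[k] w) =
      TensorProduct.map (h.retract ∘ₗ LinearMap.mulRight k z)
        (h.retract ∘ₗ LinearMap.mulRight k w) u := by
    intro u
    induction u with
    | zero => simp
    | add x y hx hy => simp only [add_mul, map_add, hx, hy]
    | tmul x y => simp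
  have e2 : (h.retract ∘ₗ LinearMap.mulRight k w) ∘ₗ (coinv π).val.toLinearMap ∘ₗ h.retract =
      LinearMap.mulRight k (h.retract w) ∘ₗ h.retract :=
    LinearMap.ext fun a => h.retract_coe_mul (h.retract a) w
  have e3 : (LinearMap.mul' k (coinv π) ∘ₗ
      (h.braided.act ∘ₗ (TensorProduct.mk k K (coinv π)).flip (h.retract z)).lTensor (coinv π)) ∘ₗ
      (TensorProduct.map h.retract π.toLinearMap ∘ₗ comul) =
      h.retract ∘ₗ LinearMap.mulRight k z := by
    ext a : 1
    have := h.retract_mul_adj a (h.retract z)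
    rw [h.retract_mul_retract] at this
    simp only [LinearMap.comp_apply]
    rw [LinearMap.lTensor_map]
    exact this
  change TensorProduct.map h.retract h.retract (comul (R := k) (b : A) * z ⊗ₜ w) =
    TensorProduct.map (LinearMap.mul' k (coinv π)) (LinearMap.mul' k (coinv π))
      (middle (h.braided.toYDData.braiding h.braided.toYDData)
        (h.braided.comul b ⊗ₜ (h.retract z ⊗ₜ h.retract w)))
  rw [braided_comul_apply, mul_middle_braiding, LinearMap.lTensor_map]
  change _ = TensorProduct.map _ _ ((TensorProduct.assoc k (coinv π) K (coinv π)).symm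
    (TensorProduct.map h.retract (h.coactLeft ∘ₗ h.retract) (comul (R := k) (b : A))))
  rw [map_coactLeft_comul, LinearEquiv.symm_apply_apply, ← LinearMap.comp_apply,
    ← TensorProduct.map_comp, e3, e1,
    ← h.map_comp_retract_comul, e2]

lemma isBraidedHopfAlgebra : h.braided.IsBraidedHopfAlgebra where
  yetterDrinfeld := h.isYetterDrinfeld
  mul_hom := h.isHom_mul
  one_hom := h.isHom_one
  comul_hom := h.isHom_comul
  counit_hom := h.isHom_counit
  antipode_hom := h.isHom_antipode
  coassoc := by
    ext b : 1
    simp only [LinearMap.comp_apply, LinearEquiv.coe_coe, braided_comul_apply]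
    rw [LinearMap.rTensor_map, LinearMap.lTensor_map, braided_comul_comp_retract, map_comul_right]
  rTensor_counit_comul := by
    ext b : 1
    simp only [LinearMap.comp_apply, LinearEquiv.coe_coe, braided_comul_apply]
    rw [LinearMap.rTensor_map, counit_comp_retract, map_counit_comul]
    simp [h.retract_coe]
  lTensor_counit_comul := by
    ext b : 1
    simp only [LinearMap.comp_apply, LinearEquiv.coe_coe, braided_comul_apply]
    rw [LinearMap.lTensor_map, counit_comp_retract, map_comul_counit]
    simp [h.retract_coe]
  counit_one := Bialgebra.counit_one (R := k) (A := A)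
  counit_mul a b := Bialgebra.counit_mul (R := k) (a : A) (b : A)
  comul_one := by
    rw [braided_comul_apply, OneMemClass.coe_one, Bialgebra.comul_one,
      Algebra.TensorProduct.one_def, TensorProduct.map_tmul]
    have : h.retract 1 = 1 := h.retract_coe 1
    rw [this]
  comul_mul := TensorProduct.ext' fun b c => by
    rw [LinearMap.comp_apply, LinearMap.mul'_apply, braided_comul_apply, MulMemClass.coe_mul,
      Bialgebra.comul_mul, map_retract_mul_eq]
    rfl
  mul_antipode_rTensor := by
    ext b : 1
    apply Subtype.ext
    have e1 : ∀ u : A ⊗[k] A, (LinearMap.mul' k (coinv π) (h.braided.antipode.rTensor _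
        (TensorProduct.map h.retract h.retract u)) : A) = LinearMap.mul' k A
        (TensorProduct.map (skewAntipode π ι)
          (LinearMap.id ∘ₗ (coinv π).val.toLinearMap ∘ₗ h.retract) u) := by
      intro u
      induction u with
      | zero => simp
      | add x y hx hy => simp only [map_add, AddMemClass.coe_add, hx, hy]
      | tmul x y => simp [h.coe_braided_antipode_retract]
    have e2 : LinearMap.mul' k A ∘ₗ TensorProduct.map (antipode k) LinearMap.id ∘ₗ comul =
        Algebra.linearMap k A ∘ₗ counit := HopfAlgebra.mul_antipode_rTensor_comul
    -- In convolution notation (ιπ ∗ S) ∗ id = ιπ ∗ (S ∗ id) = ιπ, which is ε on B.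
    rw [LinearMap.comp_apply, LinearMap.comp_apply, braided_comul_apply, e1,
      h.map_comp_retract_comul, skewAntipode, ← mul_map_comul_assoc, e2, ← LinearMap.lTensor_map,
      map_comul_counit]
    simp [proj_coe, braided]
  mul_antipode_lTensor := by
    ext b : 1
    apply Subtype.ext
    have e1 : ∀ u : A ⊗[k] A, (LinearMap.mul' k (coinv π) (h.braided.antipode.lTensor _
        (TensorProduct.map h.retract h.retract u)) : A) = LinearMap.mul' k A
        (TensorProduct.map ((coinv π).val.toLinearMap ∘ₗ h.retract) (skewAntipode π ι) u) := by
      intro u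
      induction u with
      | zero => simp
      | add x y hx hy => simp only [map_add, AddMemClass.coe_add, hx, hy]
      | tmul x y => simp [h.coe_braided_antipode_retract]
    -- p ∗ ιπ = id, hence p ∗ (ιπ ∗ S) = id ∗ S = ε.
    have e2 : LinearMap.mul' k A ∘ₗ TensorProduct.map ((coinv π).val.toLinearMap ∘ₗ h.retract)
        (ι.toLinearMap ∘ₗ π.toLinearMap) ∘ₗ comul = LinearMap.id :=
      LinearMap.ext h.retract_mul_proj
    rw [LinearMap.comp_apply, LinearMap.comp_apply, braided_comul_apply, e1,
      skewAntipode, mul_map_comul_assoc, e2]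
    exact HopfAlgebra.mul_antipode_lTensor_comul_apply (R := k) (b : A)

/-- The isomorphism `B ♯ K ≃ A`, `b ♯ h ↦ b ι(h)`. -/
def biproductEquiv : coinv π ⊗[k] K ≃ₗ[k] A :=
  LinearEquiv.ofLinearMap
    (LinearMap.mul' k A ∘ₗ TensorProduct.map (coinv π).val.toLinearMap ι.toLinearMap)
    -- The inverse is a ↦ p(a₁) ⊗ π(a₂).
    (TensorProduct.map h.retract π.toLinearMap ∘ₗ comul)
    (by
      ext a : 1
      have := h.retract_mul_proj a
      rw [TensorProduct.map_comp, LinearMap.comp_apply] at this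
      exact this)
    (tensor_ext_groupLike_right h.span_groupLike fun b g hg => by
      have := congrArg (h.retract.rTensor K) (h.coactRight_mul_incl b hg)
      rw [coactRight_apply, LinearMap.rTensor_map, LinearMap.comp_id, LinearMap.rTensor_tmul,
        h.retract_mul_incl b hg] at this
      exact this)

lemma biproductEquiv_tmul (b : coinv π) (x : K) : h.biproductEquiv (b ⊗ₜ x) = b * ι x := rfl

/-- The biproduct coproduct of b ♯ g maps to (p(b₁) ιπ(b₂) ⊗ p(b₃))(ι(g) ⊗ ι(g)). Here p(b₁) ιπ(b₂)
contracts by p ∗ ιπ = id, and p is superfluous on the last leg. -/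
lemma comul_biproductEquiv (b : coinv π) {g : K} (hg : IsGroupLikeElem k g) :
    comul (R := k) (h.biproductEquiv (b ⊗ₜ g)) = TensorProduct.map h.biproductEquiv.toLinearMap
      h.biproductEquiv.toLinearMap (h.braided.biproductComul (b ⊗ₜ g)) := by
  have e := map_middle_coact h.braided (coinv π).val ι g (h.braided.comul b)
  have e1 : LinearMap.mul' k A ∘ₗ TensorProduct.map (coinv π).val.toLinearMap
      ι.toLinearMap ∘ₗ TensorProduct.map h.retract π.toLinearMap ∘ₗ comul = LinearMap.id := by
    ext a : 1
    have := h.retract_mul_proj a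
    rw [TensorProduct.map_comp, LinearMap.comp_apply] at this
    exact this
  rw [braided_comul_apply, LinearMap.lTensor_map] at e
  change _ = TensorProduct.map _ _ ((TensorProduct.assoc k (coinv π) K (coinv π)).symm
      (TensorProduct.map h.retract (h.coactLeft ∘ₗ h.retract) (comul (R := k) (b : A)))) * _ at e
  rw [map_coactLeft_comul, LinearEquiv.symm_apply_apply, ← LinearMap.comp_apply
    (TensorProduct.map _ _) (TensorProduct.map _ _), ← TensorProduct.map_comp,
    LinearMap.comp_assoc, e1, h.map_id_retract_comul, ← h.comul_mul_incl _ hg] at e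
  rw [biproductEquiv_tmul, ← e, BraidedHopfData.biproductComul, LinearMap.comp_apply,
    TensorProduct.map_tmul, hg.comul_eq_tmul_self]
  rfl

/-- b ι(g) c ι(x) = b (ι(g) c ι(S g)) ι(g x), and the bracket is the action of g on c. -/
lemma biproductEquiv_mul (b c : coinv π) {g : K} (hg : IsGroupLikeElem k g) (x : K) :
    h.biproductEquiv (h.braided.biproductMul ((b ⊗ₜ g) ⊗ₜ (c ⊗ₜ x))) =
      h.biproductEquiv (b ⊗ₜ g) * h.biproductEquiv (c ⊗ₜ x) := by
  have : h.braided.biproductMul ((b ⊗ₜ g) ⊗ₜ (c ⊗ₜ x)) =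
      (b * h.adj (g ⊗ₜ c)) ⊗ₜ (g * x) := by
    simp [BraidedHopfData.biproductMul, middle, hg.comul_eq_tmul_self, braided]
  rw [this, biproductEquiv_tmul, biproductEquiv_tmul, biproductEquiv_tmul, MulMemClass.coe_mul,
    h.coe_adj hg, map_mul]
  simp only [mul_assoc]
  rw [← mul_assoc (ι (antipode k g)), incl_antipode_mul hg, one_mul]

end IsSplitProjection

end Biproduct

/-! ### Gradings on the coinvariants -/

section Biproduct

open Coalgebra HopfAlgebra

variable {k A K : Type*} [Field k] [Ring A] [HopfAlgebra k A] [Ring K] [HopfAlgebra k K]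

/-- A grading of the Hopf algebra `A` for which `π` and `ι` are the projection onto and the
inclusion of the component of degree zero. -/
structure IsGradedProjection (π : A →ₐ[k] K) (ι : K →ₐ[k] A) (𝓐 : ℕ → Submodule k A) : Prop
    extends IsSplitProjection π ι where
  isInternal : DirectSum.IsInternal 𝓐
  mul_mem : ∀ {m n : ℕ} {a b : A}, a ∈ 𝓐 m → b ∈ 𝓐 n → a * b ∈ 𝓐 (m + n)
  comul_mem : ∀ {n : ℕ} {a : A}, a ∈ 𝓐 n → comul (R := k) a ∈
    ⨆ p ∈ Finset.HasAntidiagonal.antidiagonal n, tensorSub k (𝓐 p.1) (𝓐 p.2)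
  antipode_mem : ∀ {n : ℕ} {a : A}, a ∈ 𝓐 n → antipode k a ∈ 𝓐 n
  proj_eq_zero : ∀ {n : ℕ} {a : A}, n ≠ 0 → a ∈ 𝓐 n → π a = 0
  incl_mem : ∀ x, ι x ∈ 𝓐 0
  exists_incl : ∀ a ∈ 𝓐 0, ∃ x, ι x = a

namespace IsSplitProjection

variable {π : A →ₐ[k] K} {ι : K →ₐ[k] A} (h : IsSplitProjection π ι)

include h

lemma isBiproductIso {𝓑 : ℕ → Submodule k (coinv π)} {𝓐 : ℕ → Submodule k A}
    (hgr : ∀ n, (tensorSub k (𝓑 n) ⊤).map h.biproductEquiv.toLinearMap = 𝓐 n) :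
    h.braided.IsBiproductIso 𝓑 𝓐 h.biproductEquiv where
  map_one := by
    rw [biproductEquiv_tmul, map_one, mul_one]
    rfl
  map_mul := by
    refine TensorProduct.ext (tensor_ext_groupLike_right h.span_groupLike fun b g hg => ?_)
    refine TensorProduct.ext' fun c x => ?_
    exact h.biproductEquiv_mul b c hg x
  map_comul := tensor_ext_groupLike_right h.span_groupLike fun b g hg =>
    h.comul_biproductEquiv b hg
  map_counit := TensorProduct.ext' fun b x => by
    change counit (R := k) (b * ι x : A) = counit (R := k) (b : A) * counit (R := k) x
    rw [Bialgebra.counit_mul, h.counit_incl]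
  map_grading := hgr

lemma retract_incl (x : K) : h.retract (ι x) = counit (R := k) x • 1 := by
  have : h.retract ∘ₗ ι.toLinearMap = (LinearMap.toSpanSingleton k (coinv π) 1) ∘ₗ counit :=
    hom_ext_groupLike h.span_groupLike fun g hg => by
      have := h.retract_mul_incl 1 hg
      simpa [hg.counit_eq_one] using this
  exact LinearMap.congr_fun this x

end IsSplitProjection

namespace IsGradedProjection

variable {π : A →ₐ[k] K} {ι : K →ₐ[k] A} {𝓐 : ℕ → Submodule k A}
  (h : IsGradedProjection π ι 𝓐)

/-- The components `B ∩ 𝓐ₙ` of the algebra of coinvariants. -/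
def coinvComponent (π : A →ₐ[k] K) (𝓐 : ℕ → Submodule k A) (n : ℕ) : Submodule k (coinv π) :=
  (𝓐 n).comap (coinv π).val.toLinearMap

lemma mem_coinvComponent {n : ℕ} {b : coinv π} : b ∈ coinvComponent π 𝓐 n ↔ (b : A) ∈ 𝓐 n :=
  Iff.rfl

include h

lemma map_comul_mem {V : Type*} [AddCommGroup V] [Module k V] (L : A ⊗[k] A →ₗ[k] V)
    {Z : Submodule k V} {n : ℕ} (H : ∀ i j, i + j = n → ∀ x ∈ 𝓐 i, ∀ y ∈ 𝓐 j, L (x ⊗ₜ y) ∈ Z)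
    {a : A} (ha : a ∈ 𝓐 n) : L (comul (R := k) a) ∈ Z := by
  have : ⨆ p ∈ Finset.HasAntidiagonal.antidiagonal n, tensorSub k (𝓐 p.1) (𝓐 p.2) ≤ Z.comap L :=
    iSup₂_le fun p hp => tensorSub_le.2 fun x hx y hy =>
      H p.1 p.2 (by simpa using hp) x hx y hy
  exact this (h.comul_mem ha)

lemma counit_eq_zero {n : ℕ} (hn : n ≠ 0) {a : A} (ha : a ∈ 𝓐 n) : counit (R := k) a = 0 := by
  rw [← h.counit_proj, h.proj_eq_zero hn ha, map_zero]

lemma incl_mul_mem (x : K) {n : ℕ} {a : A} (ha : a ∈ 𝓐 n) : ι x * a ∈ 𝓐 n := by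
  simpa using h.mul_mem (h.incl_mem x) ha

lemma mul_incl_mem (x : K) {n : ℕ} {a : A} (ha : a ∈ 𝓐 n) : a * ι x ∈ 𝓐 n := by
  simpa using h.mul_mem ha (h.incl_mem x)

/-- In a₁ ιSπ(a₂) only the terms with a₂ of degree zero survive π, so a₁ has the full degree n and
is multiplied by an element of degree zero. -/
lemma retract_mem {n : ℕ} {a : A} (ha : a ∈ 𝓐 n) : h.retract a ∈ coinvComponent π 𝓐 n := by
  refine h.map_comul_mem (LinearMap.mul' k A ∘ₗ (ι.toLinearMap ∘ₗ antipode k).lTensor A ∘ₗ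
    TensorProduct.map LinearMap.id π.toLinearMap) (fun i j hij x hx y hy => ?_) ha
  rcases eq_or_ne j 0 with rfl | hj
  · rw [add_zero] at hij
    subst hij
    exact h.mul_incl_mem _ hx
  · simp [h.proj_eq_zero hj hy]

lemma skewAntipode_mem_component {n : ℕ} {a : A} (ha : a ∈ 𝓐 n) :
    IsSplitProjection.skewAntipode π ι a ∈ 𝓐 n := by
  refine h.map_comul_mem (LinearMap.mul' k A ∘ₗ TensorProduct.map
    (ι.toLinearMap ∘ₗ π.toLinearMap) (antipode k)) (fun i j hij x hx y hy => ?_) ha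
  rcases eq_or_ne i 0 with rfl | hi
  · rw [zero_add] at hij
    subst hij
    exact h.incl_mul_mem _ (h.antipode_mem hy)
  · simp [h.proj_eq_zero hi hx]

/-- Independence is inherited from A. The components span B because `retract` is a graded map that
is the identity on B. -/
lemma isInternal_coinvComponent : DirectSum.IsInternal (coinvComponent π 𝓐) := by
  rw [DirectSum.isInternal_submodule_iff_iSupIndep_and_iSup_eq_top]
  obtain ⟨hi, ht⟩ := (DirectSum.isInternal_submodule_iff_iSupIndep_and_iSup_eq_top _).1 h.isInternal
  constructor
  · intro n
    rw [Submodule.disjoint_def]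
    intro b hb hb'
    have : ⨆ j, ⨆ (_ : j ≠ n), coinvComponent π 𝓐 j ≤
        (⨆ j, ⨆ (_ : j ≠ n), 𝓐 j).comap (coinv π).val.toLinearMap :=
      iSup₂_le fun j hj => Submodule.comap_mono (le_iSup₂_of_le j hj le_rfl)
    exact Subtype.ext (Submodule.disjoint_def.1 (hi n) _ hb (this hb'))
  · rw [eq_top_iff]
    intro b _
    have : ⨆ n, 𝓐 n ≤ (⨆ n, coinvComponent π 𝓐 n).comap h.retract :=
      iSup_le fun n a ha => Submodule.mem_iSup_of_mem n (h.retract_mem ha)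
    have hb := this (ht ▸ Submodule.mem_top : (b : A) ∈ ⨆ n, 𝓐 n)
    rwa [Submodule.mem_comap, h.retract_coe] at hb

lemma isGraded : h.braided.IsGraded (coinvComponent π 𝓐) where
  isInternal := h.isInternal_coinvComponent
  one_mem := by
    rw [mem_coinvComponent, OneMemClass.coe_one, ← map_one ι]
    exact h.incl_mem 1
  mul_mem _ _ _ ha _ hb := h.mul_mem ha hb
  act_mem n x b hb := h.retract_mem (h.incl_mul_mem x hb)
  coact_mem n b hb := by
    refine h.map_comul_mem (TensorProduct.map π.toLinearMap h.retract)
      (fun i j hij x hx y hy => ?_) hb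
    rcases eq_or_ne i 0 with rfl | hi
    · rw [zero_add] at hij
      subst hij
      exact tmul_mem_tensorSub Submodule.mem_top (h.retract_mem hy)
    · simp [h.proj_eq_zero hi hx]
  comul_mem n b hb := by
    refine h.map_comul_mem (TensorProduct.map h.retract h.retract)
      (fun i j hij x hx y hy => ?_) hb
    refine Submodule.mem_iSup_of_mem (i, j) (Submodule.mem_iSup_of_mem (by simpa using hij) ?_)
    exact tmul_mem_tensorSub (h.retract_mem hx) (h.retract_mem hy)
  counit_eq_zero n hn b hb := h.counit_eq_zero hn hb
  antipode_mem n b hb := h.retract_mem (h.skewAntipode_mem_component hb)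

/-- Degree zero of A is ι(K), and p(ι(x)) = ε(x) 1. -/
lemma coinvComponent_zero : coinvComponent π 𝓐 0 = Submodule.span k {1} := by
  apply le_antisymm
  · intro b hb
    obtain ⟨x, hx⟩ := h.exists_incl (b : A) hb
    rw [← h.retract_coe b, ← hx, h.retract_incl]
    exact Submodule.smul_mem _ _ (Submodule.mem_span_singleton_self _)
  · rw [Submodule.span_singleton_le_iff_mem]
    exact h.isGraded.one_mem

/-- The inverse a ↦ p(a₁) ⊗ π(a₂) keeps only terms with a₂ of degree zero, hence a₁ of degree n. -/
lemma map_biproductEquiv (n : ℕ) :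
    (tensorSub k (coinvComponent π 𝓐 n) ⊤).map h.biproductEquiv.toLinearMap = 𝓐 n := by
  apply le_antisymm
  · rw [Submodule.map_le_iff_le_comap, tensorSub_le]
    intro b hb x _
    exact h.mul_incl_mem x hb
  · intro a ha
    refine ⟨h.biproductEquiv.symm a, ?_, h.biproductEquiv.apply_symm_apply a⟩
    refine h.map_comul_mem (TensorProduct.map h.retract π.toLinearMap)
      (fun i j hij x hx y hy => ?_) ha
    rcases eq_or_ne j 0 with rfl | hj
    · rw [add_zero] at hij
      subst hij
      exact tmul_mem_tensorSub (h.retract_mem hx) Submodule.mem_top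
    · simp [h.proj_eq_zero hj hy]

end IsGradedProjection

end Biproduct

/-! ### Noetherian graded algebras and retracts of Noetherian rings -/

section Finiteness

open Coalgebra HopfAlgebra

variable {k S : Type*} [Field k] [Ring S] [Algebra k S]

/-- If `S` is left or right Noetherian then the left, or the right, ideal generated by a set `X`
is generated by finitely many elements of `X`. -/
lemma exists_finset_span_mul (hS : IsNoetherianRing S ∨ IsNoetherianRing Sᵐᵒᵖ) :
    ∃ m : S →ₗ[k] S →ₗ[k] S, (m = LinearMap.mul k S ∨ m = (LinearMap.mul k S).flip) ∧
      ∀ X : Set S, ∃ t : Finset S, ↑t ⊆ X ∧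
        ∀ x ∈ X, x ∈ Submodule.span k {z | ∃ a, ∃ y ∈ t, z = m a y} := by
  -- `m a y` is a y or y a according to the side of the hypothesis, so later arguments treat both
  -- sides at once.
  rcases hS with hS | hS
  · refine ⟨_, .inl rfl, fun X => ?_⟩
    obtain ⟨t, ht, hspan⟩ := (Submodule.fg_span_iff_fg_span_finset_subset X).1
      (IsNoetherian.noetherian (Submodule.span S X))
    refine ⟨t, ht, fun x hx => ?_⟩
    have hx' : x ∈ Submodule.span S (t : Set S) := hspan ▸ Submodule.subset_span hx
    obtain ⟨c, -, rfl⟩ := Submodule.mem_span_finset.1 hx'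
    exact sum_mem fun y hy => Submodule.subset_span ⟨c y, y, hy, rfl⟩
  · refine ⟨_, .inr rfl, fun X => ?_⟩
    have : IsNoetherian Sᵐᵒᵖ S :=
      isNoetherian_of_linearEquiv (MulOpposite.opLinearEquiv Sᵐᵒᵖ (M := S)).symm
    obtain ⟨t, ht, hspan⟩ := (Submodule.fg_span_iff_fg_span_finset_subset X).1
      (IsNoetherian.noetherian (Submodule.span Sᵐᵒᵖ X))
    refine ⟨t, ht, fun x hx => ?_⟩
    have hx' : x ∈ Submodule.span Sᵐᵒᵖ (t : Set S) := hspan ▸ Submodule.subset_span hx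
    obtain ⟨c, -, rfl⟩ := Submodule.mem_span_finset.1 hx'
    exact sum_mem fun y hy => Submodule.subset_span ⟨(c y).unop, y, hy, rfl⟩

lemma exists_proj_of_isInternal {V : Type*} [AddCommGroup V] [Module k V]
    {𝓢 : ℕ → Submodule k V} (h : DirectSum.IsInternal 𝓢) (n : ℕ) :
    ∃ P : V →ₗ[k] V, (∀ x ∈ 𝓢 n, P x = x) ∧ ∀ m ≠ n, ∀ x ∈ 𝓢 m, P x = 0 := by
  let e := LinearEquiv.ofBijective (DirectSum.coeLinearMap 𝓢) h
  have he : ∀ m (x : V) (hx : x ∈ 𝓢 m), e.symm x = DirectSum.lof k ℕ (fun i => 𝓢 i) m ⟨x, hx⟩ :=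
    fun m x hx => by
      rw [LinearEquiv.symm_apply_eq]
      exact (DirectSum.coeLinearMap_lof 𝓢 m ⟨x, hx⟩).symm
  refine ⟨(𝓢 n).subtype ∘ₗ DirectSum.component k ℕ (fun i => 𝓢 i) n ∘ₗ e.symm.toLinearMap,
    fun x hx => ?_, fun m hm x hx => ?_⟩
  · simp [he n x hx, DirectSum.component.lof_self]
  · simp [he m x hx, DirectSum.component.of, hm]

/-- A left or right Noetherian `ℕ`-graded algebra whose component of degree zero lies in a finitely
generated subalgebra is finitely generated. -/
lemma finiteType_of_graded (hS : IsNoetherianRing S ∨ IsNoetherianRing Sᵐᵒᵖ)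
    {𝓢 : ℕ → Submodule k S} (h : DirectSum.IsInternal 𝓢)
    (hmul : ∀ {m n : ℕ} {a b : S}, a ∈ 𝓢 m → b ∈ 𝓢 n → a * b ∈ 𝓢 (m + n))
    (s : Finset S) (hs : ∀ x ∈ 𝓢 0, x ∈ Algebra.adjoin k (s : Set S)) : Algebra.FiniteType k S := by
  classical
  obtain ⟨m, hm, hX⟩ := exists_finset_span_mul (k := k) hS
  -- Finitely many homogeneous elements of positive degree generate the one-sided ideal generated by
  -- all of them.
  obtain ⟨t, ht, hspan⟩ := hX {x | ∃ n ≠ 0, x ∈ 𝓢 n}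
  have hmm : ∀ {i j : ℕ} {a b : S}, a ∈ 𝓢 i → b ∈ 𝓢 j → m a b ∈ 𝓢 (i + j) := by
    intro i j a b ha hb
    rcases hm with rfl | rfl
    · exact hmul ha hb
    · rw [add_comm]
      exact hmul hb ha
  have hma : ∀ (U : Subalgebra k S) {a b : S}, a ∈ U → b ∈ U → m a b ∈ U := by
    intro U a b ha hb
    rcases hm with rfl | rfl
    · exact mul_mem ha hb
    · exact mul_mem hb ha
  have htop := h.submodule_iSup_eq_top
  set U := Algebra.adjoin k ((s ∪ t : Finset S) : Set S) with hU
  have hsU : Algebra.adjoin k (s : Set S) ≤ U := Algebra.adjoin_mono (by simp)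
  have htU : ∀ y ∈ t, y ∈ U := fun y hy => Algebra.subset_adjoin (by simp [hy])
  have key : ∀ n, ∀ x ∈ 𝓢 n, x ∈ U := by
    intro n
    induction n using Nat.strong_induction_on with
    | _ n ih =>
    intro x hx
    rcases eq_or_ne n 0 with rfl | hn
    · exact hsU (hs x hx)
    -- Project an expression of x by terms `m a y` to degree n. Only the component of a of degree n
    -- - d contributes, where d is the degree of y; since d > 0, the induction hypothesis applies to
    -- it.
    obtain ⟨P, hP, hP'⟩ := exists_proj_of_isInternal h n
    have hle : Submodule.span k {z | ∃ a, ∃ y ∈ t, z = m a y} ≤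
        (Subalgebra.toSubmodule U).comap P := by
      rw [Submodule.span_le]
      rintro _ ⟨a, y, hy, rfl⟩
      obtain ⟨d, hd, hyd⟩ := ht hy
      have : ⨆ i, 𝓢 i ≤ (Subalgebra.toSubmodule U).comap (P ∘ₗ m.flip y) := by
        refine iSup_le fun i a ha => ?_
        change P (m a y) ∈ U
        by_cases hin : i + d = n
        · rw [hP _ (hin ▸ hmm ha hyd)]
          exact hma U (ih i (by omega) a ha) (htU y hy)
        · rw [hP' _ hin _ (hmm ha hyd)]
          exact zero_mem U
      exact this (htop ▸ Submodule.mem_top)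
    have := hle (hspan x ⟨n, hn, hx⟩)
    rwa [Submodule.mem_comap, hP x hx] at this
  refine ⟨⟨s ∪ t, ?_⟩⟩
  rw [eq_top_iff]
  intro x _
  have : ⨆ i, 𝓢 i ≤ Subalgebra.toSubmodule U := iSup_le key
  exact this (htop ▸ Submodule.mem_top)

/-- A ring `R` is Noetherian if it is a retract, as a right `R`-module, of a Noetherian ring. -/
lemma isNoetherianRing_of_retract {R T : Type*} [Ring R] [Ring T] (f : R →+* T) (E : T →+ R)
    (hE : ∀ t r, E (t * f r) = E t * r) (hf : ∀ r, E (f r) = r) [IsNoetherianRing T] :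
    IsNoetherianRing R := by
  -- The extended left ideal contracts back to I, since E sends each t f(y) with y ∈ I to E(t) y ∈
  -- I.
  have hmem : ∀ (I : Ideal R) (r : R), f r ∈ I.map f → r ∈ I := by
    intro I r hr
    have : ∀ x ∈ I.map f, E x ∈ I := by
      intro x hx
      -- E is not T-linear on the left, so the induction carries all left multiples of x.
      refine Submodule.span_induction (p := fun x _ => ∀ t, E (t * x) ∈ I) ?_ ?_ ?_ ?_ hx 1 |>
        fun h => by simpa using h
      · rintro _ ⟨y, hy, rfl⟩ t
        rw [hE]
        exact I.mul_mem_left _ hy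
      · simp
      · intro x y _ _ hx hy t
        rw [mul_add, map_add]
        exact add_mem (hx t) (hy t)
      · intro a x _ hx t
        rw [smul_eq_mul, ← mul_assoc]
        exact hx _
    simpa [hf] using this _ hr
  -- Extension of ideals is injective, so ascending chains in R are as bounded as those in T.
  have hmono : StrictMono (Ideal.map f) := by
    refine (Monotone.strictMono_of_injective (fun I J h => Ideal.map_mono h) ?_)
    intro I J hIJ
    ext r
    exact ⟨fun hr => hmem J r (hIJ ▸ Ideal.mem_map_of_mem f hr),
      fun hr => hmem I r (hIJ ▸ Ideal.mem_map_of_mem f hr)⟩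
  exact isNoetherian_iff'.2 hmono.wellFoundedGT

end Finiteness

/-! ### Noetherian Hopf algebras spanned by group-likes are affine -/

section GroupLikeFinite

open Coalgebra HopfAlgebra

variable {k K : Type*} [Field k] [Ring K] [HopfAlgebra k K]

/-- A left or right Noetherian Hopf algebra spanned by group-like elements is finitely
generated. -/
lemma finiteType_of_span_groupLike (hK : Submodule.span k {g : K | IsGroupLikeElem k g} = ⊤)
    (hN : IsNoetherianRing K ∨ IsNoetherianRing Kᵐᵒᵖ) : Algebra.FiniteType k K := by
  classical
  obtain ⟨m, hm, hX⟩ := exists_finset_span_mul (k := k) hN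
  -- Finitely many g - 1 generate the augmentation ideal on one side.
  obtain ⟨t, ht, hspan⟩ := hX {x | ∃ g, IsGroupLikeElem k g ∧ x = g - 1}
  -- Adding 1 recovers g from g - 1; the antipodes adjoined next are the inverses.
  let T : Finset K := t.image (fun y => y + 1)
  let U := Algebra.adjoin k ((T ∪ T.image (antipode k) : Finset K) : Set K)
  have hTU : ∀ g, g - 1 ∈ t → g ∈ U ∧ antipode k g ∈ U := fun g hg =>
    have hgT : g ∈ T := Finset.mem_image.2 ⟨g - 1, hg, sub_add_cancel g 1⟩
    ⟨Algebra.subset_adjoin (by simp [hgT]), Algebra.subset_adjoin (by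
      rw [Finset.coe_union]
      exact .inr (Finset.mem_image_of_mem _ hgT))⟩
  -- The indicator function of the group-likes lying in U. Multiplication by a group-like g that
  -- lies in U with its inverse preserves membership in U, so l kills all multiples of g - 1.
  let l : K →ₗ[k] k := (groupLikeBasis hK).constr k fun g => if g.val ∈ U then 1 else 0
  have hl : ∀ g, IsGroupLikeElem k g → l g = if g ∈ U then 1 else 0 := fun g hg => by
    have := (groupLikeBasis hK).constr_basis k
      (fun g : GroupLike k K => if g.val ∈ U then (1 : k) else 0) ⟨g, hg⟩
    rwa [groupLikeBasis_apply] at this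
  have hl0 : ∀ x y, y ∈ t → l (m x y) = 0 := by
    intro x y hy
    obtain ⟨g, hg, rfl⟩ := ht hy
    obtain ⟨h1, h2⟩ := hTU g hy
    have : l ∘ₗ m.flip (g - 1) = 0 := hom_ext_groupLike hK fun x hx => by
      have e1 : x * g ∈ U ↔ x ∈ U := ⟨fun h => by
        have := mul_mem h h2
        rwa [mul_assoc, hg.mul_antipode_cancel, mul_one] at this, fun h => mul_mem h h1⟩
      have e2 : g * x ∈ U ↔ x ∈ U := ⟨fun h => by
        have := mul_mem h2 h
        rwa [← mul_assoc, hg.antipode_mul_cancel, one_mul] at this, fun h => mul_mem h1 h⟩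
      rcases hm with rfl | rfl
      · simp [hl _ (hx.mul hg), hl _ hx, e1]
      · simp [hl _ (hg.mul hx), hl _ hx, e2]
    exact LinearMap.congr_fun this x
  have hgU : ∀ g, IsGroupLikeElem k g → g ∈ U := by
    intro g hg
    have : Submodule.span k {z | ∃ a, ∃ y ∈ t, z = m a y} ≤ LinearMap.ker l := by
      rw [Submodule.span_le]
      rintro _ ⟨a, y, hy, rfl⟩
      exact hl0 a y hy
    -- For an arbitrary group-like g this says l(g) = l(1) = 1, so g ∈ U.
    have h0 : l (g - 1) = 0 := this (hspan _ ⟨g, hg, rfl⟩)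
    by_contra hgU
    rw [map_sub, hl _ hg, hl _ .one, if_neg hgU, if_pos (one_mem U)] at h0
    simp at h0
  refine ⟨⟨_, (eq_top_iff.2 fun x _ => ?_ : U = ⊤)⟩⟩
  have : Submodule.span k {g : K | IsGroupLikeElem k g} ≤ Subalgebra.toSubmodule U :=
    Submodule.span_le.2 hgU
  exact this (hK ▸ Submodule.mem_top)

end GroupLikeFinite

/-! ### Finite generation of K, A and B -/

section Biproduct

open Coalgebra HopfAlgebra

variable {k A K : Type*} [Field k] [Ring A] [HopfAlgebra k A] [Ring K] [HopfAlgebra k K]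

namespace IsSplitProjection

variable {π : A →ₐ[k] K} {ι : K →ₐ[k] A} (h : IsSplitProjection π ι)

include h

/-- The projection of `A` onto `B` along the sum of the subspaces `B ι(g)` with `g ≠ 1`. -/
lemma exists_bimodule_retraction : ∃ E : A →ₗ[k] coinv π, (∀ b : coinv π, E b = b) ∧
    (∀ (b : coinv π) a, E (b * a) = b * E a) ∧ ∀ a (b : coinv π), E (a * b) = E a * b := by
  classical
  -- The coefficient of the group-like 1. Applied to the right coaction it extracts the component of
  -- degree 1, which is B.
  let c : K →ₗ[k] k := (groupLikeBasis h.span_groupLike).coord 1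
  have hc : ∀ g, IsGroupLikeElem k g → c g = if g = 1 then 1 else 0 := fun g hg => by
    have := (groupLikeBasis h.span_groupLike).repr_self ⟨g, hg⟩
    rw [groupLikeBasis_apply] at this
    simp only [c, Module.Basis.coord_apply, this, Finsupp.single_apply]
    congr 1
    exact propext ⟨fun h => congrArg GroupLike.val h, fun h => GroupLike.val_injective h⟩
  let E₀ : A →ₗ[k] A := (TensorProduct.rid k A).toLinearMap ∘ₗ c.lTensor A ∘ₗ
    (coactRight π).toLinearMap
  have hE₀ : ∀ (b : coinv π) g, IsGroupLikeElem k g →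
      E₀ (b * ι g) = if g = 1 then (b : A) else 0 := by
    intro b g hg
    simp only [E₀, LinearMap.comp_apply, AlgHom.toLinearMap_apply]
    rw [h.coactRight_mul_incl b hg]
    rw [LinearMap.lTensor_tmul, hc g hg]
    by_cases hg1 : g = 1 <;> simp [hg1]
  have hret : ∀ a, (h.retract (E₀ a) : A) = E₀ a := by
    intro a
    have : (coinv π).val.toLinearMap ∘ₗ h.retract ∘ₗ E₀ = E₀ := h.hom_ext fun b g hg => by
      simp only [LinearMap.comp_apply, hE₀ b g hg]
      split_ifs <;> simp [h.retract_coe]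
    exact LinearMap.congr_fun this a
  refine ⟨h.retract ∘ₗ E₀, fun b => ?_, fun b a => ?_, fun a b => ?_⟩
  · have := hE₀ b 1 .one
    rw [map_one, mul_one, if_pos rfl] at this
    rw [LinearMap.comp_apply, this, h.retract_coe]
  -- The coaction is multiplicative and sends b to b ⊗ 1, so extracting a degree commutes with
  -- multiplication by B on either side.
  · apply Subtype.ext
    rw [MulMemClass.coe_mul]
    refine (hret _).trans ?_
    rw [LinearMap.comp_apply h.retract, hret]
    simp only [E₀, LinearMap.comp_apply, AlgHom.toLinearMap_apply]
    rw [map_mul, coactRight_coe]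
    induction coactRight π a with
    | zero => simp
    | add x y hx hy => simp only [mul_add, map_add, hx, hy]
    | tmul x y => simp
  · apply Subtype.ext
    rw [MulMemClass.coe_mul]
    refine (hret _).trans ?_
    rw [LinearMap.comp_apply h.retract, hret]
    simp only [E₀, LinearMap.comp_apply, AlgHom.toLinearMap_apply]
    rw [map_mul, coactRight_coe]
    induction coactRight π a with
    | zero => simp
    | add x y hx hy => simp only [add_mul, map_add, hx, hy]
    | tmul x y => simp

/-- B is a direct summand of A as a bimodule. The left Noetherian case needs right linearity of the
projection and the other case left linearity; `retract` is in general linear only on the left. -/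
lemma isNoetherianRing_coinv (hN : IsNoetherianRing A ∨ IsNoetherianRing Aᵐᵒᵖ) :
    IsNoetherianRing (coinv π) ∨ IsNoetherianRing (coinv π)ᵐᵒᵖ := by
  obtain ⟨E, hE, hl, hr⟩ := h.exists_bimodule_retraction
  rcases hN with hN | hN
  · exact .inl (isNoetherianRing_of_retract (coinv π).val.toRingHom E.toAddMonoidHom hr hE)
  · refine .inr (isNoetherianRing_of_retract (T := Aᵐᵒᵖ) (RingHom.op (coinv π).val.toRingHom)
      (AddMonoidHom.mulOp E.toAddMonoidHom) ?_ ?_)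
    · intro a b
      exact congrArg MulOpposite.op (hl b.unop a.unop)
    · intro b
      exact congrArg MulOpposite.op (hE b.unop)

lemma isNoetherianRing_base (hN : IsNoetherianRing A ∨ IsNoetherianRing Aᵐᵒᵖ) :
    IsNoetherianRing K ∨ IsNoetherianRing Kᵐᵒᵖ := by
  have hs : Function.Surjective π.toRingHom := fun x => ⟨ι x, h.proj_incl x⟩
  rcases hN with hN | hN
  · exact .inl (isNoetherianRing_of_surjective A K π.toRingHom hs)
  · refine .inr (isNoetherianRing_of_surjective Aᵐᵒᵖ Kᵐᵒᵖ (RingHom.op π.toRingHom) fun x => ?_)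
    exact ⟨MulOpposite.op (ι x.unop), congrArg MulOpposite.op (h.proj_incl x.unop)⟩

end IsSplitProjection

namespace IsGradedProjection

variable {π : A →ₐ[k] K} {ι : K →ₐ[k] A} {𝓐 : ℕ → Submodule k A}
  (h : IsGradedProjection π ι 𝓐)

include h

lemma finiteType (hN : IsNoetherianRing A ∨ IsNoetherianRing Aᵐᵒᵖ) :
    Algebra.FiniteType k K ∧ Algebra.FiniteType k A ∧ Algebra.FiniteType k (coinv π) := by
  classical
  have hK := finiteType_of_span_groupLike h.span_groupLike (h.isNoetherianRing_base hN)
  obtain ⟨s, hs⟩ := hK.out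
  refine ⟨hK, finiteType_of_graded hN h.isInternal h.mul_mem (s.image ι) fun x hx => ?_,
    finiteType_of_graded (h.isNoetherianRing_coinv hN) h.isInternal_coinvComponent
      (fun ha hb => h.isGraded.mul_mem _ _ _ ha _ hb) ∅ fun x hx => ?_⟩
  · obtain ⟨y, rfl⟩ := h.exists_incl x hx
    rw [Finset.coe_image, ← AlgHom.map_adjoin, hs]
    exact ⟨y, trivial, rfl⟩
  -- B₀ = k lies in the subalgebra generated by the empty set.
  · rw [h.coinvComponent_zero] at hx
    have : Submodule.span k {(1 : coinv π)} ≤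
        Subalgebra.toSubmodule (Algebra.adjoin k ((∅ : Finset (coinv π)) : Set (coinv π))) := by
      rw [Submodule.span_singleton_le_iff_mem]
      exact one_mem (Algebra.adjoin k _)
    exact this hx

end IsGradedProjection

end Biproduct

/-! ### The coradical filtration is exhaustive -/

section Exhaustion

open Coalgebra

variable {k C : Type*} [Field k] [AddCommGroup C] [Module k C]

/-- Over a field, the coordinates of u along a basis of V lie in W and are separated by functionals.
-/
lemma tensor_eq_zero_of_forall_dual {V W : Type*} [AddCommGroup V] [Module k V] [AddCommGroup W]
    [Module k W] {u : V ⊗[k] W}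
    (hu : ∀ (f : V →ₗ[k] k) (g : W →ₗ[k] k), TensorProduct.map f g u = 0) : u = 0 := by
  classical
  let b := Module.Basis.ofVectorSpace k V
  apply (TensorProduct.equivFinsuppOfBasisLeft (N := W) b).injective
  rw [map_zero]
  ext i
  rw [TensorProduct.equivFinsuppOfBasisLeft_apply, Finsupp.zero_apply,
    ← Module.forall_dual_apply_eq_zero_iff k]
  intro g
  have h := congrArg (TensorProduct.lid k k) (hu (b.coord i) g)
  rw [map_zero] at h
  rw [← h]
  generalize b.coord i = f
  clear h hu
  induction u with
  | zero => simp
  | add x y hx hy => simp only [map_add, hx, hy]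
  | tmul x y => simp

variable [Coalgebra k C]

/-- The map `x ↦ f(x₁) x₂`. -/
def leftHit (f : C →ₗ[k] k) : C →ₗ[k] C :=
  (TensorProduct.lid k C).toLinearMap ∘ₗ f.rTensor C ∘ₗ comul

/-- The map `x ↦ g(x₂) x₁`. -/
def rightHit (g : C →ₗ[k] k) : C →ₗ[k] C :=
  (TensorProduct.rid k C).toLinearMap ∘ₗ g.lTensor C ∘ₗ comul

lemma apply_leftHit (f g : C →ₗ[k] k) (x : C) :
    g (leftHit f x) = TensorProduct.lid k k (TensorProduct.map f g (comul (R := k) x)) := by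
  simp only [leftHit, LinearMap.comp_apply]
  induction comul (R := k) x with
  | zero => simp
  | add x y hx hy => simp only [map_add, hx, hy]
  | tmul x y => simp

lemma apply_rightHit (f g : C →ₗ[k] k) (x : C) :
    f (rightHit g x) = TensorProduct.lid k k (TensorProduct.map f g (comul (R := k) x)) := by
  simp only [rightHit, LinearMap.comp_apply]
  induction comul (R := k) x with
  | zero => simp
  | add x y hx hy => simp only [map_add, hx, hy]
  | tmul x y => simp [mul_comm]

lemma counit_leftHit (f : C →ₗ[k] k) (x : C) : counit (R := k) (leftHit f x) = f x := by
  rw [apply_leftHit, ← LinearMap.comp_id counit, ← LinearMap.id_comp f]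
  have := congrArg (f.rTensor k) (Coalgebra.lTensor_counit_comul (R := k) x)
  rw [LinearMap.lTensor, LinearMap.rTensor_map, LinearMap.rTensor_tmul] at this
  simp only [LinearMap.comp_id, LinearMap.id_comp] at this ⊢
  rw [this]
  simp

lemma leftHit_counit : leftHit (k := k) (C := C) counit = LinearMap.id := by
  ext x
  simp [leftHit]

/-- Both sides are g(x₁) f(x₂) x₃: the operators are closed under composition. -/
lemma leftHit_leftHit (f g : C →ₗ[k] k) (x : C) : leftHit f (leftHit g x) =
    leftHit ((TensorProduct.lid k k).toLinearMap ∘ₗ TensorProduct.map g f ∘ₗ comul) x := by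
  have e := congrArg (TensorProduct.lid k _ ∘ (TensorProduct.lid k C).toLinearMap.lTensor k)
    (map_comul_right g f (LinearMap.id (R := k) (M := C)) x)
  simp only [Function.comp_apply] at e
  rw [LinearMap.lTensor_map] at e
  have e1 : ∀ u : C ⊗[k] C, TensorProduct.lid k C (TensorProduct.map g
      ((TensorProduct.lid k C).toLinearMap ∘ₗ TensorProduct.map f LinearMap.id ∘ₗ comul) u) =
      leftHit f (TensorProduct.lid k C (g.rTensor C u)) := by
    intro u
    induction u with
    | zero => simp
    | add x y hx hy => simp only [map_add, hx, hy]
    | tmul x y => simp [leftHit, LinearMap.rTensor]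
  have e2 : ∀ u : (k ⊗[k] k) ⊗[k] C,
      TensorProduct.lid k C ((TensorProduct.lid k C).toLinearMap.lTensor k
      (TensorProduct.assoc k k k C u)) = TensorProduct.lid k C
      ((TensorProduct.lid k k).toLinearMap.rTensor C u) := by
    intro u
    induction u with
    | zero => simp
    | add x y hx hy => simp only [map_add, hx, hy]
    | tmul x y =>
      induction x with
      | zero => simp
      | add x y hx hy => simp only [TensorProduct.add_tmul, map_add, hx, hy]
      | tmul x z => simp [smul_smul, mul_comm]
  rw [e1, e2, LinearMap.rTensor_map] at e
  exact e

/-- Both sides are f(x₁) g(x₃) x₂, so right hits are endomorphisms of C as a module over the left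
hits. -/
lemma leftHit_rightHit (f g : C →ₗ[k] k) (x : C) :
    leftHit f (rightHit g x) = rightHit g (leftHit f x) := by
  have e := congrArg (TensorProduct.lid k _ ∘ (TensorProduct.rid k C).toLinearMap.lTensor k)
    (map_comul_right f (LinearMap.id (R := k) (M := C)) g x)
  simp only [Function.comp_apply] at e
  rw [LinearMap.lTensor_map] at e
  have e1 : ∀ u : C ⊗[k] C, TensorProduct.lid k C (TensorProduct.map f
      ((TensorProduct.rid k C).toLinearMap ∘ₗ TensorProduct.map LinearMap.id g ∘ₗ comul) u) =
      rightHit g (TensorProduct.lid k C (f.rTensor C u)) := by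
    intro u
    induction u with
    | zero => simp
    | add x y hx hy => simp only [map_add, hx, hy]
    | tmul x y => simp [rightHit, LinearMap.lTensor]
  have e2 : ∀ u : (k ⊗[k] C) ⊗[k] k,
      TensorProduct.lid k C ((TensorProduct.rid k C).toLinearMap.lTensor k
      (TensorProduct.assoc k k C k u)) = TensorProduct.rid k C
      ((TensorProduct.lid k C).toLinearMap.rTensor k u) := by
    intro u
    induction u with
    | zero => simp
    | add x y hx hy => simp only [map_add, hx, hy]
    | tmul x y =>
      induction x with
      | zero => simp
      | add x y hx hy => simp only [TensorProduct.add_tmul, map_add, hx, hy]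
      | tmul x z => simp [smul_smul]
  have e3 : ∀ u : C ⊗[k] C, TensorProduct.rid k C (TensorProduct.map
      ((TensorProduct.lid k C).toLinearMap ∘ₗ TensorProduct.map f LinearMap.id ∘ₗ comul) g u) =
      leftHit f (TensorProduct.rid k C (g.lTensor C u)) := by
    intro u
    induction u with
    | zero => simp
    | add x y hx hy => simp only [map_add, hx, hy]
    | tmul x y => simp [leftHit, LinearMap.rTensor]
  rw [e1, e2, LinearMap.rTensor_map, e3] at e
  exact e.symm

variable (k C) in
/-- The algebra of the operators `x ↦ f(x₁) x₂`; its submodules in `C` are the left coideals. -/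
def HitAlgebra : Type _ := Algebra.adjoin k (Set.range (leftHit (k := k) (C := C)))

namespace HitAlgebra

instance : Ring (HitAlgebra k C) :=
  inferInstanceAs (Ring (Algebra.adjoin k (Set.range (leftHit (k := k) (C := C)))))

instance : Algebra k (HitAlgebra k C) :=
  inferInstanceAs (Algebra k (Algebra.adjoin k (Set.range (leftHit (k := k) (C := C)))))

instance : Module (HitAlgebra k C) C :=
  inferInstanceAs (Module (Algebra.adjoin k (Set.range (leftHit (k := k) (C := C)))) C)

instance : IsScalarTower k (HitAlgebra k C) C :=
  inferInstanceAs
    (IsScalarTower k (Algebra.adjoin k (Set.range (leftHit (k := k) (C := C)))) C)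

/-- The operator `x ↦ f(x₁) x₂` as an element of the algebra. -/
def of (f : C →ₗ[k] k) : HitAlgebra k C := ⟨leftHit f, Algebra.subset_adjoin ⟨f, rfl⟩⟩

/-- The operators already form an algebra: the counit gives the identity, and composition is a
convolution of functionals. -/
lemma exists_of_eq (a : HitAlgebra k C) : ∃ f : C →ₗ[k] k, a = of f := by
  obtain ⟨a, ha⟩ := a
  suffices ∃ f : C →ₗ[k] k, a = leftHit f from this.imp fun f hf => Subtype.ext hf
  induction ha using Algebra.adjoin_induction with
  | mem x hx =>
    obtain ⟨f, rfl⟩ := hx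
    exact ⟨f, rfl⟩
  | algebraMap r =>
    refine ⟨r • counit, ?_⟩
    ext x
    have := LinearMap.congr_fun (leftHit_counit (k := k) (C := C)) x
    simp only [leftHit, LinearMap.rTensor_smul, LinearMap.comp_apply, LinearMap.smul_apply,
      map_smul] at this ⊢
    rw [this]
    simp
  | add x y _ _ hx hy =>
    obtain ⟨f, rfl⟩ := hx
    obtain ⟨g, rfl⟩ := hy
    exact ⟨f + g, by ext x; simp [leftHit, LinearMap.rTensor_add]⟩
  | mul x y _ _ hx hy =>
    obtain ⟨f, rfl⟩ := hx
    obtain ⟨g, rfl⟩ := hy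
    exact ⟨_, LinearMap.ext fun x => leftHit_leftHit f g x⟩

end HitAlgebra

/-- The submodule of `C` given by a left coideal. -/
def hitSubmodule (X : Submodule k C) (hX : ∀ f : C →ₗ[k] k, ∀ x ∈ X, leftHit f x ∈ X) :
    Submodule (HitAlgebra k C) C where
  carrier := X
  add_mem' := add_mem
  zero_mem' := zero_mem X
  smul_mem' a x hx := by
    obtain ⟨f, rfl⟩ := HitAlgebra.exists_of_eq a
    exact hX f x hx

lemma leftHit_mem_submodule (X : Submodule (HitAlgebra k C) C) (f : C →ₗ[k] k) {x : C}
    (hx : x ∈ X) : leftHit f x ∈ X :=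
  X.smul_mem (HitAlgebra.of f) hx

/-- The map `x ↦ g(x₂) x₁` as a module endomorphism. -/
def rightHitLin (g : C →ₗ[k] k) : C →ₗ[HitAlgebra k C] C where
  toFun := rightHit g
  map_add' := map_add _
  map_smul' a x := by
    obtain ⟨f, rfl⟩ := HitAlgebra.exists_of_eq a
    exact (leftHit_rightHit f g x).symm

/-- From f(φ x) = ε(φ(f(x₁) x₂)) the map φ is determined by the functional ε ∘ φ. Any linear
extension g of that functional to C works. -/
lemma exists_rightHit_eq (N : Submodule (HitAlgebra k C) C) (φ : N →ₗ[HitAlgebra k C] C) :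
    ∃ g : C →ₗ[k] k, ∀ x : N, φ x = rightHit g (x : C) := by
  obtain ⟨g, hg⟩ := LinearMap.exists_extend (p := N.restrictScalars k)
    (counit (R := k) ∘ₗ φ.restrictScalars k)
  refine ⟨g, fun x => ?_⟩
  rw [← sub_eq_zero, ← Module.forall_dual_apply_eq_zero_iff k]
  intro f
  have h1 : φ (HitAlgebra.of f • x) = leftHit f (φ x) := map_smul φ _ x
  have h2 := LinearMap.congr_fun hg (⟨leftHit f (x : C), leftHit_mem_submodule N f x.2⟩)
  have h3 : g (leftHit f (x : C)) = counit (R := k) (φ (HitAlgebra.of f • x)) := h2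
  rw [h1, counit_leftHit, apply_leftHit, ← apply_rightHit] at h3
  rw [map_sub, h3, sub_self]

/-- Stability under the two kinds of hits places Δ(X) in X ⊗ C and in C ⊗ X; applying a projection
onto X on both legs places it in X ⊗ X. -/
lemma isSubcoalgebra_of_hit {X : Submodule k C} (hl : ∀ f : C →ₗ[k] k, ∀ x ∈ X, leftHit f x ∈ X)
    (hr : ∀ g : C →ₗ[k] k, ∀ x ∈ X, rightHit g x ∈ X) : IsSubcoalgebra k X := by
  intro x hx
  obtain ⟨P, hP, hP'⟩ := exists_proj X
  have h1 : TensorProduct.map (LinearMap.id - P) LinearMap.id (comul (R := k) x) = 0 := by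
    refine tensor_eq_zero_of_forall_dual fun f g => ?_
    apply (TensorProduct.lid k k).injective
    rw [← LinearMap.comp_apply, ← TensorProduct.map_comp, LinearMap.comp_id, ← apply_rightHit,
      LinearMap.comp_apply, LinearMap.sub_apply, hP' _ (hr g x hx), LinearMap.id_apply, sub_self,
      map_zero, map_zero]
  have h2 : TensorProduct.map LinearMap.id (LinearMap.id - P) (comul (R := k) x) = 0 := by
    refine tensor_eq_zero_of_forall_dual fun f g => ?_
    apply (TensorProduct.lid k k).injective
    rw [← LinearMap.comp_apply, ← TensorProduct.map_comp, LinearMap.comp_id, ← apply_leftHit,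
      LinearMap.comp_apply, LinearMap.sub_apply, hP' _ (hl f x hx), LinearMap.id_apply, sub_self,
      map_zero, map_zero]
  rw [map_sub_left, TensorProduct.map_id, LinearMap.id_apply, sub_eq_zero] at h1
  rw [map_sub_right, TensorProduct.map_id, LinearMap.id_apply, sub_eq_zero] at h2
  rw [h1, h2, ← LinearMap.comp_apply, ← TensorProduct.map_comp]
  exact map_mem_tensorSub (fun x _ => hP x) (fun x _ => hP x) (mem_tensorSub_top _)

lemma IsSubcoalgebra.leftHit_mem {X : Submodule k C} (hX : IsSubcoalgebra k X) (f : C →ₗ[k] k)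
    {x : C} (hx : x ∈ X) : leftHit f x ∈ X := by
  have : tensorSub k X X ≤ X.comap ((TensorProduct.lid k C).toLinearMap ∘ₗ f.rTensor C) :=
    tensorSub_le.2 fun a _ b hb => by simpa using X.smul_mem (f a) hb
  exact this (hX x hx)

lemma IsSubcoalgebra.rightHit_mem {X : Submodule k C} (hX : IsSubcoalgebra k X) (f : C →ₗ[k] k)
    {x : C} (hx : x ∈ X) : rightHit f x ∈ X := by
  have : tensorSub k X X ≤ X.comap ((TensorProduct.rid k C).toLinearMap ∘ₗ f.lTensor C) :=
    tensorSub_le.2 fun a ha b _ => by simpa using X.smul_mem (f b) ha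
  exact this (hX x hx)

/-- An isotypic component is stable under endomorphisms, hence under right hits, so it is a
subcoalgebra. A nonzero subcoalgebra E inside it contains a simple submodule S isomorphic to M. Any
other copy of M is the image of S under a module map, which is a right hit and so stays in E. -/
lemma isSimpleSubcoalgebra_isotypicComponent (M : Submodule (HitAlgebra k C) C)
    [IsSimpleModule (HitAlgebra k C) M] : IsSimpleSubcoalgebra k
      ((isotypicComponent (HitAlgebra k C) C M).restrictScalars k) := by
  set I := isotypicComponent (HitAlgebra k C) C M with hI
  refine ⟨isSubcoalgebra_of_hit (fun f x hx => leftHit_mem_submodule I f hx) (fun g x hx => ?_),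
    ?_, fun E hE hEI => ?_⟩
  · exact LinearMap.le_comap_isotypicComponent M (rightHitLin g) hx
  · intro h0
    have : I = ⊥ := by
      rw [eq_bot_iff]
      intro x hx
      exact (Submodule.mem_bot k).1 (h0 ▸ (show x ∈ I.restrictScalars k from hx))
    exact (bot_lt_isotypicComponent (R := HitAlgebra k C) M).ne' this
  · let E' := hitSubmodule E fun f x hx => hE.leftHit_mem f hx
    have hE'I : E' ≤ I := hEI
    -- Submodules of a semisimple module are semisimple; this provides the simple submodule of E.
    have hss : IsSemisimpleModule (HitAlgebra k C) E' :=
      IsSemisimpleModule.of_injective (Submodule.inclusion hE'I) (Submodule.inclusion_injective _)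
    rcases IsSemisimpleModule.eq_bot_or_exists_simple_le E' with h0 | ⟨S, hSE, hS⟩
    · left
      rw [eq_bot_iff]
      intro x hx
      have : x ∈ E' := hx
      rw [h0] at this
      simpa using this
    · right
      refine le_antisymm hEI ?_
      obtain ⟨e⟩ := isIsotypicOfType_submodule_iff.1
        (IsIsotypicOfType.isotypicComponent (R := HitAlgebra k C) (M := C) (S := M)) S
        (hSE.trans hE'I)
      have : I ≤ E' := by
        refine sSup_le ?_
        rintro m ⟨e'⟩
        obtain ⟨g, hg⟩ := exists_rightHit_eq S
          (m.subtype ∘ₗ (e.trans e'.symm).toLinearMap)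
        intro x hx
        obtain ⟨y, hy⟩ := (e.trans e'.symm).surjective ⟨x, hx⟩
        have hxy : x = rightHit g (y : C) := by
          rw [← hg y]
          simp only [LinearMap.comp_apply, LinearEquiv.coe_coe, hy]
          rfl
        rw [hxy]
        exact hE.rightHit_mem g (hSE y.2)
      exact this

lemma simple_le_coradical (M : Submodule (HitAlgebra k C) C) [IsSimpleModule (HitAlgebra k C) M]
    {x : C} (hx : x ∈ M) : x ∈ coradical k C :=
  (le_sSup (show _ ∈ {D | IsSimpleSubcoalgebra k D} from
    isSimpleSubcoalgebra_isotypicComponent M)) (M.le_isotypicComponent hx)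

/-- Each step of the filtration is a left coideal: a map vanishing on Cₙ, applied to the second leg,
kills Δ(Cₙ). -/
lemma leftHit_mem_coradFilt (n : ℕ) (f : C →ₗ[k] k) {x : C} (hx : x ∈ coradFilt k C n) :
    leftHit f x ∈ coradFilt k C n := by
  obtain ⟨P, hP, hP'⟩ := exists_proj (coradFilt k C n)
  have h := map_comul_eq_zero_right f (g := LinearMap.id - P) (fun x hx => by simp [hP' x hx]) hx
  have e : leftHit f x - P (leftHit f x) = 0 := by
    have := congrArg (TensorProduct.lid k C) h
    rw [map_zero] at this
    rw [← this]
    simp only [leftHit, LinearMap.comp_apply]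
    clear h this
    induction comul (R := k) x with
    | zero => simp
    | add x y hx hy =>
      simp only [map_add, ← hx, ← hy]
      abel
    | tmul x y => simp [smul_sub]
  rw [sub_eq_zero.1 e]
  exact hP _

/-- The left coideal generated by x lies in the span of the finitely many second legs of an
expression of Δ(x). -/
lemma finite_span_hit (x : C) :
    Module.Finite k ((Submodule.span (HitAlgebra k C) {x}).restrictScalars k) := by
  obtain ⟨s, hs⟩ := TensorProduct.exists_finset (R := k) (comul (R := k) x)
  let W : Submodule k C := Submodule.span k (Prod.snd '' (s : Set (C × C)))
  have hW : Module.Finite k W := Module.Finite.span_of_finite k (s.finite_toSet.image _)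
  have hle : (Submodule.span (HitAlgebra k C) {x}).restrictScalars k ≤ W := by
    intro y hy
    obtain ⟨a, rfl⟩ := Submodule.mem_span_singleton.1 hy
    obtain ⟨f, rfl⟩ := HitAlgebra.exists_of_eq a
    change leftHit f x ∈ W
    simp only [leftHit, LinearMap.comp_apply, hs, map_sum]
    refine sum_mem fun p hp => ?_
    simpa using W.smul_mem _ (Submodule.subset_span ⟨p, hp, rfl⟩)
  exact Submodule.finiteDimensional_of_le hle

/-- If `g(y₂) y₁` lies in the coradical for all `g` vanishing on `Cₙ` then `y ∈ Cₙ₊₁`. -/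
lemma mem_coradFilt_succ_of_rightHit {n : ℕ} {y : C} (H : ∀ g : C →ₗ[k] k,
    (∀ x ∈ coradFilt k C n, g x = 0) → rightHit g y ∈ coradical k C) :
    y ∈ coradFilt k C (n + 1) := by
  rw [mem_coradFilt_succ]
  apply mem_of_map_mkQ_eq_zero
  refine tensor_eq_zero_of_forall_dual fun f g => ?_
  apply (TensorProduct.lid k k).injective
  rw [← LinearMap.comp_apply, ← TensorProduct.map_comp, ← apply_rightHit, map_zero]
  have := H (g ∘ₗ (coradFilt k C n).mkQ) (fun x hx => by
    rw [LinearMap.comp_apply, Submodule.mkQ_apply, (Submodule.Quotient.mk_eq_zero _).2 hx,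
      map_zero])
  rw [LinearMap.comp_apply, Submodule.mkQ_apply, (Submodule.Quotient.mk_eq_zero _).2 this, map_zero]

/-- By Schur's lemma ψ is zero or injective on S, and in the second case the image is a simple left
coideal. -/
lemma map_simple_mem_coradical {Q : Type*} [AddCommGroup Q] [Module (HitAlgebra k C) Q]
    (S : Submodule (HitAlgebra k C) Q) [IsSimpleModule (HitAlgebra k C) S]
    (ψ : Q →ₗ[HitAlgebra k C] C) {x : Q} (hx : x ∈ S) : ψ x ∈ coradical k C := by
  rcases LinearMap.injective_or_eq_zero (ψ ∘ₗ S.subtype) with hinj | h0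
  · have : IsSimpleModule (HitAlgebra k C) (LinearMap.range (ψ ∘ₗ S.subtype)) :=
      IsSimpleModule.congr (LinearEquiv.ofInjective _ hinj).symm
    exact simple_le_coradical (LinearMap.range (ψ ∘ₗ S.subtype)) ⟨⟨x, hx⟩, rfl⟩
  · have : ψ x = 0 := LinearMap.congr_fun h0 ⟨x, hx⟩
    rw [this]
    exact zero_mem _

/-- The coradical filtration is exhaustive. -/
theorem exists_mem_coradFilt (x : C) : ∃ n, x ∈ coradFilt k C n := by
  set N := Submodule.span (HitAlgebra k C) {x} with hN
  have hfin : Module.Finite k (N.restrictScalars k) := finite_span_hit x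
  have hfin' : Module.Finite k N := hfin
  -- The left coideal N generated by x is finite-dimensional, so the chain N ∩ Cₙ becomes
  -- stationary.
  obtain ⟨n, hn⟩ := monotone_stabilizes_iff_noetherian.2
    (inferInstance : IsNoetherian k (N.restrictScalars k))
    ⟨fun n => (coradFilt k C n).comap (N.restrictScalars k).subtype,
      fun _ _ h => Submodule.comap_mono (coradFilt_mono h)⟩
  have hstab : ∀ y ∈ N, y ∈ coradFilt k C (n + 1) → y ∈ coradFilt k C n := fun y hy hy' => by
    have := hn (n + 1) (Nat.le_succ n)
    have h' : (⟨y, hy⟩ : N.restrictScalars k) ∈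
      (coradFilt k C (n + 1)).comap (N.restrictScalars k).subtype := hy'
    exact (SetLike.ext_iff.1 this ⟨y, hy⟩).2 h'
  refine ⟨n, ?_⟩
  let F := hitSubmodule (coradFilt k C n) fun f x hx => leftHit_mem_coradFilt n f hx
  by_contra hx
  -- If x ∉ Cₙ, the image of N in C / Cₙ is nonzero and Artinian, so it has a simple submodule S. A
  -- representative y ∈ N of a nonzero class in S is shown to lie in Cₙ₊₁, contradicting stability.
  let N' := N.map F.mkQ
  have hN'fin : IsArtinian (HitAlgebra k C) N' := by
    have : IsArtinian k N := (inferInstance : IsArtinian k (N.restrictScalars k))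
    have : IsArtinian (HitAlgebra k C) N := isArtinian_of_tower k this
    exact isArtinian_of_surjective N (F.mkQ.submoduleMap N) (F.mkQ.submoduleMap_surjective N)
  have : Nontrivial N' := by
    refine ⟨⟨⟨F.mkQ x, x, Submodule.mem_span_singleton_self x, rfl⟩, 0, fun h => hx ?_⟩⟩
    exact (Submodule.Quotient.mk_eq_zero F).1 (congrArg Subtype.val h)
  obtain ⟨S, hS⟩ := IsAtomic.exists_atom (Submodule (HitAlgebra k C) N')
  have hS' : IsSimpleModule (HitAlgebra k C) S := isSimpleModule_iff_isAtom.2 hS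
  obtain ⟨⟨_, y, hyN, rfl⟩, hyS, hy0⟩ := S.exists_mem_ne_zero_of_ne_bot hS.1
  refine hy0 (Subtype.ext ((Submodule.Quotient.mk_eq_zero F).2 (hstab y hyN ?_)))
  refine mem_coradFilt_succ_of_rightHit fun g hg => ?_
  -- For z ∈ Cₙ, f(g(z₂) z₁) = g(f(z₁) z₂) = 0 because Cₙ is a left coideal. So the right hit by g
  -- factors through C / Cₙ and carries S into the coradical.
  have hker : F ≤ LinearMap.ker (rightHitLin g) := by
    intro z hz
    rw [LinearMap.mem_ker]
    change rightHit g z = 0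
    rw [← Module.forall_dual_apply_eq_zero_iff k]
    intro f
    rw [apply_rightHit, ← apply_leftHit]
    exact hg _ (leftHit_mem_coradFilt n f hz)
  exact map_simple_mem_coradical S (F.liftQ (rightHitLin g) hker ∘ₗ N'.subtype) hyS

end Exhaustion

/-! ### Lifting generators from the associated graded algebra -/

section Lifting

variable {k H : Type*} [Field k] [Ring H] [HopfAlgebra k H]

lemma GrC.mem_coradPred_of_cls_eq_zero {n : ℕ} {x : coradFilt k H n} (hx : cls n x = 0) :
    (x : H) ∈ coradPred k H n := by
  have h : DirectSum.of (grComp k H) n (Submodule.Quotient.mk x) = 0 := hx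
  exact (Submodule.Quotient.mk_eq_zero ((coradPred k H n).submoduleOf (coradFilt k H n))).1
    (DirectSum.of_injective (β := grComp k H) n (h.trans (map_zero _).symm))

variable [IsPointed k H]

/-- The span of the classes of the elements of `U`. -/
def grSubalgebra (U : Subalgebra k H) : Subalgebra k (GrC k H) :=
  (Submodule.span k {a | ∃ (n : ℕ) (x : coradFilt k H n),
    (x : H) ∈ U ∧ GrC.cls n x = a}).toSubalgebra
    (Submodule.subset_span ⟨0, ⟨1, one_mem_coradical⟩, U.one_mem, rfl⟩) (fun a b ha hb => by
      have := Submodule.mul_mem_mul ha hb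
      rw [Submodule.span_mul_span] at this
      refine Submodule.span_mono ?_ this
      rintro _ ⟨_, ⟨m, x, hx, rfl⟩, _, ⟨n, y, hy, rfl⟩, rfl⟩
      exact ⟨m + n, _, U.mul_mem hx hy, (GrC.cls_mul_cls x y).symm⟩)

/-- A span of homogeneous classes contains the homogeneous components of its elements, and in a
fixed degree combinations of classes of elements of U are again such classes. -/
lemma exists_lift_of_mem_grSubalgebra {U : Subalgebra k H} {a : GrC k H}
    (ha : a ∈ grSubalgebra U) (n : ℕ) : ∃ x : coradFilt k H n, (x : H) ∈ U ∧
      DirectSum.of (grComp k H) n ((show DirectSum ℕ (grComp k H) from a) n) = GrC.cls n x := by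
  change a ∈ Submodule.span k _ at ha
  induction ha using Submodule.span_induction with
  | mem a ha =>
    obtain ⟨m, x, hx, rfl⟩ := ha
    by_cases h : m = n
    · subst h
      refine ⟨x, hx, ?_⟩
      change DirectSum.of (grComp k H) m (DirectSum.of (grComp k H) m _ m) = _
      rw [DirectSum.of_eq_same]
      rfl
    · refine ⟨0, U.zero_mem, ?_⟩
      change DirectSum.of (grComp k H) n (DirectSum.of (grComp k H) m _ n) = _
      rw [DirectSum.of_eq_of_ne _ _ _ (Ne.symm h), map_zero, map_zero]
      rfl
  | zero => exact ⟨0, U.zero_mem, by rw [map_zero]; exact map_zero (DirectSum.of (grComp k H) n)⟩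
  | add a b _ _ ha hb =>
    obtain ⟨x, hx, hx'⟩ := ha
    obtain ⟨y, hy, hy'⟩ := hb
    refine ⟨x + y, U.add_mem hx hy, ?_⟩
    rw [map_add, ← hx', ← hy']
    exact map_add (DirectSum.of (grComp k H) n) _ _
  | smul c a _ ha =>
    obtain ⟨x, hx, hx'⟩ := ha
    refine ⟨c • x, U.smul_mem hx c, ?_⟩
    rw [map_smul, ← hx']
    exact map_smul (DirectSum.lof k ℕ (grComp k H) n) c _

/-- If the classes of the elements of `U` span `gr_c H` then `U = H`. -/
lemma eq_top_of_grSubalgebra_eq_top {U : Subalgebra k H} (hU : grSubalgebra U = ⊤) : U = ⊤ := by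
  have key : ∀ n, ∀ x ∈ coradFilt k H n, x ∈ U := by
    -- An element of Hₙ has the same class as some s ∈ U, and the difference lies in Hₙ₋₁.
    have step : ∀ n, (∀ x ∈ coradPred k H n, x ∈ U) → ∀ x ∈ coradFilt k H n, x ∈ U := by
      intro n ih x hx
      obtain ⟨s, hs, e⟩ := exists_lift_of_mem_grSubalgebra
        (show GrC.cls n ⟨x, hx⟩ ∈ grSubalgebra U by rw [hU]; trivial) n
      have e' : GrC.cls n ⟨x, hx⟩ = GrC.cls n s := by
        rw [← e]
        change _ = DirectSum.of (grComp k H) n (DirectSum.of (grComp k H) n _ n)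
        rw [DirectSum.of_eq_same]
        rfl
      have h0 : GrC.cls n (⟨x, hx⟩ - s) = 0 := by rw [map_sub, e', sub_self]
      have := U.add_mem (ih _ (GrC.mem_coradPred_of_cls_eq_zero h0)) hs
      simpa using this
    intro n
    induction n with
    | zero => exact step 0 fun x hx => by rw [show x = 0 from hx]; exact U.zero_mem
    | succ n ih => exact step (n + 1) ih
  rw [eq_top_iff]
  intro x _
  -- Exhaustiveness is what passes from the filtration steps to all of H.
  obtain ⟨n, hn⟩ := exists_mem_coradFilt (k := k) x
  exact key n x hn

/-- Take representatives in H of homogeneous classes summing to a. -/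
lemma exists_finset_lift (a : GrC k H) : ∃ t : Finset H, ∀ U : Subalgebra k H,
    (t : Set H) ⊆ U → a ∈ grSubalgebra U := by
  classical
  induction a using GrC.induction with
  | h0 => exact ⟨∅, fun U _ => zero_mem _⟩
  | hadd a b ha hb =>
    obtain ⟨s, hs⟩ := ha
    obtain ⟨t, ht⟩ := hb
    refine ⟨s ∪ t, fun U hU => ?_⟩
    rw [Finset.coe_union, Set.union_subset_iff] at hU
    exact add_mem (hs U hU.1) (ht U hU.2)
  | h n x =>
    exact ⟨{(x : H)}, fun U hU => Submodule.subset_span ⟨n, x, hU (by simp), rfl⟩⟩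

/-- If `gr_c H` is affine then so is `H`. -/
theorem finiteType_of_grC (h : Algebra.FiniteType k (GrC k H)) : Algebra.FiniteType k H := by
  classical
  obtain ⟨s, hs⟩ := h
  choose t ht using exists_finset_lift (k := k) (H := H)
  refine ⟨s.biUnion t, eq_top_of_grSubalgebra_eq_top ?_⟩
  rw [eq_top_iff, ← hs]
  refine Algebra.adjoin_le fun a ha => ht a _ fun x hx => Algebra.subset_adjoin ?_
  exact Finset.mem_biUnion.2 ⟨a, ha, hx⟩

end Lifting

/-! ### The associated graded Hopf algebra as a graded split projection -/

section GradedProjection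

open Coalgebra HopfAlgebra

variable {k H : Type*} [Field k] [Ring H] [HopfAlgebra k H]

lemma GrC.mem_component {n : ℕ} {a : GrC k H} :
    a ∈ component k H n ↔ ∃ x : coradFilt k H n, cls n x = a := by
  constructor
  · rintro ⟨y, rfl⟩
    obtain ⟨x, rfl⟩ := Submodule.mkQ_surjective _ y
    exact ⟨x, rfl⟩
  · rintro ⟨x, rfl⟩
    exact ⟨_, rfl⟩

lemma GrC.symb_mem_component {n : ℕ} {x : H} (hx : x ∈ coradFilt k H n) :
    symb (k := k) n x ∈ component k H n :=
  mem_component.2 ⟨⟨x, hx⟩, (symb_coe n _).symm⟩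

variable (k H) in
lemma GrC.isInternal_component : DirectSum.IsInternal (component k H) := by
  have h : ∀ n, Function.Injective (incl k H n) := fun n =>
    DirectSum.of_injective (β := grComp k H) n
  let e : DirectSum ℕ (grComp k H) ≃ₗ[k] DirectSum ℕ (fun n => component k H n) :=
    DFinsupp.mapRange.linearEquiv fun n => LinearEquiv.ofInjective (incl k H n) (h n)
  have he : (DirectSum.coeAddMonoidHom (component k H)) ∘ e = id := by
    funext a
    refine DirectSum.induction_on (motive := fun a =>
      DirectSum.coeAddMonoidHom (component k H) (e a) = a) a
      (by rw [map_zero, map_zero]; rfl) (fun n x => ?_) (fun a b ha hb => ?_)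
    · have : e (DirectSum.of (grComp k H) n x) = DirectSum.of (fun n => component k H n) n
          (LinearEquiv.ofInjective (incl k H n) (h n) x) :=
        DFinsupp.mapRange_single (f := fun n => LinearEquiv.ofInjective (incl k H n) (h n))
          (hf := fun n => map_zero _)
      rw [this]
      exact DirectSum.coeAddMonoidHom_of (component k H) n _
    · rw [map_add, map_add, ha, hb]
      rfl
  have hb : Function.Bijective (DirectSum.coeAddMonoidHom (component k H) ∘ e) := by
    rw [he]
    exact Function.bijective_id
  exact (Function.Bijective.of_comp_iff _ e.bijective).1 hb

lemma GrC.comul_mem_component {n : ℕ} {a : GrC k H} (ha : a ∈ component k H n) :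
    comul (R := k) a ∈ ⨆ p ∈ Finset.HasAntidiagonal.antidiagonal n,
      tensorSub k (component k H p.1) (component k H p.2) := by
  obtain ⟨x, rfl⟩ := mem_component.1 ha
  rw [comul_cls]
  have : tensorFilt k H n ≤ (⨆ p ∈ Finset.HasAntidiagonal.antidiagonal n,
      tensorSub k (component k H p.1) (component k H p.2)).comap (symb₂ n) := by
    refine tensorFilt_le fun i j hij x hx y hy => ?_
    rw [Submodule.mem_comap, symb₂_tmul hij hx hy]
    have hle : tensorSub k (component k H i) (component k H j) ≤
        ⨆ p ∈ Finset.HasAntidiagonal.antidiagonal n,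
          tensorSub k (component k H p.1) (component k H p.2) :=
      le_iSup₂_of_le (i, j) (by simpa using hij) le_rfl
    exact hle (tmul_mem_tensorSub (symb_mem_component hx) (symb_mem_component hy))
  exact this (comul_mem_tensorFilt x.2)

variable [IsPointed k H]

namespace GrC

variable (k H) in
/-- The inclusion of the coradical as the component of degree zero. -/
def inclZero : corad k H →ₐ[k] GrC k H :=
  AlgHom.ofLinearMap
    { toFun x := cls 0 ⟨x, x.2⟩
      map_add' x y := map_add (cls 0) (⟨x, x.2⟩ : coradFilt k H 0) ⟨y, y.2⟩
      map_smul' c x := map_smul (cls 0) c (⟨x, x.2⟩ : coradFilt k H 0) }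
    one_eq_cls.symm
    fun x y => (cls_mul_cls (⟨x, x.2⟩ : coradFilt k H 0) (⟨y, y.2⟩ : coradFilt k H 0)).symm

lemma inclZero_apply (x : corad k H) : inclZero k H x = cls 0 ⟨(x : H), x.2⟩ := rfl

lemma projZero_cls_zero (x : coradFilt k H 0) : projZero k H (cls 0 x) = ⟨x, x.2⟩ :=
  projZeroLin_cls_zero x

lemma projZero_cls_pos {n : ℕ} (hn : n ≠ 0) (x : coradFilt k H n) : projZero k H (cls n x) = 0 :=
  projZeroLin_cls_pos hn x

/-- Group-likes of H lie in the coradical and stay group-like there, since corad(H) ⊗ corad(H) → H ⊗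
H is injective. Pointedness makes them span. -/
lemma span_groupLike_corad : Submodule.span k {g : corad k H | IsGroupLikeElem k g} = ⊤ := by
  have h : ∀ {g : H} (hg : IsGroupLikeElem k g),
      IsGroupLikeElem k (⟨g, groupLike_mem_coradical hg⟩ : corad k H) := fun {g} hg =>
    ⟨hg.counit_eq_one, corad.incl₂_injective k H (by
      rw [corad.incl₂_comul, corad.incl₂_tmul]
      exact hg.comul_eq_tmul_self)⟩
  rw [eq_top_iff]
  rintro ⟨x, hx⟩ -
  have hx' : x ∈ Submodule.span k {g : H | IsGroupLikeElem k g} := by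
    rw [← coradical_eq_span]
    exact hx
  have : Submodule.span k {g : H | IsGroupLikeElem k g} ≤
      (Submodule.span k {g : corad k H | IsGroupLikeElem k g}).map
        (corad k H).val.toLinearMap :=
    Submodule.span_le.2 fun g hg => ⟨_, Submodule.subset_span (h hg), rfl⟩
  obtain ⟨y, hy, hyx⟩ := this hx'
  rwa [show (⟨x, hx⟩ : corad k H) = y from Subtype.ext hyx.symm]

lemma comul_inclZero (x : corad k H) : comul (R := k) (inclZero k H x) =
    TensorProduct.map (inclZero k H).toLinearMap (inclZero k H).toLinearMap
      (comul (R := k) x) := by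
  have h : symb₂ 0 ∘ₗ (corad.incl₂ k H).toLinearMap =
      TensorProduct.map (inclZero k H).toLinearMap (inclZero k H).toLinearMap :=
    TensorProduct.ext' fun a b => by
      rw [LinearMap.comp_apply, AlgHom.toLinearMap_apply, corad.incl₂_tmul,
        symb₂_tmul (i := 0) (j := 0) rfl a.2 b.2,
        symb_coe 0 ⟨(a : H), a.2⟩, symb_coe 0 ⟨(b : H), b.2⟩]
      rfl
  rw [inclZero_apply, comul_cls, ← h, LinearMap.comp_apply, AlgHom.toLinearMap_apply,
    corad.incl₂_comul]

/-- If i + j = n > 0, one of i and j is positive and the projection kills that leg. This is why the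
projection respects Δ in positive degrees. -/
lemma map_projZero_symb₂ {n : ℕ} (hn : n ≠ 0) {u : H ⊗[k] H} (hu : u ∈ tensorFilt k H n) :
    TensorProduct.map (projZero k H).toLinearMap (projZero k H).toLinearMap (symb₂ n u) = 0 := by
  have : tensorFilt k H n ≤ LinearMap.ker (TensorProduct.map (projZero k H).toLinearMap
      (projZero k H).toLinearMap ∘ₗ symb₂ n) := by
    refine tensorFilt_le fun i j hij x hx y hy => ?_
    rw [LinearMap.mem_ker, LinearMap.comp_apply, symb₂_tmul hij hx hy, TensorProduct.map_tmul,
      symb_coe i ⟨x, hx⟩, symb_coe j ⟨y, hy⟩, AlgHom.toLinearMap_apply, AlgHom.toLinearMap_apply]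
    rcases eq_or_ne i 0 with hi | hi
    · rw [projZero_cls_pos (by omega : j ≠ 0), TensorProduct.tmul_zero]
    · rw [projZero_cls_pos hi, TensorProduct.zero_tmul]
  exact this hu

lemma projZero_inclZero (x : corad k H) : projZero k H (inclZero k H x) = x :=
  projZero_cls_zero _

lemma comul_projZero (a : GrC k H) : comul (R := k) (projZero k H a) =
    TensorProduct.map (projZero k H).toLinearMap (projZero k H).toLinearMap
      (comul (R := k) a) := by
  induction a using induction with
  | h0 => simp
  | hadd a b ha hb => simp only [map_add, ha, hb]
  | h n x =>
    rcases eq_or_ne n 0 with rfl | hn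
    · have h := comul_inclZero (⟨x, x.2⟩ : corad k H)
      rw [inclZero_apply] at h
      rw [projZero_cls_zero, h, ← LinearMap.comp_apply, ← TensorProduct.map_comp]
      have e : (projZero k H).toLinearMap ∘ₗ (inclZero k H).toLinearMap = LinearMap.id :=
        LinearMap.ext projZero_inclZero
      rw [e, TensorProduct.map_id, LinearMap.id_apply]
    · rw [projZero_cls_pos hn, map_zero, comul_cls,
        map_projZero_symb₂ hn (comul_mem_tensorFilt x.2)]

lemma counit_projZero (a : GrC k H) :
    counit (R := k) (projZero k H a) = counit (R := k) a := by
  induction a using induction with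
  | h0 => simp
  | hadd a b ha hb => simp only [map_add, ha, hb]
  | h n x =>
    rcases eq_or_ne n 0 with rfl | hn
    · rw [projZero_cls_zero, counit_cls_zero]
      rfl
    · rw [projZero_cls_pos hn, counit_cls_pos hn, map_zero]

variable (k H) in
/-- The associated graded Hopf algebra with the projection onto its component of degree zero. -/
theorem isGradedProjection :
    IsGradedProjection (projZero k H) (inclZero k H) (component k H) where
  comul_proj := comul_projZero
  counit_proj := counit_projZero
  comul_incl := comul_inclZero
  counit_incl x := counit_cls_zero _
  proj_incl := projZero_inclZero
  span_groupLike := span_groupLike_corad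
  isInternal := isInternal_component k H
  mul_mem ha hb := by
    obtain ⟨x, rfl⟩ := mem_component.1 ha
    obtain ⟨y, rfl⟩ := mem_component.1 hb
    exact mem_component.2 ⟨_, (cls_mul_cls x y).symm⟩
  comul_mem := comul_mem_component
  antipode_mem ha := by
    obtain ⟨x, rfl⟩ := mem_component.1 ha
    exact mem_component.2 ⟨_, (antipode_cls _ x).symm⟩
  proj_eq_zero hn ha := by
    obtain ⟨x, rfl⟩ := mem_component.1 ha
    exact projZero_cls_pos hn x
  incl_mem x := mem_component.2 ⟨_, rfl⟩
  exists_incl a ha := by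
    obtain ⟨x, rfl⟩ := mem_component.1 ha
    exact ⟨⟨x, x.2⟩, rfl⟩

end GrC

end GradedProjection

end PointedHopf

end

theorem corollary2p3 {k H : Type*} [Field k] [Ring H] [HopfAlgebra k H]
    [PointedHopf.IsPointed k H]
    (hN : IsNoetherianRing (PointedHopf.GrC k H) ∨ IsNoetherianRing (PointedHopf.GrC k H)ᵐᵒᵖ) :
    Algebra.FiniteType k (PointedHopf.corad k H) ∧
    Algebra.FiniteType k (PointedHopf.GrC k H) ∧
    Algebra.FiniteType k H ∧
    Algebra.FiniteType k (PointedHopf.GrC.braidedPart k H) ∧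
    ∃ (D : PointedHopf.BraidedHopfData k (PointedHopf.corad k H)
        (PointedHopf.GrC.braidedPart k H))
      (Φ : PointedHopf.GrC.braidedPart k H ⊗[k] PointedHopf.corad k H ≃ₗ[k] PointedHopf.GrC k H),
      D.IsBraidedHopfAlgebra ∧
      D.IsGraded (PointedHopf.GrC.braidedComponent k H) ∧
      PointedHopf.GrC.braidedComponent k H 0 = Submodule.span k {1} ∧
      D.IsBiproductIso (PointedHopf.GrC.braidedComponent k H) (PointedHopf.GrC.component k H) Φ := by
  have h := PointedHopf.GrC.isGradedProjection k H
  obtain ⟨hK, hA, hB⟩ := h.finiteType hN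
  -- `braidedPart` and `braidedComponent` agree by definition with `coinv` and `coinvComponent` for
  -- the projection `projZero`.
  exact ⟨hK, hA, PointedHopf.finiteType_of_grC hA, hB, h.braided, h.biproductEquiv,
    h.isBraidedHopfAlgebra, h.isGraded, h.coinvComponent_zero,
    h.isBiproductIso h.map_biproductEquiv⟩
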